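/- \textbf{Setting.} Let $b,\sigma:[0,\infty)\to\mathbb R$ be locally Lipschitz with $\sigma>0$ on $(0,\infty)$, and let $X$ be the diffusion $dX_t=b(X_t)\,dt+\sigma(X_t)\,dW_t$, $X_0=x>0$. Let $p'(x)=\exp\bigl(-2\int_1^x b(s)\sigma^{-2}(s)\,ds\bigr)$ be the derivative of its scale function and $m(dx)=\frac{2}{\sigma^2(x)p'(x)}\,dx$ its speed measure; in Feller's classification, suppose that $0$ is inaccessible and $\infty$ is natural. Let $r:[0,\infty)\to\mathbb R$ be continuous and bounded with $r\ge r_0>0$, write $\Lambda_t=\int_0^t r(X_u)\,du$, and $$\mathscr L w=\tfrac12\sigma^2w''+bw'-rw ,\qquad R_F(x)=\mathbb E_x\Bigl[\int_0^\infty e^{-\Lambda_t}F(X_t)\,dt\Bigr].$$ Let $\varphi,\psi>0$ be the $C^2$ solutions of $\mathscr Lw=0$ on $(0,\infty)$ with $\varphi'<0<\psi'$ and $\lim_{x\downarrow0}\varphi(x)=\lim_{x\uparrow\infty}\psi(x)=\infty$ (each is unique up to a positive factor). Let $h$ and $k$ be real functions on $(0,\infty)$ such that: (i) $h$ is continuous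 and bounded from below, $\lim_{x\downarrow0}h(x)/r(x)$ exists in $\mathbb R$, and $\mathbb E_x[\int_0^\infty e^{-\Lambda_t}|h(X_t)|\,dt]<\infty$ for all $x>0$; (ii) $k$ is (locally) absolutely continuous, $\int_0^1|k(s)|\,ds<\infty$, $K(x):=\int_0^xk(s)\,ds$ is bounded from below, $\mathbb E_x[\int_0^\infty e^{-\Lambda_t}|\mathscr LK(X_t)|\,dt]<\infty$ for all $x>0$, and $\limsup_{x\uparrow\infty}K(x)/\psi(x)\in[0,\infty)$; (iii) $\Theta:=h+\mathscr LK$ is continuous and, for some $\xi\in(0,\infty)$, $\Theta/r$ is strictly increasing on $(0,\xi)$ and strictly decreasing on $(\xi,\infty)$. Put $q=R_\Theta'/\psi'$ on $(0,\infty)$ and $$\underline x=\inf\{s>0: q'(s)>0\},\qquad \overline x=\inf\Bigl\{s>0: q(s)>\lim_{x\downarrow0}q(x)\Bigr\}\qquad(\inf\emptyset=\infty),$$ $$F(\gamma,\beta)=\int_\gamma^\beta\bigl(q(s)-q(\beta)\bigr)\psi'(s)\,ds ,\qquad 0\le\gamma<\beta<\infty .$$ \textbf{Claim.} Suppose that $\underline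 x<\infty$ and $\overline x<\infty$. Then $q'<0$ on $(0,\underline x)$ and $q'>0$ on $(\underline x,\infty)$; the limits $K_\infty=\lim_{x\uparrow\infty}K(x)/\psi(x)\ge0$, $R_h(0)=\lim_{x\downarrow0}R_h(x)$ and $\psi(0)=\lim_{x\downarrow0}\psi(x)$ exist in $\mathbb R$; for each $\beta\in(\underline x,\overline x)$ there is a unique $\Gamma(\beta)\in(0,\underline x)$ with $q(\Gamma(\beta))=q(\beta)$; the limit $$c^\star:=-\lim_{\beta\uparrow\overline x}F(\Gamma(\beta),\beta)$$ exists in $(0,\infty)$; and the following hold. (I) There exist $c^\circ\in(c^\star,\infty]$ and a strictly increasing function $\beta^\circ:[c^\star,c^\circ)\to[\overline x,\infty)$ such that $F(0,\beta^\circ(c))=-c$ for all $c\in[c^\star,c^\circ)$ and $\lim_{c\uparrow c^\circ}\beta^\circ(c)=\infty$. (II) $c^\circ=\infty$ if and only if $\lim_{x\uparrow\infty}\Theta(x)/r(x)=-\infty$. (III) Given any $c\in[c^\star,c^\circ)$, write $\beta^\circ=\beta^\circ(c)$. The function $$w(x)=\begin{cases}R_h(x)+\bigl(K_\infty-q(\beta^\circ)\bigr)\psi(x),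 & 0<x<\beta^\circ,\\ R_h(0)+\bigl(K_\infty-q(\beta^\circ)\bigr)\psi(0)+\int_0^xk(s)\,ds-c, & x\ge\beta^\circ,\end{cases}$$ is $C^1$ on $(0,\infty)$ and $C^2$ on $(0,\infty)\setminus\{\beta^\circ\}$, it is bounded from below, its derivative $w'$ is locally absolutely continuous, and it satisfies the HJB equation $$\max\Bigl\{\mathscr Lw(x)+h(x),\ -c+\sup_{z\in[0,x)}\int_{x-z}^x\bigl(k(s)-w'(s)\bigr)\,ds\Bigr\}=0\qquad\text{for Lebesgue-a.e. }x>0 .$$ -/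

import Mathlib

open MeasureTheory ProbabilityTheory Filter Topology Set
open scoped NNReal ENNReal

namespace ImpulseControl

noncomputable section

/-! ### The uncontrolled diffusion -/

/-- The operator `½ σ² w'' + b w' - r w`. For `r = 0` this is the generator of the diffusion. -/
def opL (b σ r : ℝ → ℝ) (w : ℝ → ℝ) (x : ℝ) : ℝ :=
  (1 / 2) * σ x ^ 2 * deriv (deriv w) x + b x * deriv w x - r x * w x

/-- The derivative `p'` of the scale function `p` with `p 1 = 0` and `p' 1 = 1`. -/
def scaleDeriv (b σ : ℝ → ℝ) (x : ℝ) : ℝ :=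
  Real.exp (-2 * ∫ s in (1 : ℝ)..x, b s / σ s ^ 2)

/-- The density `2 / (σ² p')` of the speed measure. -/
def speedDensity (b σ : ℝ → ℝ) (x : ℝ) : ℝ :=
  2 / (σ x ^ 2 * scaleDeriv b σ x)

/-- The coefficients are locally Lipschitz on `[0, ∞[` and `σ > 0` on `]0, ∞[`. -/
structure RegularCoefficients (b σ : ℝ → ℝ) : Prop where
  drift_lip : LocallyLipschitzOn (Ici (0 : ℝ)) b
  vol_lip : LocallyLipschitzOn (Ici (0 : ℝ)) σ
  vol_pos : ∀ x, 0 < x → 0 < σ x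

/-- Feller: the boundary point `0` is inaccessible (not exit and not regular), that is,
`∫_{]0,1[} m(]y,1[) p(dy) = ∞`. -/
def ZeroInaccessible (b σ : ℝ → ℝ) : Prop :=
  ∫⁻ y in Ioo (0 : ℝ) 1, (∫⁻ z in Ioo y 1, ENNReal.ofReal (speedDensity b σ z)) *
    ENNReal.ofReal (scaleDeriv b σ y) = ∞

/-- Feller: the boundary point `∞` is natural, that is,
`∫_{]1,∞[} m(]1,y[) p(dy) = ∞` (it is inaccessible) and
`∫_{]1,∞[} (p(y) - p(1)) m(dy) = ∞` (it is not entrance). -/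
def InftyNatural (b σ : ℝ → ℝ) : Prop :=
  (∫⁻ y in Ioi (1 : ℝ), (∫⁻ z in Ioo 1 y, ENNReal.ofReal (speedDensity b σ z)) *
      ENNReal.ofReal (scaleDeriv b σ y) = ∞) ∧
  (∫⁻ y in Ioi (1 : ℝ), (∫⁻ z in Ioo 1 y, ENNReal.ofReal (scaleDeriv b σ z)) *
      ENNReal.ofReal (speedDensity b σ y) = ∞)

/-- `X` is a non-explosive solution, with continuous paths in `]0, ∞[` and initial state `x`,
of the SDE `dX = b(X) dt + σ(X) dW`, in the sense of the (Stroock-Varadhan) martingale problem: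
for every `C²` function `f` with compact support in `]0, ∞[`, the process
`f(X_t) - ∫_0^t (½ σ² f'' + b f')(X_s) ds` is a martingale. -/
structure IsDiffusion (b σ : ℝ → ℝ) {Ω : Type*} [mΩ : MeasurableSpace Ω]
    (𝓕 : Filtration ℝ≥0 mΩ) (P : Measure Ω) (x : ℝ) (X : ℝ≥0 → Ω → ℝ) : Prop where
  adapted : ∀ t, Measurable[𝓕 t] (X t)
  cont : ∀ ω, Continuous fun t => X t ω
  pos : ∀ ω t, 0 < X t ω
  init : ∀ᵐ ω ∂P, X 0 ω = x
  martingale : ∀ f : ℝ → ℝ, ContDiff ℝ 2 f → HasCompactSupport f → tsupport f ⊆ Ioi 0 →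
    Martingale (fun (t : ℝ≥0) ω => f (X t ω) -
      ∫ s in (0 : ℝ)..t, opL b σ 0 f (X s.toNNReal ω)) 𝓕 P

/-- The cumulative discounting rate `Λ_t = ∫_0^t r(X_u) du`. -/
def cumRate (r : ℝ → ℝ) {Ω : Type*} (X : ℝ≥0 → Ω → ℝ) (t : ℝ) (ω : Ω) : ℝ :=
  ∫ u in (0 : ℝ)..t, r (X u.toNNReal ω)

/-- The integrability condition `E_x [∫_0^∞ e^{-Λ_t} |F(X_t)| dt] < ∞` for all `x > 0`;
`X x` is the diffusion started at `x`. -/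
def DiscountedIntegrable (r : ℝ → ℝ) {Ω : Type*} [MeasurableSpace Ω] (P : Measure Ω)
    (X : ℝ → ℝ≥0 → Ω → ℝ) (F : ℝ → ℝ) : Prop :=
  ∀ x, 0 < x → ∫⁻ ω, (∫⁻ t in Ioi (0 : ℝ),
    ENNReal.ofReal (Real.exp (-cumRate r (X x) t ω) * |F (X x t.toNNReal ω)|)) ∂P < ∞

/-- `R_F(x) = E_x [∫_0^∞ e^{-Λ_t} F(X_t) dt]`. -/
def RF (r : ℝ → ℝ) {Ω : Type*} [MeasurableSpace Ω] (P : Measure Ω)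
    (X : ℝ → ℝ≥0 → Ω → ℝ) (F : ℝ → ℝ) (x : ℝ) : ℝ :=
  ∫ ω, (∫ t in Ioi (0 : ℝ),
    Real.exp (-cumRate r (X x) t ω) * F (X x t.toNNReal ω)) ∂P

/-! ### Discounting, fundamental solutions and payoff functions -/

/-- The discounting rate is continuous, bounded, and bounded away from `0` on `[0, ∞[`. -/
structure DiscountRate (r : ℝ → ℝ) : Prop where
  cont : ContinuousOn r (Ici 0)
  bdd : ∃ r₁, ∀ x, 0 ≤ x → r x ≤ r₁
  lower : ∃ r₀, 0 < r₀ ∧ ∀ x, 0 ≤ x → r₀ ≤ r x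

/-- `φ` and `ψ` are the decreasing and the increasing fundamental solutions of
`½ σ² w'' + b w' - r w = 0` on `]0, ∞[`; these properties determine each of the two up to a
positive multiplicative constant. -/
structure FundamentalSolutions (b σ r φ ψ : ℝ → ℝ) : Prop where
  phi_smooth : ContDiffOn ℝ 2 φ (Ioi 0)
  psi_smooth : ContDiffOn ℝ 2 ψ (Ioi 0)
  phi_ode : ∀ x, 0 < x → opL b σ r φ x = 0
  psi_ode : ∀ x, 0 < x → opL b σ r ψ x = 0
  phi_pos : ∀ x, 0 < x → 0 < φ x
  psi_pos : ∀ x, 0 < x → 0 < ψ x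
  phi_decr : ∀ x, 0 < x → deriv φ x < 0
  psi_incr : ∀ x, 0 < x → 0 < deriv ψ x
  phi_zero : Tendsto φ (𝓝[>] 0) atTop
  psi_infty : Tendsto ψ atTop atTop

/-- The primitive `x ↦ ∫_0^x k(s) ds`. -/
def primK (k : ℝ → ℝ) (x : ℝ) : ℝ := ∫ s in (0 : ℝ)..x, k s

/-- `Θ = h + 𝓛 (∫_0^· k(s) ds)`. -/
def Theta (b σ r h k : ℝ → ℝ) (x : ℝ) : ℝ := h x + opL b σ r (primK k) x

/-- The standing conditions on the running payoff `h` and the marginal profit `k`. -/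
structure PayoffConditions (b σ r h k ψ : ℝ → ℝ) {Ω : Type*} [MeasurableSpace Ω]
    (P : Measure Ω) (X : ℝ → ℝ≥0 → Ω → ℝ) : Prop where
  h_cont : ContinuousOn h (Ioi 0)
  h_bdd : BddBelow (h '' Ioi 0)
  h_lim : ∃ l : ℝ, Tendsto (fun x => h x / r x) (𝓝[>] 0) (𝓝 l)
  h_int : DiscountedIntegrable r P X h
  k_ac : ∀ u v, 0 < u → u ≤ v → AbsolutelyContinuousOnInterval k u v
  k_int : IntegrableOn k (Ioc 0 1)
  k_bdd : BddBelow (primK k '' Ioi 0)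
  Lk_int : DiscountedIntegrable r P X (opL b σ r (primK k))
  k_growth : ∃ l : ℝ, 0 ≤ l ∧
    limsup (fun x => ((primK k x / ψ x : ℝ) : EReal)) atTop = (l : EReal)
  theta_cont : ContinuousOn (Theta b σ r h k) (Ioi 0)
  theta_shape : ∃ ξ : ℝ, 0 < ξ ∧
    StrictMonoOn (fun x => Theta b σ r h k x / r x) (Ioo 0 ξ) ∧
    StrictAntiOn (fun x => Theta b σ r h k x / r x) (Ioi ξ)

/-! ### Critical points and the free-boundary function

In this part, `q` stands for the function `R_Θ' / ψ'`. -/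

/-- The ratio `R' / ψ'`. -/
def ratio (R ψ : ℝ → ℝ) (x : ℝ) : ℝ := deriv R x / deriv ψ x

/-- The point `x̲ = inf {s > 0 | q'(s) > 0}`, with `inf ∅ = ⊤`: the derivative of `q` changes
sign once, from negative to positive, and it does so at `x̲`. -/
def xLower (q : ℝ → ℝ) : EReal :=
  sInf ((fun s : ℝ => (s : EReal)) '' {s | 0 < s ∧ 0 < deriv q s})

/-- The point `x̄ = inf {s > 0 | q(s) > lim_{x ↓ 0} q(x)}`, with `inf ∅ = ⊤`. -/
def xUpper (q : ℝ → ℝ) : EReal :=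
  sInf ((fun s : ℝ => (s : EReal)) ''
    {s | 0 < s ∧ limUnder (𝓝[>] (0 : ℝ)) (fun x => (q x : EReal)) < (q s : EReal)})

/-- The free-boundary function `F(γ, β) = ∫_γ^β (q(s) - q(β)) ψ'(s) ds`, for `0 ≤ γ < β`. -/
def freeBdry (q ψ : ℝ → ℝ) (γ β : ℝ) : ℝ :=
  ∫ s in γ..β, (q s - q β) * deriv ψ s

/-- `c⋆ = - lim_{β ↑ x̄} F(Γ(β), β)`, where, for `β ∈ ]x̲, x̄[`, `Γ(β)` is the unique point of
`]0, x̲[` such that `q(Γ(β)) = q(β)`. Here, `xl` and `xu` are the points `x̲` and `x̄`, assumed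
finite. -/
def IsCriticalCost (q ψ : ℝ → ℝ) (xl xu cstar : ℝ) : Prop :=
  ∃ Γ : ℝ → ℝ,
    (∀ β ∈ Ioo xl xu, Γ β ∈ Ioo 0 xl ∧ ∀ γ ∈ Ioo 0 xl, (q γ = q β ↔ γ = Γ β)) ∧
    Tendsto (fun β => -freeBdry q ψ (Γ β) β) (𝓝[<] xu) (𝓝 cstar)

/-! ### The HJB equation -/

/-- `w` is `C¹` on `]0, ∞[` with locally absolutely continuous derivative, and
`max {𝓛w(x) + h(x), -c + sup_{z ∈ [0,x[} ∫_{x-z}^x (k(s) - w'(s)) ds} = 0` for Lebesgue almost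
every `x > 0`; the supremum is taken in the extended reals. -/
def SolvesHJB (b σ r h k : ℝ → ℝ) (c : ℝ) (w : ℝ → ℝ) : Prop :=
  ContDiffOn ℝ 1 w (Ioi 0) ∧
  (∀ u v, 0 < u → u ≤ v → AbsolutelyContinuousOnInterval (deriv w) u v) ∧
  ∀ᵐ x ∂(volume.restrict (Ioi (0 : ℝ))),
    max ((opL b σ r w x + h x : ℝ) : EReal)
      (((-c : ℝ) : EReal) +
        ⨆ z ∈ Ico 0 x, ((∫ s in (x - z)..x, (k s - deriv w s) : ℝ) : EReal)) = 0

/-- The candidate value function with `γ = 0` and free-boundary point `β`. The constants `Kinf`,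
`R0`, `psi0` stand for `K_∞`, `R_h(0)`, `ψ(0)`. -/
def wZero (Rh q ψ k : ℝ → ℝ) (Kinf R0 psi0 c β : ℝ) (x : ℝ) : ℝ :=
  if x < β then Rh x + (Kinf - q β) * ψ x
  else R0 + (Kinf - q β) * psi0 + primK k x - c

end

end ImpulseControl

namespace ImpulseControl

/-! ### Scale function, speed measure and flux -/

/-! The probabilistic input is a single fact: the resolvent R_F is the Green operator (φ(x) ∫_0^x ψF
dm + ψ(x) ∫_x^∞ φF dm)/C, where C is the Wronskian (`RF_eq_green`). It follows from the martingale
problem alone, without stopping times. For F of compact support, the Green potential u is multiplied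
by a cut-off function, and Dynkin's formula is applied with the discounting rate r + W_n, where W_n
dominates the cut-off error. The expected discounted total of a rate under its own discounting is 1,
and the share of r tends to 1, so the share of W_n, and with it the error, vanishes
(`IsDiffusion.discExp_eq_green_of_compact`).

The rest is real analysis. Let Ψ = ψ'/p', θ = Θ/r and A(x) = ∫_0^x Θψ dm. The Wronskian and the
quotient rule give q' = κ(A − θΨ) with κ > 0, and R_Θ − qψ = A/Ψ (`freeBoundaryData`). Since dA = θ
dΨ and both functions vanish at 0, A/Ψ is the Ψ-average of θ over (0, x). As θ rises and then falls,
A − θΨ changes sign at most once, from negative to positive (`Q_neg`, `Q_strictMono`).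

The function H(β) = −F(0, β) satisfies H' = q'(ψ − ψ(0)), so it increases strictly beyond x̲. Hence
c⋆ = H(x̄), c° is the supremum of H on [x̄, ∞), and β° is the inverse of H. Because H = −A/Ψ − qψ(0)
+ R_Θ(0+), with q bounded on [x̄, ∞) and Ψ → ∞ (as ∞ is natural), H is unbounded exactly when θ → −∞
(`ccirc_eq_top_iff`).

For part (III), K + R_{𝓛K} solves the homogeneous equation and is o(φ) at 0, so it equals K_∞ψ. With
E = R_Θ − q(β°)ψ this turns the candidate into w(x) = K(x) + E(min(x, β°)). The derivative E' = (q −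
q(β°))ψ' vanishes at β° (smooth fit) and is nonpositive before it, so no impulse gains more than
E(0+) − E(β°) = c. Beyond β° the inequality to check is θ ≤ E(β°) = A(β°)/Ψ(β°), which is a
consequence of q'(β°) > 0 (`solvesHJB_candidate`, `θ_lt`). -/

lemma contDiffOn_two_of_hasDerivAt {u u₁ u₂ : ℝ → ℝ} {s : Set ℝ} (hs : IsOpen s)
    (h₁ : ∀ x ∈ s, HasDerivAt u (u₁ x) x) (h₂ : ∀ x ∈ s, HasDerivAt u₁ (u₂ x) x)
    (hc : ContinuousOn u₂ s) : ContDiffOn ℝ 2 u s := by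
  have e₂ : ContDiffOn ℝ 1 u₁ s := by
    rw [show (1 : WithTop ℕ∞) = 0 + 1 from rfl, contDiffOn_succ_iff_deriv_of_isOpen hs]
    refine ⟨fun x hx => (h₂ x hx).differentiableAt.differentiableWithinAt, by simp, ?_⟩
    rw [contDiffOn_zero]
    exact hc.congr fun x hx => (h₂ x hx).deriv
  rw [show (2 : WithTop ℕ∞) = 1 + 1 from rfl, contDiffOn_succ_iff_deriv_of_isOpen hs]
  refine ⟨fun x hx => (h₁ x hx).differentiableAt.differentiableWithinAt, by simp, ?_⟩
  exact e₂.congr fun x hx => (h₁ x hx).deriv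

lemma hasDerivAt_of_contDiffOn_two {w : ℝ → ℝ} {s : Set ℝ} (hs : IsOpen s)
    (hw : ContDiffOn ℝ 2 w s) {x : ℝ} (hx : x ∈ s) :
    HasDerivAt w (deriv w x) x ∧ HasDerivAt (deriv w) (deriv (deriv w) x) x := by
  rw [show (2 : WithTop ℕ∞) = 1 + 1 from rfl, contDiffOn_succ_iff_deriv_of_isOpen hs] at hw
  refine ⟨((hw.1 x hx).differentiableAt (hs.mem_nhds hx)).hasDerivAt, ?_⟩
  exact (((hw.2.2).differentiableOn one_ne_zero x hx).differentiableAt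
    (hs.mem_nhds hx)).hasDerivAt

lemma continuousOn_derivs_of_contDiffOn_two {w : ℝ → ℝ} {s : Set ℝ} (hs : IsOpen s)
    (hw : ContDiffOn ℝ 2 w s) :
    ContinuousOn w s ∧ ContinuousOn (deriv w) s ∧ ContinuousOn (deriv (deriv w)) s := by
  have h := hw
  rw [show (2 : WithTop ℕ∞) = 1 + 1 from rfl, contDiffOn_succ_iff_deriv_of_isOpen hs] at h
  exact ⟨hw.continuousOn, h.2.2.continuousOn,
    h.2.2.continuousOn_deriv_of_isOpen hs le_rfl⟩

variable {b σ r φ ψ : ℝ → ℝ}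

lemma scaleDeriv_pos (b σ : ℝ → ℝ) (x : ℝ) : 0 < scaleDeriv b σ x := Real.exp_pos _

lemma RegularCoefficients.continuousOn_drift (hcoef : RegularCoefficients b σ) :
    ContinuousOn b (Ioi 0) := hcoef.drift_lip.continuousOn.mono Ioi_subset_Ici_self

lemma RegularCoefficients.continuousOn_vol (hcoef : RegularCoefficients b σ) :
    ContinuousOn σ (Ioi 0) := hcoef.vol_lip.continuousOn.mono Ioi_subset_Ici_self

lemma DiscountRate.continuousOn_Ioi (hr : DiscountRate r) : ContinuousOn r (Ioi 0) :=
  hr.cont.mono Ioi_subset_Ici_self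

lemma DiscountRate.pos (hr : DiscountRate r) {x : ℝ} (hx : 0 < x) : 0 < r x := by
  obtain ⟨r₀, h, h'⟩ := hr.lower
  exact h.trans_le (h' x hx.le)

lemma hasDerivAt_scaleDeriv (hcoef : RegularCoefficients b σ) {x : ℝ} (hx : 0 < x) :
    HasDerivAt (scaleDeriv b σ) (-2 * (b x / σ x ^ 2) * scaleDeriv b σ x) x := by
  have hc : ContinuousOn (fun s => b s / σ s ^ 2) (Ioi 0) :=
    hcoef.continuousOn_drift.div (hcoef.continuousOn_vol.pow 2)
      fun y hy => (pow_pos (hcoef.vol_pos y hy) 2).ne'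
  have hsub : uIcc 1 x ⊆ Ioi 0 := fun y hy => by
    rcases (mem_uIcc.1 hy) with h | h <;> simp only [mem_Ioi] <;> linarith [h.1]
  have h := intervalIntegral.integral_hasDerivAt_right (hc.mono hsub).intervalIntegrable
    (hc.stronglyMeasurableAtFilter isOpen_Ioi x hx) (hc.continuousAt (Ioi_mem_nhds hx))
  refine (h.const_mul (-2)).exp.congr_deriv ?_
  simp only [scaleDeriv]
  ring

lemma continuousOn_scaleDeriv (hcoef : RegularCoefficients b σ) :
    ContinuousOn (scaleDeriv b σ) (Ioi 0) :=
  fun _ hx => (hasDerivAt_scaleDeriv hcoef hx).continuousAt.continuousWithinAt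

lemma speedDensity_pos (hcoef : RegularCoefficients b σ) {x : ℝ} (hx : 0 < x) :
    0 < speedDensity b σ x :=
  div_pos two_pos (mul_pos (pow_pos (hcoef.vol_pos x hx) 2) (scaleDeriv_pos b σ x))

lemma continuousOn_speedDensity (hcoef : RegularCoefficients b σ) :
    ContinuousOn (speedDensity b σ) (Ioi 0) :=
  continuousOn_const.div ((hcoef.continuousOn_vol.pow 2).mul (continuousOn_scaleDeriv hcoef))
    fun x hx => (mul_pos (pow_pos (hcoef.vol_pos x hx) 2) (scaleDeriv_pos b σ x)).ne'

/-- The derivative of `w` with respect to the scale function. -/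
noncomputable def flux (b σ w : ℝ → ℝ) (x : ℝ) : ℝ := deriv w x / scaleDeriv b σ x

lemma deriv_eq_scaleDeriv_mul_flux (b σ w : ℝ → ℝ) (x : ℝ) :
    deriv w x = scaleDeriv b σ x * flux b σ w x := by
  rw [flux, mul_div_cancel₀ _ (scaleDeriv_pos b σ x).ne']

/-- The generator is d/dm d/dp, with no first-order term left. The rate `r` is arbitrary: it is
subtracted inside `opL` and added back. -/
lemma hasDerivAt_flux (hcoef : RegularCoefficients b σ) (r : ℝ → ℝ) {w : ℝ → ℝ}
    (hw : ContDiffOn ℝ 2 w (Ioi 0)) {x : ℝ} (hx : 0 < x) :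
    HasDerivAt (flux b σ w) (speedDensity b σ x * (opL b σ r w x + r x * w x)) x := by
  have h := (hasDerivAt_of_contDiffOn_two isOpen_Ioi hw hx).2.div
    (hasDerivAt_scaleDeriv hcoef hx) (scaleDeriv_pos b σ x).ne'
  have h1 := (scaleDeriv_pos b σ x).ne'
  have h2 := (hcoef.vol_pos x hx).ne'
  refine h.congr_deriv ?_
  simp only [speedDensity, opL]
  field_simp
  ring

lemma FundamentalSolutions.hasDerivAt_psi (hfund : FundamentalSolutions b σ r φ ψ) {x : ℝ}
    (hx : 0 < x) : HasDerivAt ψ (deriv ψ x) x :=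
  (hasDerivAt_of_contDiffOn_two isOpen_Ioi hfund.psi_smooth hx).1

lemma FundamentalSolutions.hasDerivAt_phi (hfund : FundamentalSolutions b σ r φ ψ) {x : ℝ}
    (hx : 0 < x) : HasDerivAt φ (deriv φ x) x :=
  (hasDerivAt_of_contDiffOn_two isOpen_Ioi hfund.phi_smooth hx).1

lemma FundamentalSolutions.hasDerivAt_flux_psi (hfund : FundamentalSolutions b σ r φ ψ)
    (hcoef : RegularCoefficients b σ) {x : ℝ} (hx : 0 < x) :
    HasDerivAt (flux b σ ψ) (speedDensity b σ x * (r x * ψ x)) x := by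
  simpa [hfund.psi_ode x hx] using hasDerivAt_flux hcoef r hfund.psi_smooth hx

lemma FundamentalSolutions.hasDerivAt_flux_phi (hfund : FundamentalSolutions b σ r φ ψ)
    (hcoef : RegularCoefficients b σ) {x : ℝ} (hx : 0 < x) :
    HasDerivAt (flux b σ φ) (speedDensity b σ x * (r x * φ x)) x := by
  simpa [hfund.phi_ode x hx] using hasDerivAt_flux hcoef r hfund.phi_smooth hx

lemma FundamentalSolutions.flux_psi_pos (hfund : FundamentalSolutions b σ r φ ψ) {x : ℝ}
    (hx : 0 < x) : 0 < flux b σ ψ x := div_pos (hfund.psi_incr x hx) (scaleDeriv_pos b σ x)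

lemma FundamentalSolutions.flux_phi_neg (hfund : FundamentalSolutions b σ r φ ψ) {x : ℝ}
    (hx : 0 < x) : flux b σ φ x < 0 :=
  div_neg_of_neg_of_pos (hfund.phi_decr x hx) (scaleDeriv_pos b σ x)

lemma FundamentalSolutions.psi_strictMono (hfund : FundamentalSolutions b σ r φ ψ) :
    StrictMonoOn ψ (Ioi 0) :=
  strictMonoOn_of_deriv_pos (convex_Ioi 0) hfund.psi_smooth.continuousOn
    fun x hx => hfund.psi_incr x (by simpa using hx)

lemma FundamentalSolutions.phi_strictAnti (hfund : FundamentalSolutions b σ r φ ψ) :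
    StrictAntiOn φ (Ioi 0) :=
  strictAntiOn_of_deriv_neg (convex_Ioi 0) hfund.phi_smooth.continuousOn
    fun x hx => hfund.phi_decr x (by simpa using hx)

lemma eq_of_hasDerivAt_zero_Ioi {f : ℝ → ℝ} (hf : ∀ x, 0 < x → HasDerivAt f 0 x) {x y : ℝ}
    (hx : 0 < x) (hy : 0 < y) : f x = f y :=
  (convex_Ioi (0 : ℝ)).is_const_of_fderivWithin_eq_zero
    (fun z hz => (hf z hz).differentiableAt.differentiableWithinAt)
    (fun z hz => by
      rw [fderivWithin_of_isOpen isOpen_Ioi hz]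
      ext
      simp [(hf z hz).deriv]) hx hy

/-- The Wronskian of `φ` and `ψ` with respect to the scale function is a positive constant. -/
lemma FundamentalSolutions.exists_wronskian (hfund : FundamentalSolutions b σ r φ ψ)
    (hcoef : RegularCoefficients b σ) :
    ∃ C, 0 < C ∧ ∀ x, 0 < x → φ x * flux b σ ψ x - ψ x * flux b σ φ x = C := by
  refine ⟨φ 1 * flux b σ ψ 1 - ψ 1 * flux b σ φ 1, ?_, fun x hx => ?_⟩
  · have h1 := mul_pos (hfund.phi_pos 1 one_pos) (hfund.flux_psi_pos (b := b) (σ := σ) one_pos)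
    have h2 := mul_neg_of_pos_of_neg (hfund.psi_pos 1 one_pos)
      (hfund.flux_phi_neg (b := b) (σ := σ) one_pos)
    linarith
  · refine eq_of_hasDerivAt_zero_Ioi
      (f := fun x => φ x * flux b σ ψ x - ψ x * flux b σ φ x) (fun y hy => ?_) hx one_pos
    have h := ((hfund.hasDerivAt_phi hy).mul (hfund.hasDerivAt_flux_psi hcoef hy)).sub
      ((hfund.hasDerivAt_psi hy).mul (hfund.hasDerivAt_flux_phi hcoef hy))
    refine h.congr_deriv ?_
    rw [deriv_eq_scaleDeriv_mul_flux b σ φ y, deriv_eq_scaleDeriv_mul_flux b σ ψ y]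
    ring

lemma tendsto_nhdsGT_zero_of_monotoneOn {f : ℝ → ℝ} {a m : ℝ} (ha : 0 < a)
    (hf : MonotoneOn f (Ioo 0 a)) (hm : ∀ x ∈ Ioo 0 a, m ≤ f x) :
    ∃ l, m ≤ l ∧ (∀ x ∈ Ioo 0 a, l ≤ f x) ∧ Tendsto f (𝓝[>] 0) (𝓝 l) := by
  have hb : BddBelow (f '' Ioo 0 a) := ⟨m, by rintro _ ⟨x, hx, rfl⟩; exact hm x hx⟩
  have hne : (f '' Ioo 0 a).Nonempty := (nonempty_Ioo.2 ha).image f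
  refine ⟨sInf (f '' Ioo 0 a), le_csInf hne (by rintro _ ⟨x, hx, rfl⟩; exact hm x hx),
    fun x hx => csInf_le hb (mem_image_of_mem f hx), ?_⟩
  exact hf.tendsto_nhdsWithin_Ioo_right (nonempty_Ioo.2 ha) hb

lemma FundamentalSolutions.exists_psi_zero (hfund : FundamentalSolutions b σ r φ ψ) :
    ∃ l, 0 ≤ l ∧ (∀ x, 0 < x → l < ψ x) ∧ Tendsto ψ (𝓝[>] 0) (𝓝 l) := by
  obtain ⟨l, h0, h1, h2⟩ := tendsto_nhdsGT_zero_of_monotoneOn (f := ψ) (a := 1) (m := 0) one_pos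
    (hfund.psi_strictMono.monotoneOn.mono Ioo_subset_Ioi_self)
    (fun x hx => (hfund.psi_pos x hx.1).le)
  refine ⟨l, h0, fun x hx => ?_, h2⟩
  have hm : 0 < min x 1 / 2 := by positivity
  have hx' : min x 1 / 2 < x := by linarith [min_le_left x 1]
  exact (h1 _ ⟨hm, by linarith [min_le_right x 1]⟩).trans_lt (hfund.psi_strictMono hm hx hx')

/-- Both terms of the Wronskian are positive, so φ times the flux of ψ is at most C, while φ
explodes at 0. -/
lemma FundamentalSolutions.tendsto_flux_psi_zero (hfund : FundamentalSolutions b σ r φ ψ)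
    (hcoef : RegularCoefficients b σ) : Tendsto (flux b σ ψ) (𝓝[>] 0) (𝓝 0) := by
  obtain ⟨C, hC, hW⟩ := hfund.exists_wronskian hcoef
  have h : Tendsto (fun x => C / φ x) (𝓝[>] 0) (𝓝 0) := hfund.phi_zero.const_div_atTop C
  refine squeeze_zero' ?_ ?_ h <;> filter_upwards [self_mem_nhdsWithin] with x hx
  · exact (hfund.flux_psi_pos hx).le
  · rw [le_div_iff₀ (hfund.phi_pos x hx), ← hW x hx]
    nlinarith [mul_neg_of_pos_of_neg (hfund.psi_pos x hx) (hfund.flux_phi_neg (b := b) (σ := σ) hx)]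

lemma FundamentalSolutions.flux_psi_strictMono (hfund : FundamentalSolutions b σ r φ ψ)
    (hcoef : RegularCoefficients b σ) (hr : DiscountRate r) :
    StrictMonoOn (flux b σ ψ) (Ioi 0) :=
  strictMonoOn_of_deriv_pos (convex_Ioi 0)
    (fun x hx => (hfund.hasDerivAt_flux_psi hcoef hx).continuousAt.continuousWithinAt)
    fun x hx => by
      have hx : 0 < x := by simpa using hx
      rw [(hfund.hasDerivAt_flux_psi hcoef hx).deriv]
      exact mul_pos (speedDensity_pos hcoef hx) (mul_pos (hr.pos hx) (hfund.psi_pos x hx))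

end ImpulseControl


namespace ImpulseControl

/-! ### The Green operator -/

variable {b σ r φ ψ : ℝ → ℝ} {F : ℝ → ℝ} {C : ℝ}

/-- Integrability of `F` with respect to the Green kernel. -/
structure GreenIntegrable (b σ φ ψ F : ℝ → ℝ) : Prop where
  lower : ∀ x, 0 < x → IntegrableOn (fun y => ψ y * F y * speedDensity b σ y) (Ioc 0 x)
  upper : ∀ x, 0 < x → IntegrableOn (fun y => φ y * F y * speedDensity b σ y) (Ioi x)

noncomputable def lowerInt (b σ ψ F : ℝ → ℝ) (x : ℝ) : ℝ :=
  ∫ y in Ioc 0 x, ψ y * F y * speedDensity b σ y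

noncomputable def upperInt (b σ φ F : ℝ → ℝ) (x : ℝ) : ℝ :=
  ∫ y in Ioi x, φ y * F y * speedDensity b σ y

/-- The Green operator, where `C` is the Wronskian. -/
noncomputable def green (b σ φ ψ : ℝ → ℝ) (C : ℝ) (F : ℝ → ℝ) (x : ℝ) : ℝ :=
  (φ x * lowerInt b σ ψ F x + ψ x * upperInt b σ φ F x) / C

/-- This is the derivative of `green` with respect to the scale function: the two terms that come
from differentiating the integrals cancel. -/
noncomputable def greenFlux (b σ φ ψ : ℝ → ℝ) (C : ℝ) (F : ℝ → ℝ) (x : ℝ) : ℝ :=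
  (flux b σ φ x * lowerInt b σ ψ F x + flux b σ ψ x * upperInt b σ φ F x) / C

lemma continuousOn_mul_speedDensity (hcoef : RegularCoefficients b σ) {w : ℝ → ℝ}
    (hw : ContinuousOn w (Ioi 0)) (hF : ContinuousOn F (Ioi 0)) :
    ContinuousOn (fun y => w y * F y * speedDensity b σ y) (Ioi 0) :=
  (hw.mul hF).mul (continuousOn_speedDensity hcoef)

lemma hasDerivAt_lowerInt (hcoef : RegularCoefficients b σ)
    (hfund : FundamentalSolutions b σ r φ ψ) (hF : ContinuousOn F (Ioi 0))
    (hint : GreenIntegrable b σ φ ψ F) {x : ℝ} (hx : 0 < x) :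
    HasDerivAt (lowerInt b σ ψ F) (ψ x * F x * speedDensity b σ x) x := by
  have hc := continuousOn_mul_speedDensity hcoef hfund.psi_smooth.continuousOn hF
  have h := intervalIntegral.integral_hasDerivAt_right
    ((intervalIntegrable_iff_integrableOn_Ioc_of_le hx.le).2 (hint.lower x hx))
    (hc.stronglyMeasurableAtFilter isOpen_Ioi x hx) (hc.continuousAt (Ioi_mem_nhds hx))
  refine h.congr_of_eventuallyEq ?_
  filter_upwards [Ioi_mem_nhds hx] with y hy
  rw [lowerInt, intervalIntegral.integral_of_le (le_of_lt hy)]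

lemma upperInt_eq_sub (hint : GreenIntegrable b σ φ ψ F) {x y : ℝ} (hx : 0 < x) (hy : 0 < y) :
    upperInt b σ φ F y = upperInt b σ φ F x
      - ∫ z in x..y, φ z * F z * speedDensity b σ z := by
  have := intervalIntegral.integral_Ioi_sub_Ioi' (hint.upper x hx) (hint.upper y hy)
  simp only [upperInt]
  linarith

lemma hasDerivAt_upperInt (hcoef : RegularCoefficients b σ)
    (hfund : FundamentalSolutions b σ r φ ψ) (hF : ContinuousOn F (Ioi 0))
    (hint : GreenIntegrable b σ φ ψ F) {x : ℝ} (hx : 0 < x) :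
    HasDerivAt (upperInt b σ φ F) (-(φ x * F x * speedDensity b σ x)) x := by
  have hc := continuousOn_mul_speedDensity hcoef hfund.phi_smooth.continuousOn hF
  have h := (intervalIntegral.integral_hasDerivAt_right (a := x) (b := x) (by simp)
    (hc.stronglyMeasurableAtFilter isOpen_Ioi x hx)
    (hc.continuousAt (Ioi_mem_nhds hx))).const_sub (upperInt b σ φ F x)
  refine h.congr_of_eventuallyEq ?_
  filter_upwards [Ioi_mem_nhds hx] with y hy
  exact upperInt_eq_sub hint hx hy

lemma hasDerivAt_green (hcoef : RegularCoefficients b σ)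
    (hfund : FundamentalSolutions b σ r φ ψ) (hF : ContinuousOn F (Ioi 0))
    (hint : GreenIntegrable b σ φ ψ F) {x : ℝ} (hx : 0 < x) :
    HasDerivAt (green b σ φ ψ C F) (scaleDeriv b σ x * greenFlux b σ φ ψ C F x) x := by
  have h := (((hfund.hasDerivAt_phi hx).mul (hasDerivAt_lowerInt hcoef hfund hF hint hx)).add
    ((hfund.hasDerivAt_psi hx).mul (hasDerivAt_upperInt hcoef hfund hF hint hx))).div_const C
  refine h.congr_deriv ?_
  rw [deriv_eq_scaleDeriv_mul_flux b σ φ x, deriv_eq_scaleDeriv_mul_flux b σ ψ x, greenFlux]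
  ring

/-- Differentiating the integrals now leaves the Wronskian times −F m/C, that is, the source term −F
m. -/
lemma hasDerivAt_greenFlux (hcoef : RegularCoefficients b σ)
    (hfund : FundamentalSolutions b σ r φ ψ) (hC : 0 < C)
    (hW : ∀ x, 0 < x → φ x * flux b σ ψ x - ψ x * flux b σ φ x = C)
    (hF : ContinuousOn F (Ioi 0))
    (hint : GreenIntegrable b σ φ ψ F) {x : ℝ} (hx : 0 < x) :
    HasDerivAt (greenFlux b σ φ ψ C F)
      (speedDensity b σ x * (r x * green b σ φ ψ C F x - F x)) x := by
  have h := (((hfund.hasDerivAt_flux_phi hcoef hx).mul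
      (hasDerivAt_lowerInt hcoef hfund hF hint hx)).add
    ((hfund.hasDerivAt_flux_psi hcoef hx).mul
      (hasDerivAt_upperInt hcoef hfund hF hint hx))).div_const C
  refine h.congr_deriv ?_
  have hg : φ x * lowerInt b σ ψ F x + ψ x * upperInt b σ φ F x = green b σ φ ψ C F x * C := by
    rw [green, div_mul_cancel₀ _ hC.ne']
  rw [div_eq_iff hC.ne']
  linear_combination speedDensity b σ x * r x * hg - speedDensity b σ x * F x * hW x hx

lemma flux_green (hcoef : RegularCoefficients b σ)
    (hfund : FundamentalSolutions b σ r φ ψ) (hF : ContinuousOn F (Ioi 0))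
    (hint : GreenIntegrable b σ φ ψ F) {x : ℝ} (hx : 0 < x) :
    flux b σ (green b σ φ ψ C F) x = greenFlux b σ φ ψ C F x := by
  rw [flux, (hasDerivAt_green hcoef hfund hF hint hx).deriv,
    mul_div_cancel_left₀ _ (scaleDeriv_pos b σ x).ne']

lemma contDiffOn_green (hcoef : RegularCoefficients b σ) (hr : DiscountRate r)
    (hfund : FundamentalSolutions b σ r φ ψ) (hC : 0 < C)
    (hW : ∀ x, 0 < x → φ x * flux b σ ψ x - ψ x * flux b σ φ x = C)
    (hF : ContinuousOn F (Ioi 0))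
    (hint : GreenIntegrable b σ φ ψ F) : ContDiffOn ℝ 2 (green b σ φ ψ C F) (Ioi 0) := by
  refine contDiffOn_two_of_hasDerivAt isOpen_Ioi
    (fun x hx => hasDerivAt_green hcoef hfund hF hint hx)
    (fun x hx => (hasDerivAt_scaleDeriv hcoef hx).mul
      (hasDerivAt_greenFlux hcoef hfund hC hW hF hint hx)) ?_
  have h1 : ContinuousOn (green b σ φ ψ C F) (Ioi 0) := fun x hx =>
    (hasDerivAt_green hcoef hfund hF hint hx).continuousAt.continuousWithinAt
  have h2 : ContinuousOn (greenFlux b σ φ ψ C F) (Ioi 0) := fun x hx =>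
    (hasDerivAt_greenFlux hcoef hfund hC hW hF hint hx).continuousAt.continuousWithinAt
  have h3 : ContinuousOn (fun s => b s / σ s ^ 2) (Ioi 0) :=
    hcoef.continuousOn_drift.div (hcoef.continuousOn_vol.pow 2)
      fun y hy => (pow_pos (hcoef.vol_pos y hy) 2).ne'
  exact (((continuousOn_const.mul h3).mul (continuousOn_scaleDeriv hcoef)).mul h2).add
    ((continuousOn_scaleDeriv hcoef).mul ((continuousOn_speedDensity hcoef).mul
      ((hr.continuousOn_Ioi.mul h1).sub hF)))

lemma opL_green (hcoef : RegularCoefficients b σ) (hr : DiscountRate r)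
    (hfund : FundamentalSolutions b σ r φ ψ) (hC : 0 < C)
    (hW : ∀ x, 0 < x → φ x * flux b σ ψ x - ψ x * flux b σ φ x = C)
    (hF : ContinuousOn F (Ioi 0))
    (hint : GreenIntegrable b σ φ ψ F) {x : ℝ} (hx : 0 < x) :
    opL b σ r (green b σ φ ψ C F) x = -F x := by
  have h1 := hasDerivAt_flux hcoef r (contDiffOn_green hcoef hr hfund hC hW hF hint) hx
  have h2 := hasDerivAt_greenFlux hcoef hfund hC hW hF hint hx
  have h3 := h1.unique (h2.congr_of_eventuallyEq (by
    filter_upwards [Ioi_mem_nhds hx] with y hy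
    exact flux_green hcoef hfund hF hint hy))
  have := mul_left_cancel₀ (speedDensity_pos hcoef hx).ne' h3
  linarith

/-- A solution of the homogeneous equation is a combination of `φ` and `ψ`. -/
lemma FundamentalSolutions.exists_coeff (hfund : FundamentalSolutions b σ r φ ψ)
    (hcoef : RegularCoefficients b σ) {u : ℝ → ℝ} (hu : ContDiffOn ℝ 2 u (Ioi 0))
    (hode : ∀ x, 0 < x → opL b σ r u x = 0) :
    ∃ a₁ a₂ : ℝ, ∀ x, 0 < x → u x = a₁ * φ x + a₂ * ψ x := by
  obtain ⟨C, hC, hW⟩ := hfund.exists_wronskian hcoef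
  -- The Wronskian of two solutions is constant. The Wronskians of `u` with ψ and φ are, up to sign
  -- and the factor C, the coefficients sought.
  have hconst : ∀ {v : ℝ → ℝ}, ContDiffOn ℝ 2 v (Ioi 0) → (∀ x, 0 < x → opL b σ r v x = 0) →
      ∀ x, 0 < x → u x * flux b σ v x - v x * flux b σ u x
        = u 1 * flux b σ v 1 - v 1 * flux b σ u 1 := by
    intro v hv hv0 x hx
    refine eq_of_hasDerivAt_zero_Ioi
      (f := fun x => u x * flux b σ v x - v x * flux b σ u x) (fun y hy => ?_) hx one_pos
    have h := ((hasDerivAt_of_contDiffOn_two isOpen_Ioi hu hy).1.mul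
      (hasDerivAt_flux hcoef r hv hy)).sub
      ((hasDerivAt_of_contDiffOn_two isOpen_Ioi hv hy).1.mul (hasDerivAt_flux hcoef r hu hy))
    refine h.congr_deriv ?_
    rw [deriv_eq_scaleDeriv_mul_flux b σ u y, deriv_eq_scaleDeriv_mul_flux b σ v y,
      hode y hy, hv0 y hy]
    ring
  have h1 := hconst hfund.psi_smooth hfund.psi_ode
  have h2 := hconst hfund.phi_smooth hfund.phi_ode
  set c₁ := u 1 * flux b σ ψ 1 - ψ 1 * flux b σ u 1
  set c₂ := u 1 * flux b σ φ 1 - φ 1 * flux b σ u 1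
  refine ⟨c₁ / C, -c₂ / C, fun x hx => ?_⟩
  field_simp
  rw [← h1 x hx, ← h2 x hx, ← hW x hx]
  ring

lemma FundamentalSolutions.div_antitone (hfund : FundamentalSolutions b σ r φ ψ) {x y : ℝ}
    (hy : 0 < y) (hyx : y ≤ x) : φ x / ψ x ≤ φ y / ψ y :=
  div_le_div₀ (hfund.phi_pos y hy).le
    (hfund.phi_strictAnti.antitoneOn hy (mem_Ioi.2 (hy.trans_le hyx)) hyx) (hfund.psi_pos y hy)
    (hfund.psi_strictMono.monotoneOn hy (mem_Ioi.2 (hy.trans_le hyx)) hyx)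

lemma FundamentalSolutions.tendsto_phi_div_psi (hfund : FundamentalSolutions b σ r φ ψ) :
    Tendsto (fun x => φ x / ψ x) atTop (𝓝 0) := by
  have h : Tendsto (fun x => φ 1 / ψ x) atTop (𝓝 0) := hfund.psi_infty.const_div_atTop _
  refine squeeze_zero' ?_ ?_ h <;> filter_upwards [eventually_ge_atTop 1] with x hx
  · exact (div_pos (hfund.phi_pos x (by linarith)) (hfund.psi_pos x (by linarith))).le
  · exact div_le_div_of_nonneg_right (hfund.phi_strictAnti.antitoneOn (mem_Ioi.2 one_pos)
      (mem_Ioi.2 (by linarith)) hx) (hfund.psi_pos x (by linarith)).le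

lemma FundamentalSolutions.tendsto_psi_div_phi (hfund : FundamentalSolutions b σ r φ ψ) :
    Tendsto (fun x => ψ x / φ x) (𝓝[>] 0) (𝓝 0) := by
  have h : Tendsto (fun x => ψ 1 / φ x) (𝓝[>] 0) (𝓝 0) := hfund.phi_zero.const_div_atTop _
  refine squeeze_zero' ?_ ?_ h <;> filter_upwards [Ioc_mem_nhdsGT one_pos] with x hx
  · exact (div_pos (hfund.psi_pos x hx.1) (hfund.phi_pos x hx.1)).le
  · exact div_le_div_of_nonneg_right (hfund.psi_strictMono.monotoneOn hx.1
      (mem_Ioi.2 one_pos) hx.2) (hfund.phi_pos x hx.1).le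

lemma tendsto_lowerInt_zero (hint : GreenIntegrable b σ φ ψ F) :
    Tendsto (lowerInt b σ ψ F) (𝓝[>] 0) (𝓝 0) := by
  have h := intervalIntegral.continuousOn_primitive_interval (a := 0) (b := 1) (μ := volume)
    (f := fun y => ψ y * F y * speedDensity b σ y)
    (by rw [uIcc_of_le zero_le_one, integrableOn_Icc_iff_integrableOn_Ioc]
        exact hint.lower 1 one_pos)
  rw [uIcc_of_le zero_le_one] at h
  have h0 := (h 0 (left_mem_Icc.2 zero_le_one)).tendsto
  rw [intervalIntegral.integral_same] at h0
  have h1 : 𝓝[>] (0 : ℝ) ≤ 𝓝[Icc 0 1] 0 := by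
    rw [← nhdsWithin_Ioc_eq_nhdsGT one_pos]
    exact nhdsWithin_mono _ Ioc_subset_Icc_self
  refine (h0.mono_left h1).congr' ?_
  filter_upwards [self_mem_nhdsWithin] with y hy
  rw [lowerInt, intervalIntegral.integral_of_le (le_of_lt hy)]

lemma tendsto_upperInt_atTop (hint : GreenIntegrable b σ φ ψ F) :
    Tendsto (upperInt b σ φ F) atTop (𝓝 0) := by
  have h := (intervalIntegral_tendsto_integral_Ioi 1 (hint.upper 1 one_pos)
    tendsto_id).const_sub (upperInt b σ φ F 1)
  rw [show (∫ x in Ioi 1, φ x * F x * speedDensity b σ x) = upperInt b σ φ F 1 from rfl,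
    sub_self] at h
  refine h.congr' ?_
  filter_upwards [eventually_gt_atTop 0] with y hy
  exact (upperInt_eq_sub hint one_pos hy).symm

/-- After division by ψ the upper part is the tail of a convergent integral. The lower part carries
the factor φ/ψ, which tends to 0, and dominated convergence applies. -/
lemma tendsto_green_div_psi
    (hfund : FundamentalSolutions b σ r φ ψ)
    (hint : GreenIntegrable b σ φ ψ F) :
    Tendsto (fun x => green b σ φ ψ C F x / ψ x) atTop (𝓝 0) := by
  set f : ℝ → ℝ := fun y => ψ y * F y * speedDensity b σ y with hf
  set g : ℝ → ℝ := fun y => φ y * F y * speedDensity b σ y with hg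
  have key : Tendsto (fun x => ∫ y in Ioi (0 : ℝ), φ x / ψ x * (Ioc 0 x).indicator f y)
      atTop (𝓝 (∫ y in Ioi (0 : ℝ), (0 : ℝ))) := by
    refine tendsto_integral_filter_of_dominated_convergence
      -- As φ/ψ decreases, (φ/ψ)(x) is at most its value at 1 for y ≤ 1, and at most (φ/ψ)(y) for 1
      -- < y ≤ x, which turns ψ|F|m into φ|F|m.
      (fun y => φ 1 / ψ 1 * |(Ioc 0 1).indicator f y| + |(Ioi 1).indicator g y|) ?_ ?_ ?_ ?_
    · filter_upwards [eventually_gt_atTop 0] with x hx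
      have : Integrable ((Ioc 0 x).indicator f) :=
        (integrable_indicator_iff measurableSet_Ioc).2 (hint.lower x hx)
      exact (this.integrableOn.const_mul _).aestronglyMeasurable
    · filter_upwards [eventually_ge_atTop 1] with x hx
      refine (ae_restrict_mem measurableSet_Ioi).mono fun y (hy : 0 < y) => ?_
      have hx0 : 0 < x := by linarith
      have hq : 0 < φ x / ψ x := div_pos (hfund.phi_pos x hx0) (hfund.psi_pos x hx0)
      rw [norm_mul, Real.norm_of_nonneg hq.le, Real.norm_eq_abs]
      by_cases hyx : y ≤ x
      · rw [indicator_of_mem (show y ∈ Ioc 0 x from ⟨hy, hyx⟩)]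
        by_cases hy1 : y ≤ 1
        · rw [indicator_of_mem (show y ∈ Ioc 0 1 from ⟨hy, hy1⟩)]
          have := mul_le_mul_of_nonneg_right (hfund.div_antitone one_pos hx) (abs_nonneg (f y))
          linarith [abs_nonneg ((Ioi 1).indicator g y)]
        · rw [indicator_of_mem (show y ∈ Ioi 1 from not_le.1 hy1),
            indicator_of_notMem (by simp [hy1]), abs_zero, mul_zero, zero_add]
          have h1 : g y = φ y / ψ y * f y := by
            have := (hfund.psi_pos y hy).ne'
            simp only [hf, hg]; field_simp
          rw [h1, abs_mul (φ y / ψ y), abs_of_pos (div_pos (hfund.phi_pos y hy) (hfund.psi_pos y hy))]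
          exact mul_le_mul_of_nonneg_right (hfund.div_antitone hy hyx) (abs_nonneg _)
      · rw [indicator_of_notMem (by simp [hyx]), abs_zero, mul_zero]
        have := (div_pos (hfund.phi_pos 1 one_pos) (hfund.psi_pos 1 one_pos)).le
        positivity
    · refine Integrable.add (Integrable.const_mul ?_ _) ?_
      · exact ((integrable_indicator_iff measurableSet_Ioc).2
          (hint.lower 1 one_pos)).abs.integrableOn
      · exact ((integrable_indicator_iff measurableSet_Ioi).2
          (hint.upper 1 one_pos)).abs.integrableOn
    · refine (ae_restrict_mem measurableSet_Ioi).mono fun y (hy : 0 < y) => ?_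
      have := hfund.tendsto_phi_div_psi.mul_const (f y)
      rw [zero_mul] at this
      refine this.congr' ?_
      filter_upwards [eventually_ge_atTop y] with x hx
      rw [indicator_of_mem (show y ∈ Ioc 0 x from ⟨hy, hx⟩)]
  rw [integral_zero] at key
  have h := (key.add (tendsto_upperInt_atTop hint)).div_const C
  rw [add_zero, zero_div] at h
  refine h.congr' ?_
  filter_upwards [eventually_gt_atTop 0] with x hx
  have hpsi := (hfund.psi_pos x hx).ne'
  rw [integral_const_mul, setIntegral_indicator measurableSet_Ioc,
    inter_eq_right.2 (Ioc_subset_Ioi_self : Ioc 0 x ⊆ Ioi 0)]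
  change (φ x / ψ x * lowerInt b σ ψ F x + upperInt b σ φ F x) / C = _
  rw [green]
  field_simp

/-- The mirror image at 0, with ψ/φ increasing and the roles of the two integrals exchanged. It is
used to exclude a φ-component in the representation of K. -/
lemma tendsto_green_div_phi
    (hfund : FundamentalSolutions b σ r φ ψ)
    (hint : GreenIntegrable b σ φ ψ F) :
    Tendsto (fun x => green b σ φ ψ C F x / φ x) (𝓝[>] 0) (𝓝 0) := by
  set f : ℝ → ℝ := fun y => ψ y * F y * speedDensity b σ y with hf
  set g : ℝ → ℝ := fun y => φ y * F y * speedDensity b σ y with hg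
  have hinv : ∀ {x y : ℝ}, 0 < y → y ≤ x → ψ y / φ y ≤ ψ x / φ x := fun {x y} hy hyx =>
    div_le_div₀ (hfund.psi_pos x (hy.trans_le hyx)).le
      (hfund.psi_strictMono.monotoneOn hy (mem_Ioi.2 (hy.trans_le hyx)) hyx)
      (hfund.phi_pos x (hy.trans_le hyx))
      (hfund.phi_strictAnti.antitoneOn hy (mem_Ioi.2 (hy.trans_le hyx)) hyx)
  have key : Tendsto (fun x => ∫ y in Ioi (0 : ℝ), ψ x / φ x * (Ioi x).indicator g y)
      (𝓝[>] 0) (𝓝 (∫ y in Ioi (0 : ℝ), (0 : ℝ))) := by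
    refine tendsto_integral_filter_of_dominated_convergence
      (fun y => ψ 1 / φ 1 * |(Ioi 1).indicator g y| + |(Ioc 0 1).indicator f y|) ?_ ?_ ?_ ?_
    · filter_upwards [self_mem_nhdsWithin] with x hx
      have : Integrable ((Ioi x).indicator g) :=
        (integrable_indicator_iff measurableSet_Ioi).2 (hint.upper x hx)
      exact (this.integrableOn.const_mul _).aestronglyMeasurable
    · filter_upwards [Ioc_mem_nhdsGT one_pos] with x hx
      refine (ae_restrict_mem measurableSet_Ioi).mono fun y (hy : 0 < y) => ?_
      have hx0 : 0 < x := hx.1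
      have hq : 0 < ψ x / φ x := div_pos (hfund.psi_pos x hx0) (hfund.phi_pos x hx0)
      rw [norm_mul, Real.norm_of_nonneg hq.le, Real.norm_eq_abs]
      by_cases hyx : x < y
      · rw [indicator_of_mem (show y ∈ Ioi x from hyx)]
        by_cases hy1 : 1 < y
        · rw [indicator_of_mem (show y ∈ Ioi 1 from hy1)]
          have := mul_le_mul_of_nonneg_right (hinv hx.1 hx.2) (abs_nonneg (g y))
          linarith [abs_nonneg ((Ioc 0 1).indicator f y)]
        · rw [indicator_of_mem (show y ∈ Ioc 0 1 from ⟨hy, not_lt.1 hy1⟩),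
            indicator_of_notMem (by simpa using hy1), abs_zero, mul_zero, zero_add]
          have h1 : f y = ψ y / φ y * g y := by
            have := (hfund.phi_pos y hy).ne'
            simp only [hf, hg]; field_simp
          rw [h1, abs_mul (ψ y / φ y), abs_of_pos (div_pos (hfund.psi_pos y hy) (hfund.phi_pos y hy))]
          exact mul_le_mul_of_nonneg_right (hinv hx.1 hyx.le) (abs_nonneg _)
      · rw [indicator_of_notMem (by simpa using hyx), abs_zero, mul_zero]
        have := (div_pos (hfund.psi_pos 1 one_pos) (hfund.phi_pos 1 one_pos)).le
        positivity
    · refine Integrable.add (Integrable.const_mul ?_ _) ?_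
      · exact ((integrable_indicator_iff measurableSet_Ioi).2
          (hint.upper 1 one_pos)).abs.integrableOn
      · exact ((integrable_indicator_iff measurableSet_Ioc).2
          (hint.lower 1 one_pos)).abs.integrableOn
    · refine (ae_restrict_mem measurableSet_Ioi).mono fun y (hy : 0 < y) => ?_
      have := hfund.tendsto_psi_div_phi.mul_const (g y)
      rw [zero_mul] at this
      refine this.congr' ?_
      filter_upwards [Ioo_mem_nhdsGT hy] with x hx
      rw [indicator_of_mem (show y ∈ Ioi x from hx.2)]
  rw [integral_zero] at key
  have h := ((tendsto_lowerInt_zero hint).add key).div_const C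
  rw [add_zero, zero_div] at h
  refine h.congr' ?_
  filter_upwards [self_mem_nhdsWithin] with x (hx : 0 < x)
  have hphi := (hfund.phi_pos x hx).ne'
  rw [integral_const_mul, setIntegral_indicator measurableSet_Ioi,
    inter_eq_right.2 (Ioi_subset_Ioi hx.le)]
  change (lowerInt b σ ψ F x + ψ x / φ x * upperInt b σ φ F x) / C = _
  rw [green]
  field_simp

/-- Suppose that Ψ = ψ'/p' is bounded. Its derivative rψm is then integrable at ∞. Since ψ' ≥ Ψ(1)p'
on [1, ∞), ψ dominates Ψ(1)(p − p(1)), so p − p(1) would be m-integrable, contrary to ∞ not being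
entrance. -/
lemma FundamentalSolutions.tendsto_flux_psi_atTop (hfund : FundamentalSolutions b σ r φ ψ)
    (hcoef : RegularCoefficients b σ) (hr : DiscountRate r) (hinfty : InftyNatural b σ) :
    Tendsto (flux b σ ψ) atTop atTop := by
  by_contra hcon
  have hmono := hfund.flux_psi_strictMono hcoef hr
  obtain ⟨L, hL⟩ : ∃ L, ∀ x, 0 < x → flux b σ ψ x ≤ L := by
    by_contra! hno
    refine hcon (tendsto_atTop.2 fun L => ?_)
    obtain ⟨x, hx, hxL⟩ := hno L
    filter_upwards [eventually_ge_atTop x] with y hy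
    exact hxL.le.trans (hmono.monotoneOn hx (mem_Ioi.2 (hx.trans_le hy)) hy)
  obtain ⟨r₀, hr₀, hr₀'⟩ := hr.lower
  have h1 := hfund.flux_psi_pos (b := b) (σ := σ) one_pos
  set L₁ := flux b σ ψ 1
  have hder : ∀ x ∈ Ici (1 : ℝ), HasDerivAt (flux b σ ψ) (speedDensity b σ x * (r x * ψ x)) x :=
    fun x hx => hfund.hasDerivAt_flux_psi hcoef (lt_of_lt_of_le one_pos hx)
  have hlim : ∃ l, Tendsto (flux b σ ψ) atTop (𝓝 l) := by
    have hm : Monotone fun x => flux b σ ψ (max x 1) := fun x y hxy =>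
      hmono.monotoneOn (mem_Ioi.2 (by positivity)) (mem_Ioi.2 (by positivity))
        (max_le_max_right 1 hxy)
    refine ⟨_, (tendsto_atTop_ciSup hm ⟨L, ?_⟩).congr' ?_⟩
    · rintro _ ⟨x, rfl⟩
      exact hL _ (by positivity)
    · filter_upwards [eventually_ge_atTop 1] with x hx
      simp [max_eq_left hx]
  obtain ⟨l, hl⟩ := hlim
  have hint : IntegrableOn (fun x => speedDensity b σ x * (r x * ψ x)) (Ioi 1) :=
    integrableOn_Ioi_deriv_of_nonneg' hder (fun x (hx : 1 < x) => by
      have hx0 : 0 < x := by linarith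
      exact (mul_pos (speedDensity_pos hcoef hx0)
        (mul_pos (hr.pos hx0) (hfund.psi_pos x hx0))).le) hl
  have hsc : ∀ y, 1 < y → ∫⁻ z in Ioo 1 y, ENNReal.ofReal (scaleDeriv b σ z)
      ≤ ENNReal.ofReal (ψ y / L₁) := by
    intro y hy
    have hsub : Icc 1 y ⊆ Ioi 0 := fun z hz => lt_of_lt_of_le one_pos hz.1
    have hi : IntegrableOn (scaleDeriv b σ) (Ioo 1 y) :=
      (((continuousOn_scaleDeriv hcoef).mono hsub).integrableOn_Icc).mono_set Ioo_subset_Icc_self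
    rw [← ofReal_integral_eq_lintegral_ofReal hi (.of_forall fun z => (scaleDeriv_pos b σ z).le)]
    refine ENNReal.ofReal_le_ofReal ?_
    rw [le_div_iff₀ h1, ← integral_Ioc_eq_integral_Ioo, ← intervalIntegral.integral_of_le hy.le]
    have hc : ContinuousOn (deriv ψ) (uIcc 1 y) := by
      rw [uIcc_of_le hy.le]
      exact (continuousOn_derivs_of_contDiffOn_two isOpen_Ioi hfund.psi_smooth).2.1.mono hsub
    have hftc := intervalIntegral.integral_eq_sub_of_hasDerivAt (a := 1) (b := y) (f := ψ)
      (f' := deriv ψ) (fun z hz => hfund.hasDerivAt_psi (hsub (by rwa [uIcc_of_le hy.le] at hz)))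
      hc.intervalIntegrable
    have hle : (∫ z in (1 : ℝ)..y, scaleDeriv b σ z * L₁) ≤ ∫ z in (1 : ℝ)..y, deriv ψ z := by
      refine intervalIntegral.integral_mono_on hy.le ?_ hc.intervalIntegrable fun z hz => ?_
      · refine (ContinuousOn.mul ?_ continuousOn_const).intervalIntegrable
        rw [uIcc_of_le hy.le]
        exact (continuousOn_scaleDeriv hcoef).mono hsub
      · rw [deriv_eq_scaleDeriv_mul_flux b σ ψ z]
        exact mul_le_mul_of_nonneg_left
          (hmono.monotoneOn (mem_Ioi.2 one_pos) (hsub hz) hz.1) (scaleDeriv_pos b σ z).le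
    rw [intervalIntegral.integral_mul_const] at hle
    linarith [hfund.psi_pos 1 one_pos]
  have hfin : ∫⁻ y in Ioi (1 : ℝ), (∫⁻ z in Ioo 1 y, ENNReal.ofReal (scaleDeriv b σ z)) *
      ENNReal.ofReal (speedDensity b σ y) < ∞ := by
    refine lt_of_le_of_lt (b := ∫⁻ y in Ioi (1 : ℝ),
      ENNReal.ofReal ((r₀ * L₁)⁻¹ * (speedDensity b σ y * (r y * ψ y)))) ?_ ?_
    · refine setLIntegral_mono' measurableSet_Ioi fun y (hy : 1 < y) => ?_
      have hy0 : 0 < y := by linarith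
      have hM := speedDensity_pos hcoef hy0
      have hψ := hfund.psi_pos y hy0
      refine (mul_le_mul_left (hsc y hy) _).trans ?_
      rw [← ENNReal.ofReal_mul (by positivity)]
      refine ENNReal.ofReal_le_ofReal ?_
      rw [inv_mul_eq_div, le_div_iff₀ (by positivity), div_mul_eq_mul_div, div_mul_eq_mul_div,
        div_le_iff₀ h1]
      have := hr₀' y hy0.le
      have hpos : 0 ≤ speedDensity b σ y * ψ y * L₁ := by positivity
      nlinarith [mul_le_mul_of_nonneg_left this hpos]
    · exact Integrable.lintegral_lt_top (Integrable.const_mul hint _)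
  exact absurd hinfty.2 hfin.ne

end ImpulseControl


namespace ImpulseControl

/-! ### Discounted functionals of a positive continuous process -/

/-- A process with continuous paths in `]0, ∞[`. -/
structure PositivePaths {Ω : Type*} (m : MeasurableSpace Ω) (Y : ℝ≥0 → Ω → ℝ) : Prop where
  meas : ∀ t, Measurable (Y t)
  cont : ∀ ω, Continuous (Y · ω)
  pos : ∀ ω t, 0 < Y t ω

section Paths

variable {Ω : Type*} {m : MeasurableSpace Ω} {Y : ℝ≥0 → Ω → ℝ} {G V : ℝ → ℝ}

lemma PositivePaths.continuous_comp (hY : PositivePaths m Y)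
    (hG : ContinuousOn G (Ioi 0)) (ω : Ω) : Continuous fun t : ℝ => G (Y t.toNNReal ω) :=
  hG.comp_continuous ((hY.cont ω).comp continuous_real_toNNReal) fun _ => hY.pos ω _

lemma PositivePaths.measurable_comp (hY : PositivePaths m Y)
    (hG : ContinuousOn G (Ioi 0)) (t : ℝ≥0) : Measurable fun ω => G (Y t ω) := by
  classical
  -- Nothing is known of `G` off ]0, ∞[, so it is replaced there by 0; the paths never see the
  -- change.
  have h : Measurable ((Ioi (0 : ℝ)).piecewise G fun _ => 0) :=
    hG.measurable_piecewise continuousOn_const measurableSet_Ioi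
  have he : (fun ω => G (Y t ω)) = (Ioi (0 : ℝ)).piecewise G (fun _ => 0) ∘ Y t := by
    ext ω
    simp [hY.pos ω t]
  rw [he]
  exact h.comp (hY.meas t)

lemma measurable_of_continuous_of_measurable {H : ℝ → Ω → ℝ} (hc : ∀ ω, Continuous (H · ω))
    (hm : ∀ t, Measurable (H t)) : Measurable fun p : Ω × ℝ => H p.2 p.1 :=
  (measurable_uncurry_of_continuous_of_measurable hc hm).comp measurable_swap

lemma PositivePaths.measurable_prod (hY : PositivePaths m Y)
    (hG : ContinuousOn G (Ioi 0)) : Measurable fun p : Ω × ℝ => G (Y p.2.toNNReal p.1) :=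
  measurable_of_continuous_of_measurable (H := fun t ω => G (Y t.toNNReal ω))
    (hY.continuous_comp hG) fun _ => hY.measurable_comp hG _

lemma measurable_intervalIntegral_of_continuous {H : ℝ → Ω → ℝ}
    (hc : ∀ ω, Continuous (H · ω)) (hm : ∀ t, Measurable (H t)) (a c : ℝ) :
    Measurable fun ω => ∫ t in a..c, H t ω := by
  have h := (measurable_of_continuous_of_measurable hc hm).stronglyMeasurable
  have h1 : ∀ s : Set ℝ, Measurable fun ω => ∫ t in s, H t ω := fun s =>
    (StronglyMeasurable.integral_prod_right (ν := volume.restrict s) h).measurable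
  exact (h1 _).sub (h1 _)

lemma PositivePaths.hasDerivAt_cumRate (hY : PositivePaths m Y)
    (hV : ContinuousOn V (Ioi 0)) (ω : Ω) (t : ℝ) :
    HasDerivAt (fun t => cumRate V Y t ω) (V (Y t.toNNReal ω)) t :=
  ((hY.continuous_comp hV ω).integral_hasStrictDerivAt 0 t).hasDerivAt

lemma PositivePaths.measurable_cumRate (hY : PositivePaths m Y)
    (hV : ContinuousOn V (Ioi 0)) (t : ℝ) : Measurable (cumRate V Y t) :=
  measurable_intervalIntegral_of_continuous (H := fun t ω => V (Y t.toNNReal ω))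
    (hY.continuous_comp hV) (fun _ => hY.measurable_comp hV _) 0 t

/-- The discount factor. -/
noncomputable def disc (V : ℝ → ℝ) (Y : ℝ≥0 → Ω → ℝ) (t : ℝ) (ω : Ω) : ℝ :=
  Real.exp (-cumRate V Y t ω)

lemma disc_pos (V : ℝ → ℝ) (Y : ℝ≥0 → Ω → ℝ) (t : ℝ) (ω : Ω) : 0 < disc V Y t ω := Real.exp_pos _

lemma disc_zero (V : ℝ → ℝ) (Y : ℝ≥0 → Ω → ℝ) (ω : Ω) : disc V Y 0 ω = 1 := by
  simp [disc, cumRate]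

lemma PositivePaths.hasDerivAt_disc (hY : PositivePaths m Y)
    (hV : ContinuousOn V (Ioi 0)) (ω : Ω) (t : ℝ) :
    HasDerivAt (fun t => disc V Y t ω) (-(V (Y t.toNNReal ω) * disc V Y t ω)) t := by
  refine (hY.hasDerivAt_cumRate hV ω t).neg.exp.congr_deriv ?_
  simp only [disc, Pi.neg_apply]
  ring

lemma PositivePaths.continuous_disc (hY : PositivePaths m Y)
    (hV : ContinuousOn V (Ioi 0)) (ω : Ω) : Continuous fun t => disc V Y t ω :=
  continuous_iff_continuousAt.2 fun t => (hY.hasDerivAt_disc hV ω t).continuousAt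

lemma PositivePaths.measurable_disc (hY : PositivePaths m Y)
    (hV : ContinuousOn V (Ioi 0)) (t : ℝ) : Measurable (disc V Y t) :=
  (hY.measurable_cumRate hV t).neg.exp

lemma PositivePaths.measurable_disc_prod (hY : PositivePaths m Y)
    (hV : ContinuousOn V (Ioi 0)) : Measurable fun p : Ω × ℝ => disc V Y p.2 p.1 :=
  measurable_of_continuous_of_measurable (hY.continuous_disc hV) (hY.measurable_disc hV)

lemma PositivePaths.mul_le_cumRate (hY : PositivePaths m Y)
    (hV : ContinuousOn V (Ioi 0)) {v₀ : ℝ} (hlow : ∀ y, 0 < y → v₀ ≤ V y) {t : ℝ} (ht : 0 ≤ t)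
    (ω : Ω) : v₀ * t ≤ cumRate V Y t ω := by
  have h := intervalIntegral.integral_mono_on (μ := volume) ht (f := fun _ => v₀)
    (g := fun u => V (Y u.toNNReal ω)) (by simp)
    ((hY.continuous_comp hV ω).intervalIntegrable 0 t) fun u _ => hlow _ (hY.pos ω _)
  rw [intervalIntegral.integral_const, smul_eq_mul, sub_zero, mul_comm] at h
  exact h

lemma PositivePaths.disc_le (hY : PositivePaths m Y)
    (hV : ContinuousOn V (Ioi 0)) {v₀ : ℝ} (hlow : ∀ y, 0 < y → v₀ ≤ V y) {t : ℝ} (ht : 0 ≤ t)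
    (ω : Ω) : disc V Y t ω ≤ Real.exp (-v₀ * t) := by
  refine Real.exp_le_exp.2 ?_
  linarith [hY.mul_le_cumRate hV hlow ht ω]

lemma PositivePaths.disc_le_one (hY : PositivePaths m Y)
    (hV : ContinuousOn V (Ioi 0)) (hlow : ∀ y, 0 < y → 0 ≤ V y) {t : ℝ} (ht : 0 ≤ t)
    (ω : Ω) : disc V Y t ω ≤ 1 := by
  simpa using hY.disc_le hV hlow ht ω

/-- The discount factor at time `s` only depends on the process up to time `s`. -/
lemma PositivePaths.measurable_disc_filtration {m : MeasurableSpace Ω} {𝓕 : Filtration ℝ≥0 m}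
    (hY : PositivePaths m Y) (hadapt : ∀ t, Measurable[𝓕 t] (Y t))
    (hV : ContinuousOn V (Ioi 0)) (s : ℝ≥0) : Measurable[𝓕 s] (disc V Y s) := by
  -- The process frozen at time s has positive continuous paths and is measurable with respect to 𝓕
  -- s at all times, so the general measurability lemma applies with 𝓕 s as the ambient σ-algebra.
  have hY' : PositivePaths (𝓕 s) fun t => Y (min t s) :=
    { meas := fun t => (hadapt _).mono (𝓕.mono (min_le_right t s)) le_rfl
      cont := fun ω => (hY.cont ω).comp (continuous_id.min continuous_const)
      pos := fun ω t => hY.pos ω _ }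
  have h := hY'.measurable_disc hV s
  have he : disc V Y (s : ℝ) = disc V (fun t => Y (min t s)) (s : ℝ) := by
    ext ω
    simp only [disc, cumRate]
    congr 2
    refine intervalIntegral.integral_congr fun u hu => ?_
    rw [uIcc_of_le s.coe_nonneg] at hu
    have hus : u.toNNReal ≤ s := Real.toNNReal_le_iff_le_coe.2 hu.2
    simp only [min_eq_left hus]
  rw [he]
  exact h

lemma PositivePaths.integrable_disc (hY : PositivePaths m Y) {P : Measure Ω}
    [IsProbabilityMeasure P]
    (hV : ContinuousOn V (Ioi 0)) {v₀ : ℝ} (hv₀ : 0 < v₀) (hlow : ∀ y, 0 < y → v₀ ≤ V y)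
    (hG : ContinuousOn G (Ioi 0)) {B : ℝ} (hB : ∀ y, 0 < y → |G y| ≤ B) :
    Integrable (fun p : Ω × ℝ => disc V Y p.2 p.1 * G (Y p.2.toNNReal p.1))
      (P.prod (volume.restrict (Ioi 0))) := by
  have hexp : Integrable (fun t => Real.exp (-v₀ * t) * B) (volume.restrict (Ioi 0)) :=
    (exp_neg_integrableOn_Ioi 0 hv₀).mul_const B
  have hdom : Integrable (fun p : Ω × ℝ => (1 : ℝ) * (Real.exp (-v₀ * p.2) * B))
      (P.prod (volume.restrict (Ioi 0))) := (integrable_const (1 : ℝ)).mul_prod hexp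
  refine hdom.mono' ((hY.measurable_disc_prod hV).mul
    (hY.measurable_prod hG)).aestronglyMeasurable ?_
  have hpos : ∀ᵐ p : Ω × ℝ ∂(P.prod (volume.restrict (Ioi 0))), p.2 ∈ Ioi (0 : ℝ) :=
    Measure.quasiMeasurePreserving_snd.ae (ae_restrict_mem measurableSet_Ioi)
  filter_upwards [hpos] with p hp
  rw [norm_mul, Real.norm_of_nonneg (disc_pos V Y _ _).le, Real.norm_eq_abs, one_mul]
  exact mul_le_mul (hY.disc_le hV hlow (le_of_lt hp) _) (hB _ (hY.pos _ _)) (abs_nonneg _)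
    (Real.exp_pos _).le

end Paths

/-! ### Dynkin's formula for compactly supported functions -/

lemma IsDiffusion.positivePaths {Ω : Type*} [mΩ : MeasurableSpace Ω] {P : Measure Ω}
    {𝓕 : Filtration ℝ≥0 mΩ} {b σ : ℝ → ℝ} {Y : ℝ≥0 → Ω → ℝ} {x : ℝ}
    (hY : IsDiffusion b σ 𝓕 P x Y) : PositivePaths mΩ Y :=
  ⟨fun t => (hY.adapted t).mono (𝓕.le t) le_rfl, hY.cont, hY.pos⟩

section Dynkin

variable {Ω : Type*} [mΩ : MeasurableSpace Ω] {P : Measure Ω} [IsProbabilityMeasure P]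
  {𝓕 : Filtration ℝ≥0 mΩ} {b σ V f : ℝ → ℝ} {Y : ℝ≥0 → Ω → ℝ} {x : ℝ}

/-- Martingale increments are orthogonal to bounded functions of the past. The martingale property
is used in this form only. -/
lemma integral_martingale_increment_mul {M : ℝ≥0 → Ω → ℝ} (hM : Martingale M 𝓕 P) {s t : ℝ≥0}
    (hst : s ≤ t) {ζ : Ω → ℝ} (hζ : Measurable[𝓕 s] ζ) {B : ℝ} (hB : ∀ ω, |ζ ω| ≤ B) :
    ∫ ω, (M t ω - M s ω) * ζ ω ∂P = 0 := by
  have hζ' : Measurable ζ := hζ.mono (𝓕.le s) le_rfl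
  have hb : ∀ᵐ ω ∂P, ‖ζ ω‖ ≤ B := .of_forall hB
  have h1 := condExp_stronglyMeasurable_mul_of_bound (𝓕.le s) hζ.stronglyMeasurable
    (hM.integrable t) B hb
  have hi : ∀ u, Integrable (ζ * M u) P := fun u =>
    (hM.integrable u).bdd_mul hζ'.aestronglyMeasurable hb
  have h2 : ∫ ω, (ζ * M t) ω ∂P = ∫ ω, (ζ * M s) ω ∂P := by
    rw [← integral_condExp (𝓕.le s)]
    refine integral_congr_ae (h1.trans ?_)
    filter_upwards [hM.2 s t hst] with ω hω
    simp [hω]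
  have h3 : ∀ ω, (M t ω - M s ω) * ζ ω = (ζ * M t) ω - (ζ * M s) ω := fun ω => by
    simp only [Pi.mul_apply]; ring
  simp_rw [h3]
  rw [integral_sub (hi t) (hi s), h2, sub_self]

lemma continuousOn_opL (hcoef : RegularCoefficients b σ) (hV : ContinuousOn V (Ioi 0))
    (hf : ContDiffOn ℝ 2 f (Ioi 0)) : ContinuousOn (opL b σ V f) (Ioi 0) := by
  obtain ⟨h0, h1, h2⟩ := continuousOn_derivs_of_contDiffOn_two isOpen_Ioi hf
  exact (((continuousOn_const.mul (hcoef.continuousOn_vol.pow 2)).mul h2).add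
    (hcoef.continuousOn_drift.mul h1)).sub (hV.mul h0)

lemma opL_eq_zero_of_notMem_tsupport {y : ℝ} (hy : y ∉ tsupport f) : opL b σ V f y = 0 := by
  have h1 : y ∉ tsupport (deriv f) := fun h => hy (tsupport_deriv_subset h)
  have h2 : y ∉ tsupport (deriv (deriv f)) := fun h => h1 (tsupport_deriv_subset h)
  simp [opL, image_eq_zero_of_notMem_tsupport hy, image_eq_zero_of_notMem_tsupport h1,
    image_eq_zero_of_notMem_tsupport h2]

lemma exists_bound_of_tsupport {g : ℝ → ℝ} (hc : HasCompactSupport f)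
    (hsupp : tsupport f ⊆ Ioi 0) (hg : ContinuousOn g (Ioi 0))
    (h0 : ∀ y, y ∉ tsupport f → g y = 0) : ∃ B, 0 ≤ B ∧ ∀ y, |g y| ≤ B := by
  obtain ⟨B, hB⟩ := IsCompact.exists_bound_of_continuousOn hc (hg.mono hsupp)
  refine ⟨max B 0, le_max_right _ _, fun y => ?_⟩
  by_cases hy : y ∈ tsupport f
  · exact (hB y hy).trans (le_max_left _ _)
  · rw [h0 y hy, abs_zero]; exact le_max_right _ _

/-- Integration by parts, carried out path by path. Let M be the martingale of f, I its compensating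
integral and D the discount factor. With T fixed, s ↦ (M_T + I_s) D_s is differentiable with
derivative (M_T − M_s) D'_s + D_s 𝓛f(Y_s). It runs from M_T to D_T f(Y_T). The first term has mean
zero for every s because D'_s is bounded and known at time s. -/
lemma IsDiffusion.dynkin_finite (hY : IsDiffusion b σ 𝓕 P x Y)
    (hcoef : RegularCoefficients b σ) (hV : ContinuousOn V (Ioi 0))
    (hV0 : ∀ y, 0 < y → 0 ≤ V y) {B : ℝ} (hVB : ∀ y, 0 < y → V y ≤ B)
    (hf : ContDiff ℝ 2 f) (hfc : HasCompactSupport f) (hfs : tsupport f ⊆ Ioi 0) {T : ℝ}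
    (hT : 0 ≤ T) :
    ∫ ω, disc V Y T ω * f (Y T.toNNReal ω) ∂P - f x
      = ∫ ω, (∫ s in (0 : ℝ)..T, disc V Y s ω * opL b σ V f (Y s.toNNReal ω)) ∂P := by
  have hP := hY.positivePaths
  have hfIoi : ContDiffOn ℝ 2 f (Ioi 0) := hf.contDiffOn
  have hg : ContinuousOn (opL b σ 0 f) (Ioi 0) := continuousOn_opL hcoef continuousOn_const hfIoi
  obtain ⟨Bg, hBg0, hBg⟩ := exists_bound_of_tsupport hfc hfs hg
    fun y hy => opL_eq_zero_of_notMem_tsupport hy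
  obtain ⟨Bf, hBf0, hBf⟩ := exists_bound_of_tsupport hfc hfs hf.continuous.continuousOn
    fun y hy => image_eq_zero_of_notMem_tsupport hy
  set I : ℝ → Ω → ℝ := fun t ω => ∫ s in (0 : ℝ)..t, opL b σ 0 f (Y s.toNNReal ω) with hI
  set M : ℝ → Ω → ℝ := fun t ω => f (Y t.toNNReal ω) - I t ω with hM
  have hmart := hY.martingale f hf hfc hfs
  have hId : ∀ ω t, HasDerivAt (fun t => I t ω) (opL b σ 0 f (Y t.toNNReal ω)) t := fun ω t =>
    ((hP.continuous_comp hg ω).integral_hasStrictDerivAt 0 t).hasDerivAt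
  have hIc : ∀ ω, Continuous fun t => I t ω := fun ω =>
    continuous_iff_continuousAt.2 fun t => (hId ω t).continuousAt
  have hfcont : ∀ ω, Continuous fun t : ℝ => f (Y t.toNNReal ω) :=
    hP.continuous_comp hf.continuous.continuousOn
  have hMc : ∀ ω, Continuous fun t => M t ω := fun ω => (hfcont ω).sub (hIc ω)
  have hIm : ∀ t, Measurable (I t) := fun t =>
    measurable_intervalIntegral_of_continuous (H := fun t ω => opL b σ 0 f (Y t.toNNReal ω))
      (hP.continuous_comp hg) (fun t => hP.measurable_comp hg _) 0 t
  have hMm : ∀ t, Measurable (M t) := fun t =>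
    (hP.measurable_comp hf.continuous.continuousOn _).sub (hIm t)
  have hIb : ∀ t ω, 0 ≤ t → |I t ω| ≤ Bg * t := fun t ω ht => by
    have := intervalIntegral.norm_integral_le_of_norm_le_const (a := 0) (b := t) (C := Bg)
      (f := fun s => opL b σ 0 f (Y s.toNNReal ω)) fun s _ => hBg _
    simpa [abs_of_nonneg ht] using this
  have hMb : ∀ t ω, t ∈ Icc 0 T → |M t ω| ≤ Bf + Bg * T := fun t ω ht => by
    have h1 := abs_sub (f (Y t.toNNReal ω)) (I t ω)
    have h2 := hIb t ω ht.1
    have h3 := mul_le_mul_of_nonneg_left ht.2 hBg0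
    have h4 := hBf (Y t.toNNReal ω)
    exact h1.trans (by linarith)
  set ζ : ℝ → Ω → ℝ := fun s ω => -(V (Y s.toNNReal ω) * disc V Y s ω) with hζ
  have hζc : ∀ ω, Continuous fun t => ζ t ω := fun ω =>
    ((hP.continuous_comp hV ω).mul (hP.continuous_disc hV ω)).neg
  have hζm : ∀ t, Measurable (ζ t) := fun t =>
    ((hP.measurable_comp hV _).mul (hP.measurable_disc hV t)).neg
  have hζb : ∀ t ω, 0 ≤ t → |ζ t ω| ≤ B := fun t ω ht => by
    have h0 := hV0 _ (hP.pos ω t.toNNReal)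
    have h1 := disc_pos V Y t ω
    rw [hζ, abs_neg, abs_of_nonneg (mul_nonneg h0 h1.le)]
    have h2 := mul_le_mul (hVB _ (hP.pos ω t.toNNReal)) (hP.disc_le_one hV hV0 ht ω) h1.le
      (h0.trans (hVB _ (hP.pos ω t.toNNReal)))
    linarith
  have hzero : ∀ s ∈ Icc 0 T, ∫ ω, (M T ω - M s ω) * ζ s ω ∂P = 0 := by
    intro s hs
    have hle : s.toNNReal ≤ T.toNNReal := Real.toNNReal_le_toNNReal hs.2
    have hmeas : Measurable[𝓕 s.toNNReal] (ζ s) := by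
      have h1 := hP.measurable_disc_filtration hY.adapted hV s.toNNReal
      rw [Real.coe_toNNReal s hs.1] at h1
      have hP' : PositivePaths (𝓕 s.toNNReal) fun _ => Y s.toNNReal :=
        ⟨fun _ => hY.adapted _, fun _ => continuous_const, fun ω _ => hP.pos ω _⟩
      exact ((hP'.measurable_comp hV 0).mul h1).neg
    have := integral_martingale_increment_mul hmart hle hmeas (fun ω => hζb s ω hs.1)
    simpa only [Real.coe_toNNReal s hs.1, Real.coe_toNNReal T hT] using this
  have hfub : ∫ ω, (∫ s in (0 : ℝ)..T, (M T ω - M s ω) * ζ s ω) ∂P = 0 := by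
    have hjm : Measurable fun p : Ω × ℝ => (M T p.1 - M p.2 p.1) * ζ p.2 p.1 :=
      (((hMm T).comp measurable_fst).sub (measurable_of_continuous_of_measurable hMc hMm)).mul
        (measurable_of_continuous_of_measurable hζc hζm)
    have hint : Integrable (fun p : Ω × ℝ => (M T p.1 - M p.2 p.1) * ζ p.2 p.1)
        (P.prod (volume.restrict (Ioc 0 T))) := by
      refine Integrable.mono' (integrable_const ((Bf + Bg * T + (Bf + Bg * T)) * B))
        hjm.aestronglyMeasurable ?_
      have hpos : ∀ᵐ p : Ω × ℝ ∂(P.prod (volume.restrict (Ioc 0 T))), p.2 ∈ Ioc 0 T :=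
        Measure.quasiMeasurePreserving_snd.ae (ae_restrict_mem measurableSet_Ioc)
      filter_upwards [hpos] with p hp
      rw [norm_mul]
      refine mul_le_mul ((abs_sub _ _).trans (add_le_add (hMb T _ ⟨hT, le_rfl⟩)
        (hMb _ _ ⟨hp.1.le, hp.2⟩))) (hζb _ _ hp.1.le) (norm_nonneg _) (by positivity)
    simp_rw [intervalIntegral.integral_of_le hT]
    rw [integral_integral_swap (f := fun ω s => (M T ω - M s ω) * ζ s ω) hint]
    refine setIntegral_eq_zero_of_forall_eq_zero fun s hs => hzero s ⟨hs.1.le, hs.2⟩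
  have hpath : ∀ ω, ∫ s in (0 : ℝ)..T, (M T ω - M s ω) * ζ s ω
      = disc V Y T ω * f (Y T.toNNReal ω) - M T ω
        - ∫ s in (0 : ℝ)..T, disc V Y s ω * opL b σ V f (Y s.toNNReal ω) := by
    intro ω
    have hop : Continuous fun s : ℝ => disc V Y s ω * opL b σ V f (Y s.toNNReal ω) :=
      (hP.continuous_disc hV ω).mul (hP.continuous_comp (continuousOn_opL hcoef hV hfIoi) ω)
    have hd : ∀ s ∈ uIcc 0 T, HasDerivAt (fun s => (M T ω + I s ω) * disc V Y s ω)
        ((M T ω - M s ω) * ζ s ω + disc V Y s ω * opL b σ V f (Y s.toNNReal ω)) s := by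
      intro s _
      refine (((hId ω s).const_add (M T ω)).mul (hP.hasDerivAt_disc hV ω s)).congr_deriv ?_
      simp only [hM, hζ, opL, Pi.zero_apply]
      ring
    have hc1 : Continuous fun s => (M T ω - M s ω) * ζ s ω :=
      (continuous_const.sub (hMc ω)).mul (hζc ω)
    have h := intervalIntegral.integral_eq_sub_of_hasDerivAt hd
      ((hc1.add hop).intervalIntegrable 0 T)
    rw [intervalIntegral.integral_add (hc1.intervalIntegrable 0 T) (hop.intervalIntegrable 0 T),
      disc_zero] at h
    have h0 : I 0 ω = 0 := by simp [hI]
    rw [h0] at h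
    have hMT : M T ω = f (Y T.toNNReal ω) - I T ω := rfl
    linear_combination h + disc V Y T ω * hMT
  have hMT : ∫ ω, M T ω ∂P = f x := by
    have h1 : ∫ ω, M T ω ∂P = ∫ ω, M 0 ω ∂P := by
      have := integral_martingale_increment_mul hmart (zero_le (a := T.toNNReal))
        (ζ := fun _ => 1) measurable_const (B := 1) (by simp)
      have hi1 := hmart.integrable T.toNNReal
      have hi0 := hmart.integrable 0
      simp only [mul_one] at this
      rw [integral_sub hi1 hi0, sub_eq_zero] at this
      simpa [hM, hI, Real.coe_toNNReal T hT] using this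
    rw [h1]
    have h2 : M 0 =ᵐ[P] fun _ => f x := by
      filter_upwards [hY.init] with ω hω
      simp [hM, hI, hω]
    rw [integral_congr_ae h2]
    simp
  simp_rw [hpath] at hfub
  have hi1 : Integrable (fun ω => disc V Y T ω * f (Y T.toNNReal ω)) P := by
    refine Integrable.mono' (integrable_const Bf) ((hP.measurable_disc hV T).mul
      (hP.measurable_comp hf.continuous.continuousOn _)).aestronglyMeasurable
      (.of_forall fun ω => ?_)
    rw [norm_mul, Real.norm_of_nonneg (disc_pos V Y _ _).le]
    have := mul_le_mul (hP.disc_le_one hV hV0 hT ω) (hBf (Y T.toNNReal ω)) (abs_nonneg _) zero_le_one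
    simpa using this
  have hi2 : Integrable (M T) P := Integrable.mono' (integrable_const (Bf + Bg * T))
    (hMm T).aestronglyMeasurable (.of_forall fun ω => hMb T ω ⟨hT, le_rfl⟩)
  obtain ⟨Bv, hBv0, hBv⟩ := exists_bound_of_tsupport hfc hfs (continuousOn_opL hcoef hV hfIoi)
    fun y hy => opL_eq_zero_of_notMem_tsupport hy
  have hi3 : Integrable (fun ω =>
      ∫ s in (0 : ℝ)..T, disc V Y s ω * opL b σ V f (Y s.toNNReal ω)) P := by
    refine Integrable.mono' (integrable_const (Bv * T))
      (measurable_intervalIntegral_of_continuous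
        (H := fun s ω => disc V Y s ω * opL b σ V f (Y s.toNNReal ω))
        (fun ω => (hP.continuous_disc hV ω).mul
          (hP.continuous_comp (continuousOn_opL hcoef hV hfIoi) ω))
        (fun t => (hP.measurable_disc hV t).mul
          (hP.measurable_comp (continuousOn_opL hcoef hV hfIoi) _)) 0 T).aestronglyMeasurable
      (.of_forall fun ω => ?_)
    have := intervalIntegral.norm_integral_le_of_norm_le_const (a := 0) (b := T) (C := Bv)
      (f := fun s => disc V Y s ω * opL b σ V f (Y s.toNNReal ω)) fun s hs => by
        rw [uIoc_of_le hT] at hs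
        rw [norm_mul, Real.norm_of_nonneg (disc_pos V Y _ _).le]
        have := mul_le_mul (hP.disc_le_one hV hV0 hs.1.le ω) (hBv (Y s.toNNReal ω)) (abs_nonneg _)
          zero_le_one
        simpa using this
    simpa [abs_of_nonneg hT] using this
  have hi12 : Integrable (fun ω => disc V Y T ω * f (Y T.toNNReal ω) - M T ω) P := hi1.sub hi2
  rw [integral_sub hi12 hi3, integral_sub hi1 hi2, hMT] at hfub
  linarith

end Dynkin

end ImpulseControl


namespace ImpulseControl

/-! ### Discounted occupation functionals -/

section Occupation

variable {Ω : Type*} {mΩ : MeasurableSpace Ω} {P : Measure Ω} [IsProbabilityMeasure P]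
  {V G : ℝ → ℝ} {Y : ℝ≥0 → Ω → ℝ} {x v₀ B : ℝ}

/-- The expected discounted payoff `E [∫_0^∞ e^{-∫_0^t V(Y)} G(Y_t) dt]`, as an integral over a
product space. -/
noncomputable def discExp (V : ℝ → ℝ) (P : Measure Ω) (Y : ℝ≥0 → Ω → ℝ) (G : ℝ → ℝ) : ℝ :=
  ∫ p : Ω × ℝ, disc V Y p.2 p.1 * G (Y p.2.toNNReal p.1) ∂(P.prod (volume.restrict (Ioi 0)))

lemma ae_snd_pos {P : Measure Ω} [SFinite P] :
    ∀ᵐ p : Ω × ℝ ∂(P.prod (volume.restrict (Ioi 0))), 0 < p.2 :=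
  Measure.quasiMeasurePreserving_snd.ae (ae_restrict_mem measurableSet_Ioi)

lemma PositivePaths.tendsto_disc (hY : PositivePaths mΩ Y)
    (hV : ContinuousOn V (Ioi 0)) (hv₀ : 0 < v₀) (hlow : ∀ y, 0 < y → v₀ ≤ V y) (ω : Ω) :
    Tendsto (fun t => disc V Y t ω) atTop (𝓝 0) := by
  have h : Tendsto (fun t : ℝ => Real.exp (-v₀ * t)) atTop (𝓝 0) :=
    Real.tendsto_exp_atBot.comp (tendsto_id.const_mul_atTop_of_neg (neg_lt_zero.2 hv₀))
  refine squeeze_zero' (.of_forall fun t => (disc_pos V Y t ω).le) ?_ h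
  filter_upwards [eventually_ge_atTop 0] with t ht
  exact hY.disc_le hV hlow ht ω

/-- The integrand is minus the time derivative of the discount factor, which falls from 1 to 0 along
every path. -/
lemma PositivePaths.discExp_self (hY : PositivePaths mΩ Y)
    (hV : ContinuousOn V (Ioi 0)) (hv₀ : 0 < v₀) (hlow : ∀ y, 0 < y → v₀ ≤ V y)
    (hVB : ∀ y, 0 < y → |V y| ≤ B) : discExp V P Y V = 1 := by
  have hpath : ∀ ω, ∫ t in Ioi (0 : ℝ), disc V Y t ω * V (Y t.toNNReal ω) = 1 := by
    intro ω
    have hd : ∀ t ∈ Ici (0 : ℝ), HasDerivAt (fun t => -disc V Y t ω)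
        (disc V Y t ω * V (Y t.toNNReal ω)) t := fun t _ =>
      (hY.hasDerivAt_disc hV ω t).neg.congr_deriv (by ring)
    have hlim := (hY.tendsto_disc hV hv₀ hlow ω).neg
    have h := integral_Ioi_of_hasDerivAt_of_nonneg' hd (fun t _ => mul_nonneg
      (disc_pos V Y t ω).le (hv₀.le.trans (hlow _ (hY.pos ω _)))) hlim
    simpa [disc_zero] using h
  rw [discExp, integral_prod _ (hY.integrable_disc hV hv₀ hlow hV hVB)]
  simp [hpath]

/-- `V₀` may be unbounded near 0 and ∞, but each path stays in a compact subset of ]0, ∞[ up to a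
finite time, so the extra discounting vanishes pathwise. The function e^{−v₀t}B dominates. -/
lemma PositivePaths.tendsto_discExp (hY : PositivePaths mΩ Y) {r V₀ : ℝ → ℝ} {W : ℕ → ℝ → ℝ}
    (hr : ContinuousOn r (Ioi 0)) (hv₀ : 0 < v₀) (hlow : ∀ y, 0 < y → v₀ ≤ r y)
    (hV₀ : ContinuousOn V₀ (Ioi 0)) (hW : ∀ n, ContinuousOn (W n) (Ioi 0))
    (hW0 : ∀ n y, 0 < y → 0 ≤ W n y) (hWV : ∀ n y, 0 < y → W n y ≤ V₀ y / (n + 1))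
    (hG : ContinuousOn G (Ioi 0)) (hGB : ∀ y, 0 < y → |G y| ≤ B) :
    Tendsto (fun n => discExp (fun y => r y + W n y) P Y G) atTop (𝓝 (discExp r P Y G)) := by
  have hB : 0 ≤ B := (abs_nonneg _).trans (hGB 1 one_pos)
  have hrW : ∀ n, ContinuousOn (fun y => r y + W n y) (Ioi 0) := fun n => hr.add (hW n)
  have hlowW : ∀ n y, 0 < y → v₀ ≤ r y + W n y := fun n y hy => by
    linarith [hlow y hy, hW0 n y hy]
  have hexp : Integrable (fun t => Real.exp (-v₀ * t) * B) (volume.restrict (Ioi 0)) :=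
    (exp_neg_integrableOn_Ioi 0 hv₀).mul_const B
  have hdom : Integrable (fun p : Ω × ℝ => (1 : ℝ) * (Real.exp (-v₀ * p.2) * B))
      (P.prod (volume.restrict (Ioi 0))) := (integrable_const (1 : ℝ)).mul_prod hexp
  refine tendsto_integral_of_dominated_convergence _ (fun n =>
    ((hY.measurable_disc_prod (hrW n)).mul (hY.measurable_prod hG)).aestronglyMeasurable)
    hdom (fun n => ?_) ?_
  · filter_upwards [ae_snd_pos] with p hp
    rw [norm_mul, Real.norm_of_nonneg (disc_pos _ Y _ _).le, Real.norm_eq_abs, one_mul]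
    exact mul_le_mul (hY.disc_le (hrW n) (hlowW n) (le_of_lt hp) _) (hGB _ (hY.pos _ _))
      (abs_nonneg _) (Real.exp_pos _).le
  · filter_upwards [ae_snd_pos] with p hp
    refine Tendsto.mul_const _ ?_
    have hsplit : ∀ n, cumRate (fun y => r y + W n y) Y p.2 p.1
        = cumRate r Y p.2 p.1 + cumRate (W n) Y p.2 p.1 := fun n =>
      intervalIntegral.integral_add ((hY.continuous_comp hr p.1).intervalIntegrable _ _)
        ((hY.continuous_comp (hW n) p.1).intervalIntegrable _ _)
    have hz : Tendsto (fun n => cumRate (W n) Y p.2 p.1) atTop (𝓝 0) := by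
      have h1 : Tendsto (fun n : ℕ => cumRate V₀ Y p.2 p.1 / ((n : ℝ) + 1)) atTop (𝓝 0) :=
        tendsto_const_div_atTop_nhds_zero_nat (cumRate V₀ Y p.2 p.1) |>.comp (tendsto_add_atTop_nat 1) |>.congr
          fun n => by simp
      refine squeeze_zero (fun n => ?_) (fun n => ?_) h1
      · exact intervalIntegral.integral_nonneg hp.le fun t _ => hW0 n _ (hY.pos _ _)
      · rw [cumRate, cumRate, ← intervalIntegral.integral_div]
        refine intervalIntegral.integral_mono_on hp.le
          ((hY.continuous_comp (hW n) p.1).intervalIntegrable _ _)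
          (((hY.continuous_comp hV₀ p.1).div_const _).intervalIntegrable _ _)
          fun t _ => hWV n _ (hY.pos _ _)
    have h2 := (hz.const_add (cumRate r Y p.2 p.1)).neg
    rw [add_zero] at h2
    simp only [disc, hsplit]
    exact (Real.continuous_exp.tendsto _).comp h2

lemma IsDiffusion.dynkin {𝓕 : Filtration ℝ≥0 mΩ} {b σ f : ℝ → ℝ}
    (hY : IsDiffusion b σ 𝓕 P x Y)
    (hcoef : RegularCoefficients b σ) (hV : ContinuousOn V (Ioi 0)) (hv₀ : 0 < v₀)
    (hlow : ∀ y, 0 < y → v₀ ≤ V y) (hVB : ∀ y, 0 < y → |V y| ≤ B)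
    (hf : ContDiff ℝ 2 f) (hfc : HasCompactSupport f) (hfs : tsupport f ⊆ Ioi 0) :
    discExp V P Y (opL b σ V f) = -f x := by
  have hP := hY.positivePaths
  have hop := continuousOn_opL hcoef hV (hf.contDiffOn (s := Ioi 0))
  obtain ⟨Bv, hBv0, hBv⟩ := exists_bound_of_tsupport hfc hfs hop
    fun y hy => opL_eq_zero_of_notMem_tsupport hy
  obtain ⟨Bf, hBf0, hBf⟩ := exists_bound_of_tsupport hfc hfs hf.continuous.continuousOn
    fun y hy => image_eq_zero_of_notMem_tsupport hy
  have hint := hP.integrable_disc (P := P) hV hv₀ hlow hop (fun y _ => hBv y)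
  have hexp : IntegrableOn (fun t => Real.exp (-v₀ * t) * Bv) (Ioi 0) :=
    (exp_neg_integrableOn_Ioi 0 hv₀).mul_const Bv
  have hle : ∀ ω t, 0 < t → ‖disc V Y t ω * opL b σ V f (Y t.toNNReal ω)‖
      ≤ Real.exp (-v₀ * t) * Bv := fun ω t ht => by
    rw [norm_mul, Real.norm_of_nonneg (disc_pos V Y _ _).le]
    exact mul_le_mul (hP.disc_le hV hlow ht.le ω) (hBv _) (norm_nonneg _) (Real.exp_pos _).le
  have hcont : ∀ ω, Continuous fun t => disc V Y t ω * opL b σ V f (Y t.toNNReal ω) := fun ω =>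
    (hP.continuous_disc hV ω).mul (hP.continuous_comp hop ω)
  have hionω : ∀ ω, IntegrableOn (fun t => disc V Y t ω * opL b σ V f (Y t.toNNReal ω)) (Ioi 0) :=
    fun ω => hexp.mono' (hcont ω).aestronglyMeasurable
      ((ae_restrict_mem measurableSet_Ioi).mono fun t ht => hle ω t ht)
  have hlim1 : Tendsto (fun n : ℕ => ∫ ω,
      (∫ s in (0 : ℝ)..n, disc V Y s ω * opL b σ V f (Y s.toNNReal ω)) ∂P) atTop
      (𝓝 (∫ ω, (∫ s in Ioi (0 : ℝ), disc V Y s ω * opL b σ V f (Y s.toNNReal ω)) ∂P)) := by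
    refine tendsto_integral_of_dominated_convergence
      (fun _ => ∫ t in Ioi (0 : ℝ), Real.exp (-v₀ * t) * Bv) (fun n => ?_)
      (integrable_const _) (fun n => .of_forall fun ω => ?_) (.of_forall fun ω => ?_)
    · exact (measurable_intervalIntegral_of_continuous
        (H := fun s ω => disc V Y s ω * opL b σ V f (Y s.toNNReal ω)) hcont
        (fun t => (hP.measurable_disc hV t).mul (hP.measurable_comp hop _)) 0
          n).aestronglyMeasurable
    · have hn : (0 : ℝ) ≤ n := Nat.cast_nonneg n
      rw [intervalIntegral.integral_of_le hn]
      refine (norm_integral_le_of_norm_le (hexp.mono_set Ioc_subset_Ioi_self)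
        ((ae_restrict_mem measurableSet_Ioc).mono fun t ht => hle ω t ht.1)).trans ?_
      exact setIntegral_mono_set hexp (.of_forall fun t => mul_nonneg (Real.exp_pos _).le hBv0)
        (Ioc_subset_Ioi_self.eventuallyLE)
    · exact intervalIntegral_tendsto_integral_Ioi 0 (hionω ω) tendsto_natCast_atTop_atTop
  have hlim2 : Tendsto (fun n : ℕ => ∫ ω, disc V Y n ω * f (Y (n : ℝ).toNNReal ω) ∂P) atTop
      (𝓝 (∫ _ω, (0 : ℝ) ∂P)) := by
    refine tendsto_integral_of_dominated_convergence (fun _ => Bf) (fun n => ?_)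
      (integrable_const _) (fun n => .of_forall fun ω => ?_) (.of_forall fun ω => ?_)
    · exact ((hP.measurable_disc hV n).mul
        (hP.measurable_comp hf.continuous.continuousOn _)).aestronglyMeasurable
    · rw [norm_mul, Real.norm_of_nonneg (disc_pos V Y _ _).le]
      have := mul_le_mul (hP.disc_le_one hV (fun y hy => hv₀.le.trans (hlow y hy))
        (Nat.cast_nonneg n) ω) (hBf (Y (n : ℝ).toNNReal ω)) (abs_nonneg _) zero_le_one
      simpa using this
    · have h := ((hP.tendsto_disc hV hv₀ hlow ω).comp tendsto_natCast_atTop_atTop).mul_const Bf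
      rw [zero_mul] at h
      refine squeeze_zero_norm (fun n => ?_) h
      rw [norm_mul, Real.norm_of_nonneg (disc_pos V Y _ _).le]
      exact mul_le_mul_of_nonneg_left (hBf _) (disc_pos V Y _ _).le
  rw [integral_zero] at hlim2
  have heq : ∀ n : ℕ, ∫ ω, disc V Y n ω * f (Y (n : ℝ).toNNReal ω) ∂P - f x
      = ∫ ω, (∫ s in (0 : ℝ)..n, disc V Y s ω * opL b σ V f (Y s.toNNReal ω)) ∂P := fun n =>
    hY.dynkin_finite hcoef hV (fun y hy => hv₀.le.trans (hlow y hy))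
      (fun y hy => (le_abs_self _).trans (hVB y hy)) hf hfc hfs (Nat.cast_nonneg n)
  rw [discExp, integral_prod _ hint, ← zero_sub]
  exact tendsto_nhds_unique hlim1 ((hlim2.sub_const (f x)).congr heq)

end Occupation

/-! ### Bounded Green potentials -/

section Compact

variable {b σ r φ ψ F w : ℝ → ℝ} {C a c : ℝ}

lemma integrable_of_eq_zero_off (hcoef : RegularCoefficients b σ) (hw : ContinuousOn w (Ioi 0))
    (hF : ContinuousOn F (Ioi 0)) (ha : 0 < a) (h0 : ∀ y, y ∉ Icc a c → F y = 0) :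
    Integrable fun y => w y * F y * speedDensity b σ y := by
  have hsub : Icc a c ⊆ Ioi 0 := fun y hy => ha.trans_le hy.1
  have h := (((continuousOn_mul_speedDensity hcoef hw hF).mono hsub).integrableOn_Icc
    (μ := volume)).integrable_indicator measurableSet_Icc
  refine h.congr (.of_forall fun y => ?_)
  by_cases hy : y ∈ Icc a c
  · rw [indicator_of_mem hy]
  · simp [indicator_of_notMem hy, h0 y hy]

lemma greenIntegrable_of_eq_zero_off (hcoef : RegularCoefficients b σ)
    (hfund : FundamentalSolutions b σ r φ ψ)
    (hF : ContinuousOn F (Ioi 0)) (ha : 0 < a) (h0 : ∀ y, y ∉ Icc a c → F y = 0) :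
    GreenIntegrable b σ φ ψ F :=
  ⟨fun _ _ => (integrable_of_eq_zero_off hcoef hfund.psi_smooth.continuousOn hF ha h0).integrableOn,
    fun _ _ => (integrable_of_eq_zero_off hcoef hfund.phi_smooth.continuousOn hF ha
      h0).integrableOn⟩

/-- The first integral vanishes to the left of the support, so φ matters only where it is at most
φ(a). The second vanishes to the right, so ψ matters only where it is at most ψ(c). -/
lemma exists_green_bound (hcoef : RegularCoefficients b σ)
    (hfund : FundamentalSolutions b σ r φ ψ) (hC : 0 < C)
    (hF : ContinuousOn F (Ioi 0)) (ha : 0 < a) (hac : a ≤ c) (h0 : ∀ y, y ∉ Icc a c → F y = 0) :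
    ∃ U, ∀ y, 0 < y → |green b σ φ ψ C F y| ≤ U := by
  have hA := integrable_of_eq_zero_off hcoef hfund.psi_smooth.continuousOn hF ha h0
  have hB := integrable_of_eq_zero_off hcoef hfund.phi_smooth.continuousOn hF ha h0
  have hc : 0 < c := ha.trans_le hac
  refine ⟨(φ a * (∫ y, ‖ψ y * F y * speedDensity b σ y‖)
    + ψ c * ∫ y, ‖φ y * F y * speedDensity b σ y‖) / C, fun y hy => ?_⟩
  have h1 : |φ y * lowerInt b σ ψ F y| ≤ φ a * ∫ y, ‖ψ y * F y * speedDensity b σ y‖ := by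
    have hnn : 0 ≤ φ a * ∫ y, ‖ψ y * F y * speedDensity b σ y‖ :=
      mul_nonneg (hfund.phi_pos a ha).le (integral_nonneg fun _ => norm_nonneg _)
    by_cases hya : y < a
    · have : lowerInt b σ ψ F y = 0 :=
        setIntegral_eq_zero_of_forall_eq_zero fun z hz => by
          rw [h0 z fun h => absurd (h.1.trans hz.2) (not_le.2 hya)]; simp
      rwa [this, mul_zero, abs_zero]
    · rw [abs_mul, abs_of_pos (hfund.phi_pos y hy)]
      refine mul_le_mul (hfund.phi_strictAnti.antitoneOn ha hy (not_lt.1 hya)) ?_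
        (abs_nonneg _) (hfund.phi_pos a ha).le
      exact (norm_integral_le_integral_norm _).trans
        (setIntegral_le_integral hA.norm (.of_forall fun _ => norm_nonneg _))
  have h2 : |ψ y * upperInt b σ φ F y| ≤ ψ c * ∫ y, ‖φ y * F y * speedDensity b σ y‖ := by
    have hnn : 0 ≤ ψ c * ∫ y, ‖φ y * F y * speedDensity b σ y‖ :=
      mul_nonneg (hfund.psi_pos c hc).le (integral_nonneg fun _ => norm_nonneg _)
    by_cases hyc : c ≤ y
    · have : upperInt b σ φ F y = 0 :=
        setIntegral_eq_zero_of_forall_eq_zero fun z (hz : y < z) => by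
          rw [h0 z fun h => absurd (hyc.trans_lt hz) (not_lt.2 h.2)]; simp
      rwa [this, mul_zero, abs_zero]
    · rw [abs_mul, abs_of_pos (hfund.psi_pos y hy)]
      refine mul_le_mul (hfund.psi_strictMono.monotoneOn hy hc (not_le.1 hyc).le) ?_
        (abs_nonneg _) (hfund.psi_pos c hc).le
      exact (norm_integral_le_integral_norm _).trans
        (setIntegral_le_integral hB.norm (.of_forall fun _ => norm_nonneg _))
  rw [green, abs_div, abs_of_pos hC]
  exact div_le_div_of_nonneg_right ((abs_add_le _ _).trans (add_le_add h1 h2)) hC.le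

end Compact

/-! ### Logarithmic cut-off functions -/

/-- A smooth bump function which is `1` on `[-1, 1]` and `0` off `]-2, 2[`. -/
noncomputable def stdBump : ContDiffBump (0 : ℝ) := ⟨1, 2, one_pos, one_lt_two⟩

/-- The cut-off function `x ↦ η (log x / (n + 1))` on `]0, ∞[`. -/
noncomputable def cutoff (n : ℕ) (x : ℝ) : ℝ :=
  if 0 < x then stdBump (Real.log x / (n + 1)) else 0

lemma cutoff_nonneg (n : ℕ) (x : ℝ) : 0 ≤ cutoff n x := by
  rw [cutoff]; split_ifs
  · exact stdBump.nonneg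
  · exact le_rfl

lemma cutoff_le_one (n : ℕ) (x : ℝ) : cutoff n x ≤ 1 := by
  rw [cutoff]; split_ifs
  · exact stdBump.le_one
  · exact zero_le_one

lemma cutoff_eq_one {n : ℕ} {x : ℝ} (hx : 0 < x) (h : |Real.log x| ≤ n + 1) : cutoff n x = 1 := by
  rw [cutoff, if_pos hx]
  refine stdBump.one_of_mem_closedBall ?_
  have hn : (0 : ℝ) < n + 1 := by positivity
  rw [mem_closedBall_zero_iff, Real.norm_eq_abs, abs_div, abs_of_pos hn, div_le_iff₀ hn]
  simpa [stdBump] using h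

lemma cutoff_eq_zero {n : ℕ} {x : ℝ}
    (h : x ∉ Icc (Real.exp (-(2 * (n + 1)))) (Real.exp (2 * (n + 1)))) : cutoff n x = 0 := by
  rw [cutoff]
  split_ifs with hx
  · refine stdBump.zero_of_le_dist ?_
    have hn : (0 : ℝ) < n + 1 := by positivity
    rw [dist_zero_right, Real.norm_eq_abs, abs_div, abs_of_pos hn, le_div_iff₀ hn]
    change 2 * ((n : ℝ) + 1) ≤ |Real.log x|
    by_contra! hlt
    obtain ⟨h1, h2⟩ := abs_lt.1 hlt
    exact h ⟨(Real.lt_log_iff_exp_lt hx).1 h1 |>.le, (Real.log_lt_iff_lt_exp hx).1 h2 |>.le⟩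
  · rfl

lemma eventually_cutoff_eq_one {x : ℝ} (hx : 0 < x) : ∀ᶠ n in atTop, cutoff n x = 1 := by
  obtain ⟨N, hN⟩ := exists_nat_ge |Real.log x|
  filter_upwards [eventually_ge_atTop N] with n hn
  refine cutoff_eq_one hx (hN.trans ?_)
  have : (N : ℝ) ≤ n := Nat.cast_le.2 hn
  linarith

lemma hasDerivAt_cutoff (n : ℕ) {x : ℝ} (hx : 0 < x) :
    HasDerivAt (cutoff n) (deriv stdBump (Real.log x / (n + 1)) * (x⁻¹ / (n + 1))) x := by
  have h1 : HasDerivAt stdBump (deriv stdBump (Real.log x / (n + 1))) (Real.log x / (n + 1)) :=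
    ((stdBump.contDiff (n := 1)).differentiable one_ne_zero _).hasDerivAt
  have h2 := HasDerivAt.comp x h1 ((Real.hasDerivAt_log hx.ne').div_const ((n : ℝ) + 1))
  refine h2.congr_of_eventuallyEq ?_
  filter_upwards [Ioi_mem_nhds hx] with y hy
  rw [cutoff, if_pos (mem_Ioi.1 hy)]
  rfl

lemma hasDerivAt_deriv_cutoff (n : ℕ) {x : ℝ} (hx : 0 < x) :
    HasDerivAt (deriv (cutoff n))
      (deriv (deriv stdBump) (Real.log x / (n + 1)) * (x⁻¹ / (n + 1)) ^ 2
        - deriv stdBump (Real.log x / (n + 1)) * ((x ^ 2)⁻¹ / (n + 1))) x := by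
  have hb : ContDiff ℝ 2 stdBump := stdBump.contDiff
  have h1 : HasDerivAt (deriv stdBump) (deriv (deriv stdBump) (Real.log x / (n + 1)))
      (Real.log x / (n + 1)) :=
    (hasDerivAt_of_contDiffOn_two isOpen_univ hb.contDiffOn (mem_univ _)).2
  have h2 := (HasDerivAt.comp x h1 ((Real.hasDerivAt_log hx.ne').div_const ((n : ℝ) + 1))).mul
    ((hasDerivAt_inv hx.ne').div_const ((n : ℝ) + 1))
  refine (h2.congr_of_eventuallyEq ?_).congr_deriv ?_
  · filter_upwards [Ioi_mem_nhds hx] with y hy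
    rw [(hasDerivAt_cutoff n hy).deriv]
    rfl
  · simp only [Function.comp]
    ring

lemma contDiffOn_cutoff (n : ℕ) : ContDiffOn ℝ 2 (cutoff n) (Ioi 0) := by
  have h : ContDiffOn ℝ 2 (fun x => stdBump (Real.log x / (n + 1))) (Ioi 0) :=
    (stdBump.contDiff (n := 2)).comp_contDiffOn ((contDiffOn_id.log fun x hx => ne_of_gt hx).div_const _)
  exact h.congr fun x hx => by rw [cutoff, if_pos (mem_Ioi.1 hx)]

lemma exists_bump_bound : ∃ K, 0 ≤ K ∧ ∀ y, |deriv stdBump y| ≤ K ∧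
    |deriv (deriv stdBump) y| ≤ K := by
  have hb : ContDiff ℝ 2 stdBump := stdBump.contDiff
  have hc := continuousOn_derivs_of_contDiffOn_two isOpen_univ hb.contDiffOn
  obtain ⟨K₁, h1⟩ := (stdBump.hasCompactSupport.deriv).exists_bound_of_continuous
    (continuousOn_univ.1 hc.2.1)
  obtain ⟨K₂, h2⟩ := (stdBump.hasCompactSupport.deriv.deriv).exists_bound_of_continuous
    (continuousOn_univ.1 hc.2.2)
  exact ⟨max K₁ K₂, (norm_nonneg _).trans ((h1 0).trans (le_max_left _ _)),
    fun y => ⟨(h1 y).trans (le_max_left _ _), (h2 y).trans (le_max_right _ _)⟩⟩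

end ImpulseControl


namespace ImpulseControl

/-! ### The resolvent is the Green operator -/

variable {b σ r φ ψ F u : ℝ → ℝ} {C : ℝ}

lemma hasCompactSupport_mul_cutoff (u : ℝ → ℝ) (n : ℕ) :
    HasCompactSupport (fun y => u y * cutoff n y) ∧
      tsupport (fun y => u y * cutoff n y) ⊆
        Icc (Real.exp (-(2 * (n + 1)))) (Real.exp (2 * (n + 1))) := by
  have h : tsupport (fun y => u y * cutoff n y) ⊆
      Icc (Real.exp (-(2 * (n + 1)))) (Real.exp (2 * (n + 1))) :=
    closure_minimal (fun y hy => by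
      by_contra hcon
      exact hy (by simp [cutoff_eq_zero hcon])) isClosed_Icc
  exact ⟨isCompact_Icc.of_isClosed_subset (isClosed_tsupport _) h, h⟩

lemma contDiff_mul_cutoff (hu : ContDiffOn ℝ 2 u (Ioi 0)) (n : ℕ) :
    ContDiff ℝ 2 (fun y => u y * cutoff n y) := by
  obtain ⟨-, hs⟩ := hasCompactSupport_mul_cutoff u n
  rw [contDiff_iff_contDiffAt]
  intro x
  by_cases hx : x ∈ tsupport (fun y => u y * cutoff n y)
  · exact (hu.mul (contDiffOn_cutoff n)).contDiffAt
      (Ioi_mem_nhds ((Real.exp_pos _).trans_le (hs hx).1))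
  · exact contDiffAt_const.congr_of_eventuallyEq (notMem_tsupport_iff_eventuallyEq.1 hx)

/-- The product rule, with the rates on the two sides decoupled: the operator acts on the product
with rate `V`, and on `u` with rate `r`. In the application `v` is a cut-off function and the
difference of the rates is the extra discounting. -/
lemma opL_mul {v : ℝ → ℝ} (hu : ContDiffOn ℝ 2 u (Ioi 0)) (hv : ContDiffOn ℝ 2 v (Ioi 0)) (V : ℝ → ℝ)
    {y : ℝ} (hy : 0 < y) :
    opL b σ V (fun z => u z * v z) y = v y * opL b σ r u y
      + ((1 / 2) * σ y ^ 2 * (2 * deriv u y * deriv v y + u y * deriv (deriv v) y)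
        + b y * (u y * deriv v y)) - (V y - r y) * (u y * v y) := by
  have h1 : ∀ z, 0 < z → HasDerivAt (fun z => u z * v z) (deriv u z * v z + u z * deriv v z) z :=
    fun z hz => (hasDerivAt_of_contDiffOn_two isOpen_Ioi hu hz).1.mul
      (hasDerivAt_of_contDiffOn_two isOpen_Ioi hv hz).1
  have h2 : deriv (deriv fun z => u z * v z) y
      = deriv (deriv u) y * v y + deriv u y * deriv v y
        + (deriv u y * deriv v y + u y * deriv (deriv v) y) := by
    obtain ⟨u1, u2⟩ := hasDerivAt_of_contDiffOn_two isOpen_Ioi hu hy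
    obtain ⟨v1, v2⟩ := hasDerivAt_of_contDiffOn_two isOpen_Ioi hv hy
    refine HasDerivAt.deriv (((u2.mul v1).add (u1.mul v2)).congr_of_eventuallyEq ?_)
    filter_upwards [Ioi_mem_nhds hy] with z hz
    exact (h1 z hz).deriv
  simp only [opL, h2, (h1 y hy).deriv]
  ring

/-- The error made by cutting off `u` is dominated by a fixed function divided by `n + 1`. -/
lemma exists_cutoff_error (hcoef : RegularCoefficients b σ) (hu : ContDiffOn ℝ 2 u (Ioi 0)) :
    ∃ V₀ : ℝ → ℝ, ContinuousOn V₀ (Ioi 0) ∧ (∀ y, 0 < y → 0 ≤ V₀ y) ∧ ∀ (n : ℕ) (y : ℝ), 0 < y →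
      |(1 / 2) * σ y ^ 2 * (2 * deriv u y * deriv (cutoff n) y + u y * deriv (deriv (cutoff n)) y)
        + b y * (u y * deriv (cutoff n) y)| ≤ V₀ y / (n + 1) := by
  obtain ⟨K, hK, hKb⟩ := exists_bump_bound
  obtain ⟨c0, c1, -⟩ := continuousOn_derivs_of_contDiffOn_two isOpen_Ioi hu
  have cinv : ContinuousOn (fun y : ℝ => y⁻¹) (Ioi 0) :=
    continuousOn_inv₀.mono fun y hy => ne_of_gt hy
  -- `K` bounds the first two derivatives of the bump. By the chain rule each derivative of the
  -- cut-off carries a factor 1/(n + 1); a squared factor is bounded by a single one.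
  refine ⟨fun y => (1 / 2) * σ y ^ 2 * (2 * |deriv u y| * (K * y⁻¹) + |u y| * (2 * K * y⁻¹ ^ 2))
    + |b y| * (|u y| * (K * y⁻¹)), ?_, ?_, ?_⟩
  · have hσ := hcoef.continuousOn_vol
    have hb := hcoef.continuousOn_drift
    exact ((continuousOn_const.mul (hσ.pow 2)).mul
      (((continuousOn_const.mul c1.abs).mul (continuousOn_const.mul cinv)).add
        (c0.abs.mul (continuousOn_const.mul (cinv.pow 2))))).add
      (hb.abs.mul (c0.abs.mul (continuousOn_const.mul cinv)))
  · intro y hy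
    positivity
  · intro n y hy
    have hn : (0 : ℝ) < n + 1 := by positivity
    have hn1 : (1 : ℝ) ≤ n + 1 := by linarith [Nat.cast_nonneg (α := ℝ) n]
    set t := Real.log y / ((n : ℝ) + 1)
    obtain ⟨k1, k2⟩ := hKb t
    have e1 : |deriv (cutoff n) y| ≤ K * y⁻¹ / (n + 1) := by
      rw [(hasDerivAt_cutoff n hy).deriv, abs_mul, abs_of_pos (by positivity : 0 < y⁻¹ / ((n : ℝ) + 1)),
        mul_div_assoc]
      exact mul_le_mul_of_nonneg_right k1 (by positivity)
    have e2 : |deriv (deriv (cutoff n)) y| ≤ 2 * K * y⁻¹ ^ 2 / (n + 1) := by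
      rw [(hasDerivAt_deriv_cutoff n hy).deriv]
      refine (abs_sub _ _).trans ?_
      rw [abs_mul, abs_mul, abs_of_pos (by positivity : 0 < (y⁻¹ / ((n : ℝ) + 1)) ^ 2),
        abs_of_pos (by positivity : 0 < (y ^ 2)⁻¹ / ((n : ℝ) + 1))]
      have hsq : (y⁻¹ / ((n : ℝ) + 1)) ^ 2 ≤ y⁻¹ ^ 2 / (n + 1) := by
        rw [div_pow]
        exact div_le_div_of_nonneg_left (by positivity) hn (by nlinarith)
      have h1 := mul_le_mul k2 hsq (by positivity) hK
      have h2 := mul_le_mul_of_nonneg_right k1 (by positivity : 0 ≤ (y ^ 2)⁻¹ / ((n : ℝ) + 1))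
      calc _ ≤ K * (y⁻¹ ^ 2 / (n + 1)) + K * ((y ^ 2)⁻¹ / ((n : ℝ) + 1)) := add_le_add h1 h2
        _ = _ := by rw [inv_pow]; ring
    calc _ ≤ (1 / 2) * σ y ^ 2 * (2 * |deriv u y| * |deriv (cutoff n) y|
          + |u y| * |deriv (deriv (cutoff n)) y|) + |b y| * (|u y| * |deriv (cutoff n) y|) := by
          refine (abs_add_le _ _).trans (add_le_add ?_ ?_)
          · rw [abs_mul, abs_of_nonneg (by positivity : 0 ≤ 1 / 2 * σ y ^ 2)]
            refine mul_le_mul_of_nonneg_left ((abs_add_le _ _).trans (le_of_eq ?_)) (by positivity)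
            simp [abs_mul]
          · simp [abs_mul]
      _ ≤ (1 / 2) * σ y ^ 2 * (2 * |deriv u y| * (K * y⁻¹ / (n + 1))
          + |u y| * (2 * K * y⁻¹ ^ 2 / (n + 1))) + |b y| * (|u y| * (K * y⁻¹ / (n + 1))) := by
          gcongr
      _ = _ := by ring

section Resolvent

variable {Ω : Type*} {mΩ : MeasurableSpace Ω} {P : Measure Ω} [IsProbabilityMeasure P]
  {𝓕 : Filtration ℝ≥0 mΩ} {Y : ℝ≥0 → Ω → ℝ} {x : ℝ}

lemma PositivePaths.discExp_mono_abs (hY : PositivePaths mΩ Y) {V G H : ℝ → ℝ} {v₀ B : ℝ}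
    (hV : ContinuousOn V (Ioi 0)) (hv₀ : 0 < v₀) (hlow : ∀ y, 0 < y → v₀ ≤ V y)
    (hH : ContinuousOn H (Ioi 0)) (hHB : ∀ y, 0 < y → |H y| ≤ B)
    (hGH : ∀ y, 0 < y → |G y| ≤ H y) : |discExp V P Y G| ≤ discExp V P Y H := by
  simp only [discExp]
  rw [← Real.norm_eq_abs]
  refine norm_integral_le_of_norm_le (hY.integrable_disc (P := P) hV hv₀ hlow hH hHB)
    (.of_forall fun p => ?_)
  rw [norm_mul, Real.norm_of_nonneg (disc_pos _ Y _ _).le]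
  exact mul_le_mul_of_nonneg_left (hGH _ (hY.pos _ _)) (disc_pos _ Y _ _).le

lemma PositivePaths.discExp_add (hY : PositivePaths mΩ Y) {V G H : ℝ → ℝ} {v₀ B B' : ℝ}
    (hV : ContinuousOn V (Ioi 0)) (hv₀ : 0 < v₀) (hlow : ∀ y, 0 < y → v₀ ≤ V y)
    (hG : ContinuousOn G (Ioi 0)) (hGB : ∀ y, 0 < y → |G y| ≤ B')
    (hH : ContinuousOn H (Ioi 0)) (hHB : ∀ y, 0 < y → |H y| ≤ B) :
    discExp V P Y (fun y => G y + H y) = discExp V P Y G + discExp V P Y H := by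
  simp only [discExp, mul_add]
  exact integral_add (hY.integrable_disc hV hv₀ hlow hG hGB)
    (hY.integrable_disc hV hv₀ hlow hH hHB)

/-- Dynkin's formula only covers compactly supported functions, and u is not one. With η the cut-off
function, 𝓛(uη) + F is an error of size V₀/(n + 1), where V₀ need not be bounded. Raising the
discounting rate by W_n, which equals this error bound on the support of uη, makes the error at most
(1 + U) W_n, where U bounds |u|. The discounted expectation of W_n tends to 0. -/
lemma IsDiffusion.discExp_eq_green_of_compact (hY : IsDiffusion b σ 𝓕 P x Y) (hx : 0 < x)
    (hcoef : RegularCoefficients b σ) (hr : DiscountRate r)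
    (hfund : FundamentalSolutions b σ r φ ψ) (hC : 0 < C)
    (hW : ∀ x, 0 < x → φ x * flux b σ ψ x - ψ x * flux b σ φ x = C)
    (hF : ContinuousOn F (Ioi 0)) {a c : ℝ} (ha : 0 < a) (hac : a ≤ c)
    (h0 : ∀ y, y ∉ Icc a c → F y = 0) : discExp r P Y F = green b σ φ ψ C F x := by
  have hP := hY.positivePaths
  have hint := greenIntegrable_of_eq_zero_off hcoef hfund hF ha h0
  set u := green b σ φ ψ C F with hu
  have hu2 : ContDiffOn ℝ 2 u (Ioi 0) := contDiffOn_green hcoef hr hfund hC hW hF hint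
  obtain ⟨U, hU⟩ := exists_green_bound hcoef hfund hC hF ha hac h0
  have hU0 : 0 ≤ U := (abs_nonneg _).trans (hU 1 one_pos)
  obtain ⟨V₀, hV₀c, hV₀0, hV₀⟩ := exists_cutoff_error hcoef hu2
  obtain ⟨r₀, hr₀, hr₀'⟩ := hr.lower
  obtain ⟨r₁, hr₁⟩ := hr.bdd
  have hrlow : ∀ y, 0 < y → r₀ ≤ r y := fun y hy => hr₀' y hy.le
  have hrabs : ∀ y, 0 < y → |r y| ≤ r₁ := fun y hy => by
    rw [abs_of_pos (hr.pos hy)]; exact hr₁ y hy.le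
  obtain ⟨BF, hBF⟩ : ∃ B, ∀ y, |F y| ≤ B := by
    obtain ⟨B, hB⟩ := isCompact_Icc.exists_bound_of_continuousOn
      (hF.mono fun y (hy : y ∈ Icc a c) => ha.trans_le hy.1)
    refine ⟨max B 0, fun y => ?_⟩
    by_cases hy : y ∈ Icc a c
    · exact (hB y hy).trans (le_max_left _ _)
    · rw [h0 y hy, abs_zero]; exact le_max_right _ _
  have hcut : ∀ n : ℕ, ∃ B : ℝ, 0 ≤ B ∧
      ∀ y ∈ Icc (Real.exp (-(2 * ((n : ℝ) + 1)))) (Real.exp (2 * (n + 1))), V₀ y / (n + 1) ≤ B := by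
    intro n
    obtain ⟨B, hB⟩ := isCompact_Icc.exists_bound_of_continuousOn ((hV₀c.div_const ((n : ℝ) + 1)).mono
      fun y (hy : y ∈ Icc (Real.exp (-(2 * ((n : ℝ) + 1)))) (Real.exp (2 * (n + 1)))) =>
        (Real.exp_pos _).trans_le hy.1)
    exact ⟨max B 0, le_max_right _ _, fun y hy =>
      (le_abs_self _).trans ((hB y hy).trans (le_max_left _ _))⟩
  choose B hB0 hB using hcut
  -- The truncation keeps the rate bounded, as Dynkin's formula requires. `B n` is chosen so that
  -- the truncation is inactive on the interval that contains the support of the n-th cut-off.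
  set W : ℕ → ℝ → ℝ := fun n y => min (V₀ y / (n + 1)) (B n) with hWdef
  have hWc : ∀ n, ContinuousOn (W n) (Ioi 0) := fun n =>
    (hV₀c.div_const ((n : ℝ) + 1)).inf continuousOn_const
  have hW0 : ∀ n y, 0 < y → 0 ≤ W n y := fun n y hy =>
    le_min (div_nonneg (hV₀0 y hy) (by positivity)) (hB0 n)
  have hWB : ∀ n y, 0 < y → |W n y| ≤ B n := fun n y hy => by
    rw [abs_of_nonneg (hW0 n y hy)]; exact min_le_right _ _
  have hlim : ∀ {G : ℝ → ℝ} {B' : ℝ}, ContinuousOn G (Ioi 0) → (∀ y, 0 < y → |G y| ≤ B') →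
      Tendsto (fun n => discExp (fun y => r y + W n y) P Y G) atTop (𝓝 (discExp r P Y G)) :=
    fun hG hGB => hP.tendsto_discExp hr.continuousOn_Ioi hr₀ hrlow hV₀c hWc hW0
      (fun n y _ => min_le_left _ _) hG hGB
  have hVc : ∀ n, ContinuousOn (fun y => r y + W n y) (Ioi 0) := fun n =>
    hr.continuousOn_Ioi.add (hWc n)
  have hVlow : ∀ n y, 0 < y → r₀ ≤ r y + W n y := fun n y hy => by
    linarith [hrlow y hy, hW0 n y hy]
  have hVabs : ∀ n y, 0 < y → |r y + W n y| ≤ r₁ + B n := fun n y hy =>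
    (abs_add_le _ _).trans (add_le_add (hrabs y hy) (hWB n y hy))
  -- Under the rate r + W_n the discounted expectations of r and W_n add up to 1, and the one of r
  -- tends to 1.
  have hδ : Tendsto (fun n => discExp (fun y => r y + W n y) P Y (W n)) atTop (𝓝 0) := by
    have h1 : ∀ n, 1 - discExp (fun y => r y + W n y) P Y r
        = discExp (fun y => r y + W n y) P Y (W n) := fun n => by
      have h := hP.discExp_self (P := P) (hVc n) hr₀ (hVlow n) (hVabs n)
      rw [hP.discExp_add (hVc n) hr₀ (hVlow n) hr.continuousOn_Ioi hrabs (hWc n) (hWB n)] at h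
      linarith
    have h2 := (hlim hr.continuousOn_Ioi hrabs).const_sub 1
    rw [hP.discExp_self hr.continuousOn_Ioi hr₀ hrlow hrabs, sub_self] at h2
    exact h2.congr h1
  have hev : ∀ᶠ n : ℕ in atTop, ∀ y ∈ Icc a c, cutoff n y = 1 := by
    obtain ⟨N, hN⟩ := exists_nat_ge (max |Real.log a| |Real.log c|)
    filter_upwards [eventually_ge_atTop N] with n hn y hy
    refine cutoff_eq_one (ha.trans_le hy.1) ?_
    have h1 := Real.log_le_log ha hy.1
    have h2 := Real.log_le_log (ha.trans_le hy.1) hy.2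
    have h3 : (N : ℝ) ≤ n := Nat.cast_le.2 hn
    have h4 := (le_max_left |Real.log a| |Real.log c|).trans hN
    have h5 := (le_max_right |Real.log a| |Real.log c|).trans hN
    rw [abs_le] at h4 h5 ⊢
    constructor <;> linarith
  have hmain : ∀ᶠ n : ℕ in atTop, |discExp (fun y => r y + W n y) P Y F - u x|
      ≤ (1 + U) * discExp (fun y => r y + W n y) P Y (W n) := by
    filter_upwards [hev, eventually_cutoff_eq_one hx] with n hn hxn
    obtain ⟨hfc, hfs⟩ := hasCompactSupport_mul_cutoff u n
    have hfs' : tsupport (fun y => u y * cutoff n y) ⊆ Ioi 0 :=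
      hfs.trans fun y hy => (Real.exp_pos _).trans_le hy.1
    have hf2 := contDiff_mul_cutoff hu2 n
    have hd := hY.dynkin hcoef (hVc n) hr₀ (hVlow n) (hVabs n) hf2 hfc hfs'
    set V : ℝ → ℝ := fun y => r y + W n y with hV
    have hop : ContinuousOn (opL b σ V fun y => u y * cutoff n y) (Ioi 0) :=
      continuousOn_opL hcoef (hVc n) hf2.contDiffOn
    obtain ⟨Bo, -, hBo⟩ := exists_bound_of_tsupport hfc hfs' hop
      fun y hy => opL_eq_zero_of_notMem_tsupport hy
    have hadd := hP.discExp_add (P := P) (hVc n) hr₀ (hVlow n) hF (fun y _ => hBF y) hop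
      (fun y _ => hBo y)
    rw [hd, hxn, mul_one] at hadd
    rw [sub_eq_add_neg, ← hadd]
    have hscale : (1 + U) * discExp V P Y (W n) = discExp V P Y fun y => (1 + U) * W n y := by
      simp only [discExp]
      rw [← integral_const_mul]
      refine integral_congr_ae (.of_forall fun p => ?_)
      ring
    rw [hscale]
    refine hP.discExp_mono_abs (B := (1 + U) * B n) (hVc n) hr₀ (hVlow n)
      (continuousOn_const.mul (hWc n)) (fun y hy => ?_) fun y hy => ?_
    · rw [abs_mul, abs_of_nonneg (by positivity : 0 ≤ 1 + U)]
      exact mul_le_mul_of_nonneg_left (hWB n y hy) (by positivity)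
    · by_cases hsup : y ∈ tsupport (fun y => u y * cutoff n y)
      · have hFcut : cutoff n y * F y = F y := by
          by_cases hyI : y ∈ Icc a c
          · rw [hn y hyI, one_mul]
          · rw [h0 y hyI, mul_zero]
        have hWeq : W n y = V₀ y / (n + 1) := min_eq_left (hB n y (hfs hsup))
        rw [opL_mul (r := r) hu2 (contDiffOn_cutoff n) V hy,
          opL_green hcoef hr hfund hC hW hF hint hy, mul_neg, hFcut]
        have e := hV₀ n y hy
        set err := (1 / 2) * σ y ^ 2 * (2 * deriv u y * deriv (cutoff n) y
          + u y * deriv (deriv (cutoff n)) y) + b y * (u y * deriv (cutoff n) y)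
        have hVr : V y - r y = W n y := by simp [hV]
        rw [hVr, show F y + (-F y + err - W n y * (u y * cutoff n y))
          = err - W n y * (u y * cutoff n y) by ring, add_mul, one_mul]
        refine (abs_sub _ _).trans (add_le_add (by rwa [hWeq]) ?_)
        rw [abs_mul, abs_of_nonneg (hW0 n y hy), mul_comm, abs_mul,
          abs_of_nonneg (cutoff_nonneg n y)]
        refine mul_le_mul_of_nonneg_right ?_ (hW0 n y hy)
        have := mul_le_mul (hU y hy) (cutoff_le_one n y) (cutoff_nonneg n y) hU0
        simpa using this
      -- If F(y) were not 0, the cut-off would be nonzero near y. Off the support of the product u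
      -- would then vanish near y, and F = −𝓛u = 0 at y after all.
      · have hFy : F y = 0 := by
          by_contra hne
          have hyI : y ∈ Icc a c := by
            by_contra hyI
            exact hne (h0 y hyI)
          have hz := notMem_tsupport_iff_eventuallyEq.1 hsup
          have hcn : ∀ᶠ z in 𝓝 y, cutoff n z ≠ 0 := by
            refine ((hasDerivAt_cutoff n hy).continuousAt).eventually_ne ?_
            rw [hn y hyI]; exact one_ne_zero
          have hu0 : u =ᶠ[𝓝 y] fun _ => 0 := by
            filter_upwards [hz, hcn] with z h1 h2
            exact (mul_eq_zero.1 h1).resolve_right h2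
          have h1 := opL_green hcoef hr hfund hC hW hF hint hy
          rw [← hu, opL, hu0.deriv.deriv_eq, hu0.deriv_eq, hu0.eq_of_nhds] at h1
          simp at h1
          exact hne h1
        rw [hFy, opL_eq_zero_of_notMem_tsupport hsup, add_zero, abs_zero]
        exact mul_nonneg (by positivity) (hW0 n y hy)
  have h1 := (hlim hF (fun y _ => hBF y)).sub_const (u x)
  have h2 := hδ.const_mul (1 + U)
  rw [mul_zero] at h2
  have h3 : Tendsto (fun n => discExp (fun y => r y + W n y) P Y F - u x) atTop (𝓝 0) :=
    squeeze_zero_norm' hmain h2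
  exact sub_eq_zero.1 (tendsto_nhds_unique h1 h3)

end Resolvent

end ImpulseControl


namespace ImpulseControl

/-! ### The Green representation for general integrable payoffs. -/

variable {b σ r φ ψ F : ℝ → ℝ} {C : ℝ}

lemma PositivePaths.integrable_of_lintegral_lt_top {Ω : Type*} {mΩ : MeasurableSpace Ω}
    {P : Measure Ω} [SFinite P] {Y : ℝ≥0 → Ω → ℝ} (hY : PositivePaths mΩ Y)
    (hr : ContinuousOn r (Ioi 0)) (hF : ContinuousOn F (Ioi 0))
    (hfin : ∫⁻ ω, (∫⁻ t in Ioi (0 : ℝ),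
      ENNReal.ofReal (Real.exp (-cumRate r Y t ω) * |F (Y t.toNNReal ω)|)) ∂P < ∞) :
    Integrable (fun p : Ω × ℝ => disc r Y p.2 p.1 * F (Y p.2.toNNReal p.1))
      (P.prod (volume.restrict (Ioi 0))) := by
  have hm : Measurable fun p : Ω × ℝ => disc r Y p.2 p.1 * F (Y p.2.toNNReal p.1) :=
    (hY.measurable_disc_prod hr).mul (hY.measurable_prod hF)
  refine ⟨hm.aestronglyMeasurable, ?_⟩
  rw [HasFiniteIntegral, lintegral_prod _ hm.enorm.aemeasurable]
  refine lt_of_le_of_lt (le_of_eq ?_) hfin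
  refine lintegral_congr fun ω => lintegral_congr fun t => ?_
  rw [← ofReal_norm, norm_mul, Real.norm_of_nonneg (disc_pos _ _ _ _).le,
    Real.norm_eq_abs]
  rfl

section

variable {Ω : Type*} {mΩ : MeasurableSpace Ω} {P : Measure Ω} [IsProbabilityMeasure P]
  {𝓕 : Filtration ℝ≥0 mΩ} {Y : ℝ≥0 → Ω → ℝ} {x : ℝ}

lemma cutoff_mul_continuousOn (hF : ContinuousOn F (Ioi 0)) (n : ℕ) :
    ContinuousOn (fun y => F y * cutoff n y) (Ioi 0) :=
  hF.mul (contDiffOn_cutoff n).continuousOn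

lemma abs_mul_cutoff_le (F : ℝ → ℝ) (n : ℕ) (y : ℝ) : |F y * cutoff n y| ≤ |F y| := by
  rw [abs_mul, abs_of_nonneg (cutoff_nonneg n y)]
  exact mul_le_of_le_one_right (abs_nonneg _) (cutoff_le_one n y)

/-- The compact case applied to |F| times a cut-off bounds both Green integrals by the discounted
expectation of |F|, uniformly in n, which yields integrability. The identity for F is then the limit
of the compact case by dominated convergence on either side. -/
lemma IsDiffusion.green_of_integrable (hY : IsDiffusion b σ 𝓕 P x Y) (hx : 0 < x)
    (hcoef : RegularCoefficients b σ) (hr : DiscountRate r)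
    (hfund : FundamentalSolutions b σ r φ ψ) (hC : 0 < C)
    (hW : ∀ x, 0 < x → φ x * flux b σ ψ x - ψ x * flux b σ φ x = C)
    (hF : ContinuousOn F (Ioi 0))
    (hint : Integrable (fun p : Ω × ℝ => disc r Y p.2 p.1 * F (Y p.2.toNNReal p.1))
      (P.prod (volume.restrict (Ioi 0)))) :
    IntegrableOn (fun y => ψ y * F y * speedDensity b σ y) (Ioc 0 x) ∧
    IntegrableOn (fun y => φ y * F y * speedDensity b σ y) (Ioi x) ∧
    discExp r P Y F = green b σ φ ψ C F x := by
  have hP := hY.positivePaths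
  have hcoff : ∀ (G : ℝ → ℝ) (n : ℕ) (y : ℝ), y ∉ Icc (Real.exp (-(2 * ((n : ℝ) + 1))))
      (Real.exp (2 * (n + 1))) → G y * cutoff n y = 0 := fun G n y hy => by
    rw [cutoff_eq_zero hy, mul_zero]
  have hle : ∀ n : ℕ, Real.exp (-(2 * ((n : ℝ) + 1))) ≤ Real.exp (2 * (n + 1)) := fun n =>
    Real.exp_le_exp.2 (by linarith [Nat.cast_nonneg (α := ℝ) n])
  have hrep : ∀ {G : ℝ → ℝ}, ContinuousOn G (Ioi 0) → ∀ n : ℕ,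
      discExp r P Y (fun y => G y * cutoff n y) = green b σ φ ψ C (fun y => G y * cutoff n y) x :=
    fun hG n => hY.discExp_eq_green_of_compact hx hcoef hr hfund hC hW
      (cutoff_mul_continuousOn hG n) (Real.exp_pos _) (hle n) (hcoff _ n)
  have hφ := hfund.phi_pos x hx
  have hψ := hfund.psi_pos x hx
  have hi : ∀ {w : ℝ → ℝ}, ContinuousOn w (Ioi 0) → ∀ n : ℕ,
      Integrable fun y => w y * (|F y| * cutoff n y) * speedDensity b σ y := fun hw n =>
    integrable_of_eq_zero_off hcoef hw (cutoff_mul_continuousOn hF.abs n) (Real.exp_pos _)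
      (hcoff _ n)
  have hnn : ∀ {w : ℝ → ℝ}, (∀ y, 0 < y → 0 < w y) → ∀ (n : ℕ) (y : ℝ), 0 < y →
      0 ≤ w y * (|F y| * cutoff n y) * speedDensity b σ y := fun hw n y hy =>
    mul_nonneg (mul_nonneg (hw y hy).le (mul_nonneg (abs_nonneg _) (cutoff_nonneg n y)))
      (speedDensity_pos hcoef hy).le
  set K := ∫ p : Ω × ℝ, ‖disc r Y p.2 p.1 * F (Y p.2.toNNReal p.1)‖
    ∂(P.prod (volume.restrict (Ioi 0)))
  have hK : ∀ n : ℕ, φ x * lowerInt b σ ψ (fun y => |F y| * cutoff n y) x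
      + ψ x * upperInt b σ φ (fun y => |F y| * cutoff n y) x ≤ K * C := by
    intro n
    rw [← div_le_iff₀ hC]
    change green b σ φ ψ C (fun y => |F y| * cutoff n y) x ≤ K
    rw [← hrep hF.abs n]
    rw [discExp]
    refine (Real.le_norm_self _).trans
      (norm_integral_le_of_norm_le hint.norm (.of_forall fun p => ?_))
    rw [norm_mul, norm_mul (disc r Y p.2 p.1) (F _)]
    refine mul_le_mul_of_nonneg_left ?_ (norm_nonneg _)
    simpa using abs_mul_cutoff_le (fun y => |F y|) n (Y p.2.toNNReal p.1)
  have hlnn : ∀ n : ℕ, 0 ≤ lowerInt b σ ψ (fun y => |F y| * cutoff n y) x := fun n =>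
    setIntegral_nonneg measurableSet_Ioc fun y hy => hnn hfund.psi_pos n y hy.1
  have hunn : ∀ n : ℕ, 0 ≤ upperInt b σ φ (fun y => |F y| * cutoff n y) x := fun n =>
    setIntegral_nonneg measurableSet_Ioi fun y (hy : x < y) => hnn hfund.phi_pos n y (hx.trans hy)
  have hlow : IntegrableOn (fun y => ψ y * F y * speedDensity b σ y) (Ioc 0 x) := by
    have hc := continuousOn_mul_speedDensity hcoef hfund.psi_smooth.continuousOn hF
    -- On ]e^{−(n+1)}, x] the n-th cut-off equals 1 as soon as |log x| ≤ n, so the truncated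
    -- integral is part of the bounded one.
    have ha : Tendsto (fun n : ℕ => Real.exp (-((n : ℝ) + 1))) atTop (𝓝 0) :=
      Real.tendsto_exp_neg_atTop_nhds_zero.comp
        (tendsto_atTop_add_const_right _ 1 tendsto_natCast_atTop_atTop)
    refine integrableOn_Ioc_of_intervalIntegral_norm_bounded_left (I := K * C / φ x)
      (fun n => ?_) ha ?_
    · exact ((hc.mono fun y (hy : y ∈ Icc _ _) =>
        (Real.exp_pos _).trans_le hy.1).integrableOn_Icc).mono_set Ioc_subset_Icc_self
    · have hev : ∀ᶠ n : ℕ in atTop, |Real.log x| ≤ n := by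
        obtain ⟨N, hN⟩ := exists_nat_ge |Real.log x|
        filter_upwards [eventually_ge_atTop N] with n hn
        exact hN.trans (Nat.cast_le.2 hn)
      filter_upwards [hev] with n hn
      have hnl := abs_le.1 hn
      have hax : Real.exp (-((n : ℝ) + 1)) ≤ x := by
        rw [← Real.le_log_iff_exp_le hx]; linarith
      rw [le_div_iff₀ hφ, mul_comm]
      refine le_trans (mul_le_mul_of_nonneg_left ?_ hφ.le)
        (le_trans (le_add_of_nonneg_right (mul_nonneg hψ.le (hunn n))) (hK n))
      calc _ = ∫ y in Ioc (Real.exp (-((n : ℝ) + 1))) x,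
            ψ y * (|F y| * cutoff n y) * speedDensity b σ y := by
            refine setIntegral_congr_fun measurableSet_Ioc fun y hy => ?_
            have hy0 : 0 < y := (Real.exp_pos _).trans hy.1
            have h1 : cutoff n y = 1 := by
              refine cutoff_eq_one hy0 (abs_le.2 ⟨?_, ?_⟩)
              · exact (Real.le_log_iff_exp_le hy0).2 hy.1.le
              · linarith [Real.log_le_log hy0 hy.2]
            simp only [h1, mul_one, norm_mul, Real.norm_eq_abs, abs_of_pos (hfund.psi_pos y hy0),
              abs_of_pos (speedDensity_pos hcoef hy0)]
        _ ≤ _ := setIntegral_mono_set (hi hfund.psi_smooth.continuousOn n).integrableOn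
            ((ae_restrict_mem measurableSet_Ioc).mono fun y hy => hnn hfund.psi_pos n y hy.1)
            (Ioc_subset_Ioc_left (Real.exp_pos _).le).eventuallyLE
  have hupp : IntegrableOn (fun y => φ y * F y * speedDensity b σ y) (Ioi x) := by
    have hc := continuousOn_mul_speedDensity hcoef hfund.phi_smooth.continuousOn hF
    have ha : Tendsto (fun n : ℕ => Real.exp ((n : ℝ) + 1)) atTop atTop :=
      Real.tendsto_exp_atTop.comp
        (tendsto_atTop_add_const_right _ 1 tendsto_natCast_atTop_atTop)
    refine integrableOn_Ioi_of_intervalIntegral_norm_bounded (K * C / ψ x) x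
      (fun n => ?_) ha ?_
    · exact ((hc.mono fun y (hy : y ∈ Icc _ _) =>
        hx.trans_le hy.1).integrableOn_Icc).mono_set Ioc_subset_Icc_self
    · have hev : ∀ᶠ n : ℕ in atTop, |Real.log x| ≤ n := by
        obtain ⟨N, hN⟩ := exists_nat_ge |Real.log x|
        filter_upwards [eventually_ge_atTop N] with n hn
        exact hN.trans (Nat.cast_le.2 hn)
      filter_upwards [hev] with n hn
      have hnl := abs_le.1 hn
      have hax : x ≤ Real.exp ((n : ℝ) + 1) := by
        rw [← Real.log_le_iff_le_exp hx]; linarith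
      rw [le_div_iff₀ hψ, mul_comm]
      refine le_trans (mul_le_mul_of_nonneg_left ?_ hψ.le)
        (le_trans (le_add_of_nonneg_left (mul_nonneg hφ.le (hlnn n))) (hK n))
      rw [intervalIntegral.integral_of_le hax]
      calc _ = ∫ y in Ioc x (Real.exp ((n : ℝ) + 1)),
            φ y * (|F y| * cutoff n y) * speedDensity b σ y := by
            refine setIntegral_congr_fun measurableSet_Ioc fun y hy => ?_
            have hy0 : 0 < y := hx.trans hy.1
            have h1 : cutoff n y = 1 := by
              refine cutoff_eq_one hy0 (abs_le.2 ⟨?_, ?_⟩)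
              · linarith [Real.log_le_log hx hy.1.le]
              · exact (Real.log_le_iff_le_exp hy0).2 hy.2
            simp only [h1, mul_one, norm_mul, Real.norm_eq_abs, abs_of_pos (hfund.phi_pos y hy0),
              abs_of_pos (speedDensity_pos hcoef hy0)]
        _ ≤ _ := setIntegral_mono_set (hi hfund.phi_smooth.continuousOn n).integrableOn
            ((ae_restrict_mem measurableSet_Ioi).mono fun y (hy : x < y) =>
              hnn hfund.phi_pos n y (hx.trans hy))
            Ioc_subset_Ioi_self.eventuallyLE
  refine ⟨hlow, hupp, ?_⟩
  have hlimE : Tendsto (fun n => discExp r P Y (fun y => F y * cutoff n y)) atTop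
      (𝓝 (discExp r P Y F)) := by
    refine tendsto_integral_of_dominated_convergence
      (fun p : Ω × ℝ => ‖disc r Y p.2 p.1 * F (Y p.2.toNNReal p.1)‖) (fun n => ?_) hint.norm
      (fun n => .of_forall fun p => ?_) (.of_forall fun p => ?_)
    · exact ((hP.measurable_disc_prod hr.continuousOn_Ioi).mul
        (hP.measurable_prod (cutoff_mul_continuousOn hF n))).aestronglyMeasurable
    · rw [norm_mul, norm_mul (disc r Y p.2 p.1) (F _)]
      exact mul_le_mul_of_nonneg_left (abs_mul_cutoff_le F n _) (norm_nonneg _)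
    · refine tendsto_const_nhds.congr' ?_
      filter_upwards [eventually_cutoff_eq_one (hP.pos p.1 p.2.toNNReal)] with n hn
      rw [hn, mul_one]
  have hlimG : ∀ {w : ℝ → ℝ} {s : Set ℝ}, ContinuousOn w (Ioi 0) → s ⊆ Ioi 0 → MeasurableSet s →
      IntegrableOn (fun y => w y * F y * speedDensity b σ y) s →
      Tendsto (fun n : ℕ => ∫ y in s, w y * (F y * cutoff n y) * speedDensity b σ y) atTop
        (𝓝 (∫ y in s, w y * F y * speedDensity b σ y)) := by
    intro w s hw hs hsm hws
    refine tendsto_integral_of_dominated_convergence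
      (fun y => ‖w y * F y * speedDensity b σ y‖) (fun n => ?_) hws.norm
      (fun n => .of_forall fun y => ?_) ((ae_restrict_mem hsm).mono fun y hy => ?_)
    · exact ((continuousOn_mul_speedDensity hcoef hw (cutoff_mul_continuousOn hF n)).mono
        hs).aestronglyMeasurable hsm
    · rw [norm_mul, norm_mul, norm_mul (w y * F y), norm_mul (w y)]
      gcongr
      exact abs_mul_cutoff_le F n y
    · refine tendsto_const_nhds.congr' ?_
      filter_upwards [eventually_cutoff_eq_one (hs hy)] with n hn
      rw [hn, mul_one]
  have h1 := ((hlimG hfund.psi_smooth.continuousOn Ioc_subset_Ioi_self measurableSet_Ioc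
    hlow).const_mul (φ x)).add ((hlimG hfund.phi_smooth.continuousOn (Ioi_subset_Ioi hx.le)
      measurableSet_Ioi hupp).const_mul (ψ x)) |>.div_const C
  refine tendsto_nhds_unique hlimE (h1.congr fun n => ?_)
  exact (hrep hF n).symm

end

/-- The lower integral is additive as soon as one summand is measurable, so regularity is asked of
`F` alone. -/
lemma DiscountedIntegrable.add {Ω : Type*} {mΩ : MeasurableSpace Ω} {P : Measure Ω}
    {𝓕 : Filtration ℝ≥0 mΩ} {X : ℝ → ℝ≥0 → Ω → ℝ} {F G : ℝ → ℝ}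
    (hX : ∀ x, 0 < x → IsDiffusion b σ 𝓕 P x (X x))
    (hr : DiscountRate r) (hFc : ContinuousOn F (Ioi 0))
    (hF : DiscountedIntegrable r P X F)
    (hG : DiscountedIntegrable r P X G) : DiscountedIntegrable r P X (fun y => F y + G y) := by
  intro x hx
  have hP := (hX x hx).positivePaths
  have hm : Measurable fun p : Ω × ℝ =>
      ENNReal.ofReal (Real.exp (-cumRate r (X x) p.2 p.1) * |F (X x p.2.toNNReal p.1)|) :=
    ((hP.measurable_disc_prod hr.continuousOn_Ioi).mul (hP.measurable_prod hFc.abs)).ennreal_ofReal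
  have hmω : ∀ ω, Measurable fun t =>
      ENNReal.ofReal (Real.exp (-cumRate r (X x) t ω) * |F (X x t.toNNReal ω)|) := fun ω =>
    ((hP.continuous_disc hr.continuousOn_Ioi ω).mul
      (hP.continuous_comp hFc.abs ω)).measurable.ennreal_ofReal
  have hpt : ∀ ω t, ENNReal.ofReal (Real.exp (-cumRate r (X x) t ω)
        * |F (X x t.toNNReal ω) + G (X x t.toNNReal ω)|)
      ≤ ENNReal.ofReal (Real.exp (-cumRate r (X x) t ω) * |F (X x t.toNNReal ω)|)
        + ENNReal.ofReal (Real.exp (-cumRate r (X x) t ω) * |G (X x t.toNNReal ω)|) := by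
    intro ω t
    rw [← ENNReal.ofReal_add (mul_nonneg (Real.exp_pos _).le (abs_nonneg _))
      (mul_nonneg (Real.exp_pos _).le (abs_nonneg _)), ← mul_add]
    exact ENNReal.ofReal_le_ofReal (mul_le_mul_of_nonneg_left (abs_add_le _ _) (Real.exp_pos _).le)
  have hin : ∀ ω, ∫⁻ t in Ioi (0 : ℝ), ENNReal.ofReal (Real.exp (-cumRate r (X x) t ω)
        * |F (X x t.toNNReal ω) + G (X x t.toNNReal ω)|)
      ≤ (∫⁻ t in Ioi (0 : ℝ),
          ENNReal.ofReal (Real.exp (-cumRate r (X x) t ω) * |F (X x t.toNNReal ω)|))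
        + ∫⁻ t in Ioi (0 : ℝ),
          ENNReal.ofReal (Real.exp (-cumRate r (X x) t ω) * |G (X x t.toNNReal ω)|) := fun ω =>
    (lintegral_mono (hpt ω)).trans (lintegral_add_left (hmω ω) _).le
  refine lt_of_le_of_lt (lintegral_mono hin) ?_
  rw [lintegral_add_left hm.lintegral_prod_right']
  exact ENNReal.add_lt_top.2 ⟨hF x hx, hG x hx⟩

section Family

variable {Ω : Type*} {mΩ : MeasurableSpace Ω} {P : Measure Ω} [IsProbabilityMeasure P]
  {𝓕 : Filtration ℝ≥0 mΩ} {X : ℝ → ℝ≥0 → Ω → ℝ}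

/-- The resolvent of the diffusion is given by the Green kernel. -/
lemma RF_eq_green (hX : ∀ x, 0 < x → IsDiffusion b σ 𝓕 P x (X x))
    (hcoef : RegularCoefficients b σ) (hr : DiscountRate r)
    (hfund : FundamentalSolutions b σ r φ ψ) (hC : 0 < C)
    (hW : ∀ x, 0 < x → φ x * flux b σ ψ x - ψ x * flux b σ φ x = C)
    (hF : ContinuousOn F (Ioi 0)) (hint : DiscountedIntegrable r P X F) :
    GreenIntegrable b σ φ ψ F ∧ ∀ x, 0 < x → RF r P X F x = green b σ φ ψ C F x := by
  have hi : ∀ x : ℝ, 0 < x → _ := fun x hx =>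
    (hX x hx).positivePaths.integrable_of_lintegral_lt_top hr.continuousOn_Ioi hF (hint x hx)
  have h : ∀ x : ℝ, 0 < x → _ := fun x hx =>
    (hX x hx).green_of_integrable hx hcoef hr hfund hC hW hF (hi x hx)
  refine ⟨⟨fun x hx => (h x hx).1, fun x hx => (h x hx).2.1⟩, fun x hx => ?_⟩
  rw [← (h x hx).2.2, discExp, integral_prod _ (hi x hx)]
  rfl

lemma green_add {F G : ℝ → ℝ} (hF : GreenIntegrable b σ φ ψ F) (hG : GreenIntegrable b σ φ ψ G)
    {x : ℝ} (hx : 0 < x) : green b σ φ ψ C (fun y => F y + G y) x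
      = green b σ φ ψ C F x + green b σ φ ψ C G x := by
  have h1 : lowerInt b σ ψ (fun y => F y + G y) x = lowerInt b σ ψ F x + lowerInt b σ ψ G x := by
    simp only [lowerInt, mul_add, add_mul]
    exact integral_add (hF.lower x hx) (hG.lower x hx)
  have h2 : upperInt b σ φ (fun y => F y + G y) x = upperInt b σ φ F x + upperInt b σ φ G x := by
    simp only [upperInt, mul_add, add_mul]
    exact integral_add (hF.upper x hx) (hG.upper x hx)
  rw [green, green, green, h1, h2]
  ring

end Family

end ImpulseControl


namespace ImpulseControl

/-! ### Analysis of the free-boundary function -/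

lemma monotoneOn_of_hasDerivAt_nonneg {f f' : ℝ → ℝ} {s : Set ℝ} (hs : Convex ℝ s)
    (hf : ∀ x ∈ s, HasDerivAt f (f' x) x) (h : ∀ x ∈ interior s, 0 ≤ f' x) : MonotoneOn f s :=
  monotoneOn_of_deriv_nonneg hs (fun x hx => (hf x hx).continuousAt.continuousWithinAt)
    (fun x hx => (hf x (interior_subset hx)).differentiableAt.differentiableWithinAt)
    fun x hx => by rw [(hf x (interior_subset hx)).deriv]; exact h x hx

lemma antitoneOn_of_hasDerivAt_nonpos {f f' : ℝ → ℝ} {s : Set ℝ} (hs : Convex ℝ s)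
    (hf : ∀ x ∈ s, HasDerivAt f (f' x) x) (h : ∀ x ∈ interior s, f' x ≤ 0) : AntitoneOn f s :=
  antitoneOn_of_deriv_nonpos hs (fun x hx => (hf x hx).continuousAt.continuousWithinAt)
    (fun x hx => (hf x (interior_subset hx)).differentiableAt.differentiableWithinAt)
    fun x hx => by rw [(hf x (interior_subset hx)).deriv]; exact h x hx

lemma strictMonoOn_of_hasDerivAt_pos {f f' : ℝ → ℝ} {s : Set ℝ} (hs : Convex ℝ s)
    (hf : ∀ x ∈ s, HasDerivAt f (f' x) x) (h : ∀ x ∈ interior s, 0 < f' x) : StrictMonoOn f s :=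
  strictMonoOn_of_deriv_pos hs (fun x hx => (hf x hx).continuousAt.continuousWithinAt)
    fun x hx => by rw [(hf x (interior_subset hx)).deriv]; exact h x hx

lemma strictAntiOn_of_hasDerivAt_neg {f f' : ℝ → ℝ} {s : Set ℝ} (hs : Convex ℝ s)
    (hf : ∀ x ∈ s, HasDerivAt f (f' x) x) (h : ∀ x ∈ interior s, f' x < 0) : StrictAntiOn f s :=
  strictAntiOn_of_deriv_neg hs (fun x hx => (hf x hx).continuousAt.continuousWithinAt)
    fun x hx => by rw [(hf x (interior_subset hx)).deriv]; exact h x hx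

lemma sInf_image_coe_Ioi (a : ℝ) : sInf ((fun s : ℝ => (s : EReal)) '' Ioi a) = a := by
  have h := Monotone.map_csInf_of_continuousAt (f := fun s : ℝ => (s : EReal)) (A := Ioi a)
    continuous_coe_real_ereal.continuousAt EReal.coe_strictMono.monotone nonempty_Ioi bddBelow_Ioi
  rw [← h, csInf_Ioi]

/-- The relations between the functions `ψ`, `R = R_Θ`, `q = R' / ψ'` and `θ = Θ / r`, where
`Ψ = ψ' / p'` and `A = ∫_0^· Θ ψ dm`. -/
structure FreeBoundaryData (ψ R q A Ψ θ g κ : ℝ → ℝ) (ξ ψ₀ : ℝ) : Prop where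
  psi_deriv : ∀ x, 0 < x → HasDerivAt ψ (deriv ψ x) x
  psi_incr : ∀ x, 0 < x → 0 < deriv ψ x
  psi_deriv_cont : ContinuousOn (deriv ψ) (Ioi 0)
  psi_infty : Tendsto ψ atTop atTop
  psi_zero : Tendsto ψ (𝓝[>] 0) (𝓝 ψ₀)
  psi_zero_nonneg : 0 ≤ ψ₀
  psi_zero_lt : ∀ x, 0 < x → ψ₀ < ψ x
  R_deriv : ∀ x, 0 < x → HasDerivAt R (q x * deriv ψ x) x
  R_growth : Tendsto (fun x => R x / ψ x) atTop (𝓝 0)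
  flux_deriv : ∀ x, 0 < x → HasDerivAt Ψ (g x) x
  flux_pos : ∀ x, 0 < x → 0 < Ψ x
  flux_zero : Tendsto Ψ (𝓝[>] 0) (𝓝 0)
  flux_infty : Tendsto Ψ atTop atTop
  g_pos : ∀ x, 0 < x → 0 < g x
  A_deriv : ∀ x, 0 < x → HasDerivAt A (θ x * g x) x
  A_zero : Tendsto A (𝓝[>] 0) (𝓝 0)
  q_deriv : ∀ x, 0 < x → HasDerivAt q (κ x * (A x - θ x * Ψ x)) x
  κ_pos : ∀ x, 0 < x → 0 < κ x
  relation : ∀ x, 0 < x → q x * ψ x - R x = -(A x / Ψ x)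
  θ_cont : ContinuousOn θ (Ioi 0)
  ξ_pos : 0 < ξ
  θ_mono : StrictMonoOn θ (Ioo 0 ξ)
  θ_anti : StrictAntiOn θ (Ioi ξ)

namespace FreeBoundaryData

variable {ψ R q A Ψ θ g κ : ℝ → ℝ} {ξ ψ₀ : ℝ}

/-- Continuity extends the strict monotonicity to the peak ξ, which belongs to neither open interval
of the hypothesis. -/
lemma θ_mono_Ioc (D : FreeBoundaryData ψ R q A Ψ θ g κ ξ ψ₀) : StrictMonoOn θ (Ioc 0 ξ) := by
  have h : StrictMonoOn θ (closure (Ioo 0 ξ) ∩ Ioc 0 ξ) := by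
    intro x hx y hy hxy
    rcases hy.2.2.lt_or_eq with hlt | heq
    · exact D.θ_mono ⟨hx.2.1, hxy.trans hlt⟩ ⟨hy.2.1, hlt⟩ hxy
    · subst heq
      obtain ⟨z, hxz, hzy⟩ := exists_between hxy
      refine (D.θ_mono ⟨hx.2.1, hxy⟩ ⟨hx.2.1.trans hxz, hzy⟩ hxz).trans_le ?_
      have hc := (D.θ_cont y hy.2.1).continuousAt (Ioi_mem_nhds hy.2.1)
      refine ge_of_tendsto (hc.mono_left nhdsWithin_le_nhds : Tendsto θ (𝓝[<] y) _) ?_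
      filter_upwards [Ioo_mem_nhdsLT hzy] with t ht
      exact (D.θ_mono ⟨hx.2.1.trans hxz, hzy⟩ ⟨(hx.2.1.trans hxz).trans ht.1, ht.2⟩ ht.1).le
  refine h.mono fun x hx => ⟨?_, hx⟩
  rw [closure_Ioo D.ξ_pos.ne]
  exact ⟨hx.1.le, hx.2⟩

lemma θ_anti_Ici (D : FreeBoundaryData ψ R q A Ψ θ g κ ξ ψ₀) : StrictAntiOn θ (Ici ξ) := by
  intro x hx y hy hxy
  rcases (mem_Ici.1 hx).lt_or_eq with hlt | heq
  · exact D.θ_anti hlt (hlt.trans hxy) hxy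
  · subst heq
    obtain ⟨z, hxz, hzy⟩ := exists_between hxy
    refine (D.θ_anti hxz (hxz.trans hzy) hzy).trans_le ?_
    have hc := (D.θ_cont _ D.ξ_pos).continuousAt (Ioi_mem_nhds D.ξ_pos)
    refine ge_of_tendsto (hc.mono_left nhdsWithin_le_nhds : Tendsto θ (𝓝[>] ξ) _) ?_
    filter_upwards [Ioo_mem_nhdsGT hxz] with t ht
    exact (D.θ_anti ht.1 hxz ht.2).le

lemma hasDerivAt_sub_mul (D : FreeBoundaryData ψ R q A Ψ θ g κ ξ ψ₀) (t : ℝ) {x : ℝ} (hx : 0 < x) :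
    HasDerivAt (fun y => A y - t * Ψ y) ((θ x - t) * g x) x :=
  ((D.A_deriv x hx).sub ((D.flux_deriv x hx).const_mul t)).congr_deriv (by ring)

/-- For a frozen level t the function A − tΨ has derivative (θ − t)g and limit 0 at 0. With t = θ(x)
it decreases up to x. -/
lemma Q_neg (D : FreeBoundaryData ψ R q A Ψ θ g κ ξ ψ₀) {x : ℝ} (hx : x ∈ Ioc 0 ξ) :
    A x - θ x * Ψ x < 0 := by
  have hanti : StrictAntiOn (fun y => A y - θ x * Ψ y) (Ioc 0 x) :=
    strictAntiOn_of_hasDerivAt_neg (convex_Ioc 0 x)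
      (fun y hy => D.hasDerivAt_sub_mul (θ x) hy.1) fun y hy => by
        rw [interior_Ioc] at hy
        exact mul_neg_of_neg_of_pos
          (sub_neg.2 (D.θ_mono_Ioc ⟨hy.1, hy.2.le.trans hx.2⟩ hx hy.2)) (D.g_pos y hy.1)
  have hx2 : x / 2 ∈ Ioc 0 x := ⟨half_pos hx.1, half_le_self hx.1.le⟩
  have hlim : Tendsto (fun y => A y - θ x * Ψ y) (𝓝[>] 0) (𝓝 0) := by
    simpa using D.A_zero.sub (D.flux_zero.const_mul (θ x))
  have h1 : A (x / 2) - θ x * Ψ (x / 2) ≤ 0 := by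
    refine ge_of_tendsto hlim ?_
    filter_upwards [Ioo_mem_nhdsGT hx2.1] with y hy
    exact (hanti ⟨hy.1, hy.2.le.trans hx2.2⟩ hx2 hy.2).le
  exact (hanti hx2 ⟨hx.1, le_rfl⟩ (half_lt_self hx.1)).trans_le h1

/-- Freezing the level at θ(y) makes A − θ(y)Ψ increase on [x, y], and replacing θ(x) by the smaller
θ(y) at x increases the value further. No derivative of θ is needed. -/
lemma Q_strictMono (D : FreeBoundaryData ψ R q A Ψ θ g κ ξ ψ₀) :
    StrictMonoOn (fun x => A x - θ x * Ψ x) (Ici ξ) := by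
  intro x hx y hy hxy
  have hx0 : 0 < x := D.ξ_pos.trans_le hx
  have hmono : StrictMonoOn (fun z => A z - θ y * Ψ z) (Icc x y) :=
    strictMonoOn_of_hasDerivAt_pos (convex_Icc x y)
      (fun z hz => D.hasDerivAt_sub_mul (θ y) (hx0.trans_le hz.1)) fun z hz => by
        rw [interior_Icc] at hz
        exact mul_pos (sub_pos.2 (D.θ_anti_Ici ((mem_Ici.1 hx).trans hz.1.le) hy hz.2))
          (D.g_pos z (hx0.trans hz.1))
  have h1 := hmono (left_mem_Icc.2 hxy.le) (right_mem_Icc.2 hxy.le) hxy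
  have h2 := mul_lt_mul_of_pos_right (D.θ_anti_Ici hx hy hxy) (D.flux_pos x hx0)
  dsimp only at h1 ⊢
  linarith

lemma deriv_q (D : FreeBoundaryData ψ R q A Ψ θ g κ ξ ψ₀) {x : ℝ} (hx : 0 < x) :
    deriv q x = κ x * (A x - θ x * Ψ x) := (D.q_deriv x hx).deriv

lemma continuousOn_q (D : FreeBoundaryData ψ R q A Ψ θ g κ ξ ψ₀) : ContinuousOn q (Ioi 0) :=
  fun x hx => (D.q_deriv x hx).continuousAt.continuousWithinAt

/-- `x̲` is the unique sign change point of `q'`. -/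
lemma exists_xLower (D : FreeBoundaryData ψ R q A Ψ θ g κ ξ ψ₀) (hxl : xLower q < ⊤) :
    ∃ xl : ℝ, xLower q = xl ∧ ξ < xl ∧ (∀ x, 0 < x → x < xl → deriv q x < 0) ∧
      ∀ x, xl < x → 0 < deriv q x := by
  obtain ⟨s, hs0, hs⟩ : ∃ s, 0 < s ∧ 0 < deriv q s := by
    by_contra! hno
    refine hxl.ne ?_
    have : {s | 0 < s ∧ 0 < deriv q s} = ∅ := by
      ext s
      simpa using hno s
    rw [xLower, this, image_empty, sInf_empty]
  have hQ : ∀ x, 0 < x → (0 < deriv q x ↔ 0 < A x - θ x * Ψ x) := fun x hx => by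
    rw [D.deriv_q hx, mul_pos_iff_of_pos_left (D.κ_pos x hx)]
  have hQ' : ∀ x, 0 < x → (deriv q x < 0 ↔ A x - θ x * Ψ x < 0) := fun x hx => by
    rw [D.deriv_q hx]
    refine ⟨fun h => ?_, mul_neg_of_pos_of_neg (D.κ_pos x hx)⟩
    by_contra! hc
    exact absurd h (not_lt.2 (mul_nonneg (D.κ_pos x hx).le hc))
  have hQs := (hQ s hs0).1 hs
  have hξ := D.Q_neg ⟨D.ξ_pos, le_rfl⟩
  have hsξ : ξ < s := by
    by_contra! hle
    exact absurd (D.Q_neg ⟨hs0, hle⟩) (not_lt.2 hQs.le)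
  have hcont : ContinuousOn (fun x => A x - θ x * Ψ x) (Icc ξ s) := by
    have hsub : Icc ξ s ⊆ Ioi 0 := fun y hy => D.ξ_pos.trans_le hy.1
    refine ContinuousOn.mono ?_ hsub
    exact ContinuousOn.sub (fun x hx => (D.A_deriv x hx).continuousAt.continuousWithinAt)
      (D.θ_cont.mul fun x hx => (D.flux_deriv x hx).continuousAt.continuousWithinAt)
  -- A − θΨ is negative on ]0, ξ] and strictly increasing beyond ξ, so this zero is the only one.
  obtain ⟨xl, hxlmem, hxl0⟩ := intermediate_value_Ioo hsξ.le hcont ⟨hξ, hQs⟩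
  have hneg : ∀ x, 0 < x → x < xl → deriv q x < 0 := fun x hx hlt => by
    rw [hQ' x hx]
    rcases le_or_gt x ξ with h | h
    · exact D.Q_neg ⟨hx, h⟩
    · exact (D.Q_strictMono h.le hxlmem.1.le hlt).trans_eq hxl0
  have hpos : ∀ x, xl < x → 0 < deriv q x := fun x hlt => by
    rw [hQ x ((D.ξ_pos.trans hxlmem.1).trans hlt)]
    exact hxl0.symm.trans_lt (D.Q_strictMono hxlmem.1.le (hxlmem.1.trans hlt).le hlt)
  refine ⟨xl, ?_, hxlmem.1, hneg, hpos⟩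
  have hset : {s | 0 < s ∧ 0 < deriv q s} = Ioi xl := by
    ext x
    refine ⟨fun hx => ?_, fun hx => ⟨(D.ξ_pos.trans hxlmem.1).trans hx, hpos x hx⟩⟩
    by_contra! hle
    rcases (not_lt.1 (by simpa using hle)).lt_or_eq with h | h
    · exact absurd (hneg x hx.1 h) (not_lt.2 hx.2.le)
    · have := (hQ x hx.1).1 hx.2
      rw [h] at this
      exact absurd hxl0 this.ne'
  rw [xLower, hset, sInf_image_coe_Ioi]

/-! ### The critical points and the monotone branches of q. -/

section Critical

variable {xl : ℝ}

lemma q_strictAnti (D : FreeBoundaryData ψ R q A Ψ θ g κ ξ ψ₀)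
    (hneg : ∀ x, 0 < x → x < xl → deriv q x < 0) : StrictAntiOn q (Ioc 0 xl) :=
  strictAntiOn_of_deriv_neg (convex_Ioc 0 xl) (D.continuousOn_q.mono Ioc_subset_Ioi_self)
    fun x hx => by rw [interior_Ioc] at hx; exact hneg x hx.1 hx.2

lemma q_strictMono (D : FreeBoundaryData ψ R q A Ψ θ g κ ξ ψ₀) (hxl : 0 < xl)
    (hpos : ∀ x, xl < x → 0 < deriv q x) : StrictMonoOn q (Ici xl) :=
  strictMonoOn_of_deriv_pos (convex_Ici xl) (D.continuousOn_q.mono (Ici_subset_Ioi.2 hxl))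
    fun x hx => by rw [interior_Ici] at hx; exact hpos x hx

/-- `x̄` is the unique point of `]x̲, ∞[` where `q` attains the value `lim_{x ↓ 0} q(x)`. -/
lemma exists_xUpper (D : FreeBoundaryData ψ R q A Ψ θ g κ ξ ψ₀) (hxl : 0 < xl)
    (hneg : ∀ x, 0 < x → x < xl → deriv q x < 0) (hpos : ∀ x, xl < x → 0 < deriv q x)
    (hxu : xUpper q < ⊤) :
    ∃ xu : ℝ, xUpper q = xu ∧ xl < xu ∧ Tendsto q (𝓝[>] 0) (𝓝 (q xu)) ∧
      ∀ s ∈ Ioc 0 xl, q s < q xu := by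
  have hanti := D.q_strictAnti hneg
  have hmono := D.q_strictMono hxl hpos
  -- The limit at 0 is taken in the extended reals because q, which decreases near 0, could explode
  -- there. Finiteness of x̄ supplies a point where q exceeds the limit, so the limit is real.
  have hantiE : AntitoneOn (fun x => (q x : EReal)) (Ioo 0 xl) := fun x hx y hy hxy =>
    EReal.coe_le_coe_iff.2 (hanti.antitoneOn ⟨hx.1, hx.2.le⟩ ⟨hy.1, hy.2.le⟩ hxy)
  have hlim := hantiE.tendsto_nhdsWithin_Ioo_right (nonempty_Ioo.2 hxl) (OrderTop.bddAbove _)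
  set L := sSup ((fun x => (q x : EReal)) '' Ioo 0 xl) with hL
  have hlimU : limUnder (𝓝[>] (0 : ℝ)) (fun x => (q x : EReal)) = L := hlim.limUnder_eq
  have hleL : ∀ s ∈ Ioo 0 xl, (q s : EReal) ≤ L := fun s hs => le_sSup (mem_image_of_mem _ hs)
  obtain ⟨s, hs0, hs⟩ : ∃ s, 0 < s ∧ L < (q s : EReal) := by
    by_contra! hno
    refine hxu.ne ?_
    have : {s | 0 < s ∧ limUnder (𝓝[>] (0 : ℝ)) (fun x => (q x : EReal)) < (q s : EReal)} = ∅ := by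
      rw [hlimU]
      ext s
      simpa using hno s
    rw [xUpper, this, image_empty, sInf_empty]
  have hh : xl / 2 ∈ Ioo 0 xl := ⟨half_pos hxl, half_lt_self hxl⟩
  obtain ⟨l, hl⟩ : ∃ l : ℝ, L = l := by
    refine ⟨L.toReal, (EReal.coe_toReal (hs.trans (EReal.coe_lt_top _)).ne ?_).symm⟩
    exact ((EReal.bot_lt_coe _).trans_le (hleL _ hh)).ne'
  have hqlt : ∀ s ∈ Ioc 0 xl, q s < l := fun s hs => by
    have hs2 : s / 2 ∈ Ioo 0 xl := ⟨half_pos hs.1, (half_lt_self hs.1).trans_le hs.2⟩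
    have h1 := hleL _ hs2
    rw [hl, EReal.coe_le_coe_iff] at h1
    exact (hanti ⟨hs2.1, hs2.2.le⟩ hs (half_lt_self hs.1)).trans_le h1
  rw [hl, EReal.coe_lt_coe_iff] at hs
  have hsxl : xl < s := by
    by_contra! hle
    exact absurd (hqlt s ⟨hs0, hle⟩) (not_lt.2 hs.le)
  obtain ⟨xu, hxumem, hqxu⟩ := intermediate_value_Ioo hsxl.le
    (D.continuousOn_q.mono fun y hy => hxl.trans_le hy.1) ⟨hqlt xl ⟨hxl, le_rfl⟩, hs⟩
  refine ⟨xu, ?_, hxumem.1, ?_, ?_⟩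
  · have hset : {s | 0 < s ∧ limUnder (𝓝[>] (0 : ℝ)) (fun x => (q x : EReal)) < (q s : EReal)}
        = Ioi xu := by
      rw [hlimU, hl]
      ext x
      simp only [mem_ofPred_eq, EReal.coe_lt_coe_iff, mem_Ioi]
      refine ⟨fun hx => ?_, fun hx => ⟨(hxl.trans hxumem.1).trans hx, ?_⟩⟩
      · by_contra! hle
        rcases le_or_gt x xl with h | h
        · exact absurd (hqlt x ⟨hx.1, h⟩) (not_lt.2 hx.2.le)
        · have := hmono.monotoneOn h.le hxumem.1.le hle
          linarith [hx.2]
      · rw [← hqxu]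
        exact hmono hxumem.1.le (hxumem.1.trans hx).le hx
    rw [xUpper, hset, sInf_image_coe_Ioi]
  · rw [hqxu]
    rw [hl] at hlim
    exact EReal.tendsto_coe.1 hlim
  · rw [hqxu]
    exact hqlt

/-! ### The function H, the critical costs and the free boundary point. -/

variable {xu : ℝ}

lemma hasDerivAt_sub_psi (D : FreeBoundaryData ψ R q A Ψ θ g κ ξ ψ₀) (t : ℝ) {x : ℝ} (hx : 0 < x) :
    HasDerivAt (fun y => R y - t * ψ y) ((q x - t) * deriv ψ x) x :=
  ((D.R_deriv x hx).sub ((D.psi_deriv x hx).const_mul t)).congr_deriv (by ring)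

/-- As q lies between q(x̲) and l on ]0, x̲], R − q(x̲)ψ increases while R − lψ decreases. The
second fact bounds the first function from below near 0, so its monotone limit is finite. -/
lemma exists_R_zero (D : FreeBoundaryData ψ R q A Ψ θ g κ ξ ψ₀) (hxl : 0 < xl)
    (hneg : ∀ x, 0 < x → x < xl → deriv q x < 0) {l : ℝ} (hl : ∀ s ∈ Ioc 0 xl, q s < l) :
    ∃ R₀, Tendsto R (𝓝[>] 0) (𝓝 R₀) := by
  have hanti := D.q_strictAnti hneg
  have h1 : MonotoneOn (fun y => R y - q xl * ψ y) (Ioc 0 xl) :=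
    monotoneOn_of_hasDerivAt_nonneg (convex_Ioc 0 xl)
      (fun y hy => D.hasDerivAt_sub_psi (q xl) hy.1) fun y hy => by
        rw [interior_Ioc] at hy
        exact mul_nonneg (sub_nonneg.2 (hanti ⟨hy.1, hy.2.le⟩ ⟨hxl, le_rfl⟩ hy.2).le)
          (D.psi_incr y hy.1).le
  have h2 : AntitoneOn (fun y => R y - l * ψ y) (Ioc 0 xl) :=
    antitoneOn_of_hasDerivAt_nonpos (convex_Ioc 0 xl)
      (fun y hy => D.hasDerivAt_sub_psi l hy.1) fun y hy => by
        rw [interior_Ioc] at hy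
        exact mul_nonpos_of_nonpos_of_nonneg (sub_nonpos.2 (hl y ⟨hy.1, hy.2.le⟩).le)
          (D.psi_incr y hy.1).le
  obtain ⟨m, -, -, hm⟩ := tendsto_nhdsGT_zero_of_monotoneOn (m := R xl - l * ψ xl) hxl
    (h1.mono Ioo_subset_Ioc_self) (fun x hx => by
      have h3 := h2 ⟨hx.1, hx.2.le⟩ (right_mem_Ioc.2 hxl) hx.2.le
      have h4 := mul_nonneg (sub_nonneg.2 (hl xl (right_mem_Ioc.2 hxl)).le)
        (D.psi_zero_nonneg.trans (D.psi_zero_lt x hx.1).le)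
      dsimp only at h3
      linarith)
  refine ⟨m + q xl * ψ₀, (hm.add (D.psi_zero.const_mul (q xl))).congr fun x => by ring⟩

/-- `q` is nonpositive on `[x̲, ∞[`. -/
lemma q_nonpos (D : FreeBoundaryData ψ R q A Ψ θ g κ ξ ψ₀) (hxl : 0 < xl)
    (hpos : ∀ x, xl < x → 0 < deriv q x) {s : ℝ} (hs : xl ≤ s) : q s ≤ 0 := by
  by_contra! hq
  have hs0 : 0 < s := hxl.trans_le hs
  have hmono := D.q_strictMono hxl hpos
  -- If q(s) > 0, then q ≥ q(s) beyond s, so R − q(s)ψ increases there and R/ψ cannot tend to 0.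
  have h1 : MonotoneOn (fun y => R y - q s * ψ y) (Ici s) :=
    monotoneOn_of_hasDerivAt_nonneg (convex_Ici s)
      (fun y hy => D.hasDerivAt_sub_psi (q s) (hs0.trans_le hy)) fun y hy => by
        rw [interior_Ici] at hy
        exact mul_nonneg (sub_nonneg.2 (hmono hs (hs.trans (le_of_lt hy)) hy).le)
          (D.psi_incr y (hs0.trans hy)).le
  have h2 : Tendsto (fun y => R y / ψ y - (R s - q s * ψ s) / ψ y) atTop (𝓝 (0 - 0)) :=
    D.R_growth.sub (D.psi_infty.const_div_atTop _)
  have h3 : q s ≤ 0 - 0 := by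
    refine ge_of_tendsto h2 ?_
    filter_upwards [eventually_ge_atTop s] with y hy
    have hψ : 0 < ψ y := D.psi_zero_nonneg.trans_lt (D.psi_zero_lt y (hs0.trans_le hy))
    have := h1 (mem_Ici.2 le_rfl) hy hy
    rw [← sub_div, le_div_iff₀ hψ]
    dsimp only at this
    linarith
  linarith

/-- The condition β ≥ x̄ places q(β) above the limit of q at 0, so that q is maximal at β on ]0, β].
This gives the integrand of F(0, β) a constant sign. -/
lemma q_le (D : FreeBoundaryData ψ R q A Ψ θ g κ ξ ψ₀) (hxl : 0 < xl) (hlu : xl < xu)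
    (hpos : ∀ x, xl < x → 0 < deriv q x) (hq : ∀ s ∈ Ioc 0 xl, q s < q xu) {s β : ℝ} (hβ : xu ≤ β)
    (hs : 0 < s) (hsβ : s ≤ β) : q s ≤ q β := by
  have hmono := D.q_strictMono hxl hpos
  rcases le_or_gt s xl with h | h
  · exact (hq s ⟨hs, h⟩).le.trans (hmono.monotoneOn hlu.le (hlu.le.trans hβ) hβ)
  · exact hmono.monotoneOn h.le (hlu.le.trans hβ) hsβ

/-- The function `β ↦ -F(0, β)`. -/
def H (ψ R q : ℝ → ℝ) (ψ₀ R₀ β : ℝ) : ℝ := q β * (ψ β - ψ₀) - R β + R₀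

variable {R₀ : ℝ}

/-- The integrand has a constant sign and its primitive R − q(β)ψ has a limit at 0, which gives
integrability down to 0 and the fundamental theorem of calculus on ]0, β[. -/
lemma freeBdry_zero (D : FreeBoundaryData ψ R q A Ψ θ g κ ξ ψ₀) (hR₀ : Tendsto R (𝓝[>] 0) (𝓝 R₀))
    (hxl : 0 < xl) (hlu : xl < xu) (hpos : ∀ x, xl < x → 0 < deriv q x)
    (hq : ∀ s ∈ Ioc 0 xl, q s < q xu) {β : ℝ} (hβ : xu ≤ β) :
    freeBdry q ψ 0 β = -H ψ R q ψ₀ R₀ β := by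
  have hβ0 : 0 < β := (hxl.trans hlu).trans_le hβ
  set E : ℝ → ℝ := fun y => R y - q β * ψ y with hE
  have hEd : ∀ y, 0 < y → HasDerivAt E ((q y - q β) * deriv ψ y) y := fun y hy =>
    D.hasDerivAt_sub_psi (q β) hy
  have hE0 : Tendsto E (𝓝[>] 0) (𝓝 (R₀ - q β * ψ₀)) := hR₀.sub (D.psi_zero.const_mul _)
  have hint : IntegrableOn (fun y => -((q y - q β) * deriv ψ y)) (Ioc 0 β) := by
    refine intervalIntegral.integrableOn_deriv_of_nonneg
      -- The primitive is redefined at 0 by its limit to become continuous on [0, β].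
      (g := Function.update (fun y => -E y) 0 (-(R₀ - q β * ψ₀))) ?_ (fun y hy => ?_) fun y hy => ?_
    · intro y hy
      rcases hy.1.eq_or_lt with h | h
      · subst h
        rw [continuousWithinAt_update_same]
        refine hE0.neg.mono_left (nhdsWithin_mono _ fun y hy => ?_)
        exact lt_of_le_of_ne hy.1.1 (Ne.symm hy.2)
      · refine ((hEd y h).neg.continuousAt.congr ?_).continuousWithinAt
        filter_upwards [Ioi_mem_nhds h] with z hz
        rw [Function.update_of_ne (ne_of_gt hz)]
        rfl
    · refine (hEd y hy.1).neg.congr_of_eventuallyEq ?_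
      filter_upwards [Ioi_mem_nhds hy.1] with z hz
      rw [Function.update_of_ne (ne_of_gt hz)]
      rfl
    · have := mul_nonneg (sub_nonneg.2 (D.q_le hxl hlu hpos hq hβ hy.1 hy.2.le))
        (D.psi_incr y hy.1).le
      linarith
  have hint' : IntervalIntegrable (fun y => (q y - q β) * deriv ψ y) volume 0 β := by
    rw [intervalIntegrable_iff_integrableOn_Ioc_of_le hβ0.le]
    simpa using hint.neg
  have h := intervalIntegral.integral_eq_sub_of_hasDerivAt_of_tendsto hβ0
    (fun y hy => hEd y hy.1) hint' hE0
    ((hEd β hβ0).continuousAt.tendsto.mono_left nhdsWithin_le_nhds)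
  rw [freeBdry, h, hE, H]
  ring

lemma freeBdry_of_pos (D : FreeBoundaryData ψ R q A Ψ θ g κ ξ ψ₀) {γ β : ℝ} (hγ : 0 < γ)
    (hγβ : γ ≤ β) : freeBdry q ψ γ β = R β - q β * ψ β - (R γ - q β * ψ γ) := by
  have hsub : uIcc γ β ⊆ Ioi 0 := by
    rw [uIcc_of_le hγβ]; exact fun y hy => hγ.trans_le hy.1
  refine intervalIntegral.integral_eq_sub_of_hasDerivAt (f := fun y => R y - q β * ψ y)
    (fun y hy => D.hasDerivAt_sub_psi (q β) (hsub hy)) ?_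
  exact (((D.continuousOn_q.sub continuousOn_const).mul D.psi_deriv_cont).mono
    hsub).intervalIntegrable

/-- The term qψ' cancels against R' = qψ', so H inherits its monotonicity from q. -/
lemma hasDerivAt_H (D : FreeBoundaryData ψ R q A Ψ θ g κ ξ ψ₀) {x : ℝ} (hx : 0 < x) :
    HasDerivAt (H ψ R q ψ₀ R₀) (deriv q x * (ψ x - ψ₀)) x := by
  have hqd := (D.q_deriv x hx).differentiableAt.hasDerivAt
  refine (((hqd.mul ((D.psi_deriv x hx).sub_const ψ₀)).sub (D.R_deriv x hx)).add_const
    R₀).congr_deriv ?_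
  ring

lemma H_strictMono (D : FreeBoundaryData ψ R q A Ψ θ g κ ξ ψ₀) (hxl : 0 < xl)
    (hpos : ∀ x, xl < x → 0 < deriv q x) : StrictMonoOn (H ψ R q ψ₀ R₀) (Ici xl) :=
  strictMonoOn_of_hasDerivAt_pos (convex_Ici xl)
    (fun x hx => D.hasDerivAt_H (hxl.trans_le hx)) fun x hx => by
      rw [interior_Ici] at hx
      exact mul_pos (hpos x hx) (sub_pos.2 (D.psi_zero_lt x (hxl.trans hx)))

lemma H_pos (D : FreeBoundaryData ψ R q A Ψ θ g κ ξ ψ₀) (hR₀ : Tendsto R (𝓝[>] 0) (𝓝 R₀))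
    (hxl : 0 < xl) (hlu : xl < xu) (hpos : ∀ x, xl < x → 0 < deriv q x)
    (hq : ∀ s ∈ Ioc 0 xl, q s < q xu) : 0 < H ψ R q ψ₀ R₀ xu := by
  have hxu : 0 < xu := hxl.trans hlu
  have hmono := D.q_strictMono hxl hpos
  have hanti : StrictAntiOn (fun y => R y - q xu * ψ y) (Ioc 0 xu) :=
    strictAntiOn_of_hasDerivAt_neg (convex_Ioc 0 xu)
      (fun y hy => D.hasDerivAt_sub_psi (q xu) hy.1) fun y hy => by
        rw [interior_Ioc] at hy
        refine mul_neg_of_neg_of_pos (sub_neg.2 ?_) (D.psi_incr y hy.1)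
        rcases le_or_gt y xl with h | h
        · exact hq y ⟨hy.1, h⟩
        · exact hmono h.le hlu.le hy.2
  have h1 := hanti ⟨hxl, hlu.le⟩ ⟨hxu, le_rfl⟩ hlu
  -- Passing to the limit at 0 only preserves a weak inequality; strictness comes from the
  -- comparison of x̲ with x̄.
  have h2 : R xl - q xu * ψ xl ≤ R₀ - q xu * ψ₀ := by
    refine ge_of_tendsto (hR₀.sub (D.psi_zero.const_mul (q xu))) ?_
    filter_upwards [Ioo_mem_nhdsGT hxl] with y hy
    exact (hanti ⟨hy.1, (hy.2.trans hlu).le⟩ ⟨hxl, hlu.le⟩ hy.2).le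
  rw [H]
  dsimp only at h1
  linarith

/-- As β ↑ x̄, q(β) exceeds q(e) for every fixed e in ]0, x̲], so Γ(β) < e eventually and Γ(β) tends
to 0. The closed form of F(γ, β) then converges to −H(x̄). -/
lemma isCriticalCost (D : FreeBoundaryData ψ R q A Ψ θ g κ ξ ψ₀)
    (hR₀ : Tendsto R (𝓝[>] 0) (𝓝 R₀)) (hxl : 0 < xl) (hlu : xl < xu)
    (hneg : ∀ x, 0 < x → x < xl → deriv q x < 0) (hpos : ∀ x, xl < x → 0 < deriv q x)
    (hq0 : Tendsto q (𝓝[>] 0) (𝓝 (q xu))) (hq : ∀ s ∈ Ioc 0 xl, q s < q xu) :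
    IsCriticalCost q ψ xl xu (H ψ R q ψ₀ R₀ xu) := by
  have hanti := D.q_strictAnti hneg
  have hmono := D.q_strictMono hxl hpos
  have hxu : 0 < xu := hxl.trans hlu
  have hex : ∀ β ∈ Ioo xl xu, ∃ γ ∈ Ioo 0 xl, q γ = q β := by
    intro β hβ
    have h1 : q β < q xu := hmono hβ.1.le hlu.le hβ.2
    have h2 : q xl < q β := hmono (mem_Ici.2 le_rfl) hβ.1.le hβ.1
    obtain ⟨s, hs1, hs2⟩ := ((hq0.eventually (lt_mem_nhds h1)).and (Ioo_mem_nhdsGT hxl)).exists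
    obtain ⟨γ, hγ, hγq⟩ := intermediate_value_Ioo' hs2.2.le
      (D.continuousOn_q.mono fun y (hy : y ∈ Icc s xl) => hs2.1.trans_le hy.1) ⟨h2, hs1⟩
    exact ⟨γ, ⟨hs2.1.trans hγ.1, hγ.2⟩, hγq⟩
  choose! Γ hΓ hΓq using hex
  refine ⟨Γ, fun β hβ => ⟨hΓ β hβ, fun γ hγ => ⟨fun h => ?_, fun h => h ▸ hΓq β hβ⟩⟩, ?_⟩
  · exact hanti.injOn ⟨hγ.1, hγ.2.le⟩ ⟨(hΓ β hβ).1, (hΓ β hβ).2.le⟩ (h.trans (hΓq β hβ).symm)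
  · have hmem : ∀ᶠ β in 𝓝[<] xu, β ∈ Ioo xl xu := Ioo_mem_nhdsLT hlu
    have hqc : Tendsto q (𝓝[<] xu) (𝓝 (q xu)) :=
      (D.q_deriv xu hxu).continuousAt.tendsto.mono_left nhdsWithin_le_nhds
    have hΓ0 : Tendsto Γ (𝓝[<] xu) (𝓝[>] 0) := by
      refine tendsto_nhdsWithin_iff.2 ⟨?_, hmem.mono fun β hβ => (hΓ β hβ).1⟩
      refine tendsto_order.2 ⟨fun a ha => hmem.mono fun β hβ => ha.trans (hΓ β hβ).1,
        fun a ha => ?_⟩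
      have he : min a xl ∈ Ioc 0 xl := ⟨lt_min ha hxl, min_le_right _ _⟩
      filter_upwards [hmem, hqc.eventually (lt_mem_nhds (hq _ he))] with β hβ hβq
      by_contra! hcon
      have := hanti.antitoneOn he ⟨(hΓ β hβ).1, (hΓ β hβ).2.le⟩ ((min_le_left _ _).trans hcon)
      rw [hΓq β hβ] at this
      linarith
    have hψc : Tendsto ψ (𝓝[<] xu) (𝓝 (ψ xu)) :=
      (D.psi_deriv xu hxu).continuousAt.tendsto.mono_left nhdsWithin_le_nhds
    have hRc : Tendsto R (𝓝[<] xu) (𝓝 (R xu)) :=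
      (D.R_deriv xu hxu).continuousAt.tendsto.mono_left nhdsWithin_le_nhds
    have h := (((hRc.sub (hqc.mul hψc)).sub ((hR₀.comp hΓ0).sub
      (hqc.mul (D.psi_zero.comp hΓ0))))).neg
    rw [show H ψ R q ψ₀ R₀ xu = -(R xu - q xu * ψ xu - (R₀ - q xu * ψ₀)) by rw [H]; ring]
    refine h.congr' ?_
    filter_upwards [hmem] with β hβ
    rw [D.freeBdry_of_pos (hΓ β hβ).1 ((hΓ β hβ).2.trans hβ.1).le]
    rfl

/-- The critical cost `c°`. -/
noncomputable def ccirc (ψ R q : ℝ → ℝ) (ψ₀ R₀ xu : ℝ) : EReal :=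
  sSup ((fun β => (H ψ R q ψ₀ R₀ β : EReal)) '' Ici xu)

lemma H_lt_ccirc (D : FreeBoundaryData ψ R q A Ψ θ g κ ξ ψ₀) (hxl : 0 < xl) (hlu : xl < xu)
    (hpos : ∀ x, xl < x → 0 < deriv q x) {β : ℝ} (hβ : xu ≤ β) :
    (H ψ R q ψ₀ R₀ β : EReal) < ccirc ψ R q ψ₀ R₀ xu := by
  -- The supremum is not attained: H is larger at β + 1.
  have h := D.H_strictMono (R₀ := R₀) hxl hpos (hlu.le.trans hβ : xl ≤ β)
    ((hlu.le.trans hβ).trans (le_add_of_nonneg_right zero_le_one)) (lt_add_one β)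
  refine (EReal.coe_lt_coe_iff.2 h).trans_le (le_sSup ⟨β + 1, ?_, rfl⟩)
  exact hβ.trans (le_add_of_nonneg_right zero_le_one)

/-- The free boundary point as a function of the cost. -/
lemma exists_βcirc (D : FreeBoundaryData ψ R q A Ψ θ g κ ξ ψ₀) (hxl : 0 < xl) (hlu : xl < xu)
    (hpos : ∀ x, xl < x → 0 < deriv q x) :
    ∃ βc : ℝ → ℝ, (∀ c, H ψ R q ψ₀ R₀ xu ≤ c → (c : EReal) < ccirc ψ R q ψ₀ R₀ xu →
        xu ≤ βc c ∧ H ψ R q ψ₀ R₀ (βc c) = c) ∧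
      StrictMonoOn βc {c : ℝ | H ψ R q ψ₀ R₀ xu ≤ c ∧ (c : EReal) < ccirc ψ R q ψ₀ R₀ xu} ∧
      Tendsto βc (comap (fun c : ℝ => (c : EReal)) (𝓝[<] ccirc ψ R q ψ₀ R₀ xu)) atTop := by
  have hmono := D.H_strictMono (R₀ := R₀) hxl hpos
  have hex : ∀ c, H ψ R q ψ₀ R₀ xu ≤ c ∧ (c : EReal) < ccirc ψ R q ψ₀ R₀ xu →
      ∃ β, xu ≤ β ∧ H ψ R q ψ₀ R₀ β = c := by
    rintro c ⟨h1, h2⟩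
    obtain ⟨_, ⟨s, hs, rfl⟩, hlt⟩ := lt_sSup_iff.1 h2
    have hcont : ContinuousOn (H ψ R q ψ₀ R₀) (Icc xu s) := fun x hx =>
      (D.hasDerivAt_H ((hxl.trans hlu).trans_le hx.1)).continuousAt.continuousWithinAt
    obtain ⟨β, hβ, hβc⟩ := intermediate_value_Icc hs hcont
      ⟨h1, (EReal.coe_lt_coe_iff.1 hlt).le⟩
    exact ⟨β, hβ.1, hβc⟩
  choose! βc h1 h2 using hex
  have hlt : ∀ {c β : ℝ}, H ψ R q ψ₀ R₀ xu ≤ c → (c : EReal) < ccirc ψ R q ψ₀ R₀ xu → xu ≤ β →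
      H ψ R q ψ₀ R₀ β < c → β < βc c := fun {c β} hc hc' hβ hHβ => by
    by_contra! hle
    have := hmono.monotoneOn (hlu.le.trans (h1 c ⟨hc, hc'⟩)) (hlu.le.trans hβ) hle
    rw [h2 c ⟨hc, hc'⟩] at this
    linarith
  refine ⟨βc, fun c hc hc' => ⟨h1 c ⟨hc, hc'⟩, h2 c ⟨hc, hc'⟩⟩, fun c hc c' hc' hcc => ?_, ?_⟩
  · exact hlt hc'.1 hc'.2 (h1 c hc) (by rwa [h2 c hc])
  · refine tendsto_atTop.2 fun B => ?_
    -- Costs close to c° exceed H(max B x̄), which is below c°, and their boundary points then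
    -- exceed B.
    have hB : xu ≤ max B xu := le_max_right _ _
    have hI := preimage_mem_comap (m := fun c : ℝ => (c : EReal))
      (Ioo_mem_nhdsLT (D.H_lt_ccirc (R₀ := R₀) hxl hlu hpos hB))
    filter_upwards [hI] with c hc
    have hc1 : H ψ R q ψ₀ R₀ (max B xu) < c := EReal.coe_lt_coe_iff.1 hc.1
    have hc2 := hmono.monotoneOn hlu.le (hlu.le.trans hB) hB
    exact (le_max_left B xu).trans (hlt (hc2.trans hc1.le) hc.2 hB hc1).le

/-- A/Ψ is the Ψ-average of θ on ]0, β[, so this form ties the behaviour of H at infinity to that of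
θ. -/
lemma H_eq (D : FreeBoundaryData ψ R q A Ψ θ g κ ξ ψ₀) {β : ℝ} (hβ : 0 < β) :
    H ψ R q ψ₀ R₀ β = -(A β / Ψ β) - q β * ψ₀ + R₀ := by
  rw [H, ← D.relation β hβ]
  ring

/-- As θ decreases beyond ξ, it either tends to −∞ or is bounded below. A lower bound on θ bounds
its average A/Ψ from below and H from above, since q increases. If θ → −∞, the average becomes
arbitrarily negative because Ψ → ∞, and the term −qψ(0) cannot hurt as q ≤ 0. -/
lemma ccirc_eq_top_iff (D : FreeBoundaryData ψ R q A Ψ θ g κ ξ ψ₀) (hξ : ξ < xl) (hlu : xl < xu)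
    (hpos : ∀ x, xl < x → 0 < deriv q x) :
    ccirc ψ R q ψ₀ R₀ xu = ⊤ ↔ Tendsto θ atTop atBot := by
  have hxl : 0 < xl := D.ξ_pos.trans hξ
  have hxu : 0 < xu := hxl.trans hlu
  constructor
  · intro htop
    by_contra hcon
    obtain ⟨B, hB⟩ : ∃ B, ∀ x, xu ≤ x → B ≤ θ x := by
      by_contra! hno
      refine hcon (tendsto_atBot.2 fun B => ?_)
      obtain ⟨x, hx, hxB⟩ := hno B
      filter_upwards [eventually_ge_atTop x] with y hy
      have hξx : ξ ≤ x := (hξ.trans (hlu.trans_le hx)).le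
      exact (D.θ_anti_Ici.antitoneOn hξx (hξx.trans hy) hy).trans hxB.le
    have hm : MonotoneOn (fun y => A y - B * Ψ y) (Ici xu) :=
      monotoneOn_of_hasDerivAt_nonneg (convex_Ici xu)
        (fun y hy => D.hasDerivAt_sub_mul B (hxu.trans_le hy)) fun y hy => by
          rw [interior_Ici] at hy
          exact mul_nonneg (sub_nonneg.2 (hB y (le_of_lt hy))) (D.g_pos y (hxu.trans hy)).le
    have hΨ : MonotoneOn Ψ (Ici xu) := monotoneOn_of_hasDerivAt_nonneg (convex_Ici xu)
      (fun y hy => D.flux_deriv y (hxu.trans_le hy)) fun y hy => by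
        rw [interior_Ici] at hy
        exact (D.g_pos y (hxu.trans hy)).le
    have hle : ∀ β, xu ≤ β →
        H ψ R q ψ₀ R₀ β ≤ -B + |A xu - B * Ψ xu| / Ψ xu - q xu * ψ₀ + R₀ := by
      intro β hβ
      have hβ0 := hxu.trans_le hβ
      rw [D.H_eq hβ0]
      have h1 := hm (mem_Ici.2 le_rfl) hβ hβ
      have h2 := mul_le_mul_of_nonneg_right ((D.q_strictMono hxl hpos).monotoneOn hlu.le
        (hlu.le.trans hβ) hβ) D.psi_zero_nonneg
      have h3 : -(A β / Ψ β) ≤ -B + |A xu - B * Ψ xu| / Ψ xu := by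
        have h4 : |A xu - B * Ψ xu| / Ψ β ≤ |A xu - B * Ψ xu| / Ψ xu :=
          div_le_div_of_nonneg_left (abs_nonneg _) (D.flux_pos xu hxu)
            (hΨ (mem_Ici.2 le_rfl) hβ hβ)
        have h5 : -(A β / Ψ β) ≤ -B + |A xu - B * Ψ xu| / Ψ β := by
          have hp := D.flux_pos β hβ0
          rw [← neg_div, div_le_iff₀ hp, add_mul, div_mul_cancel₀ _ hp.ne']
          dsimp only at h1
          linarith [neg_abs_le (A xu - B * Ψ xu)]
        linarith
      linarith
    have : ccirc ψ R q ψ₀ R₀ xu ≤ ((-B + |A xu - B * Ψ xu| / Ψ xu - q xu * ψ₀ + R₀ : ℝ) : EReal) :=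
      sSup_le (by rintro _ ⟨β, hβ, rfl⟩; exact EReal.coe_le_coe_iff.2 (hle β hβ))
    rw [htop, top_le_iff] at this
    exact EReal.coe_ne_top _ this
  · intro hθ
    refine EReal.eq_top_iff_forall_lt _ |>.2 fun K => ?_
    obtain ⟨x₀, hx₀⟩ := eventually_atTop.1 ((tendsto_atBot.1 hθ (-(K + 2 - R₀))).and
      (eventually_ge_atTop xu))
    -- One unit absorbs the contribution of ]0, x₀] to the average, which is below 1 for large β;
    -- the other is slack.
    set B := -(K + 2 - R₀) with hB
    have hx0 : 0 < x₀ := hxu.trans_le (hx₀ x₀ le_rfl).2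
    have hm : AntitoneOn (fun y => A y - B * Ψ y) (Ici x₀) :=
      antitoneOn_of_hasDerivAt_nonpos (convex_Ici x₀)
        (fun y hy => D.hasDerivAt_sub_mul B (hx0.trans_le hy)) fun y hy => by
          rw [interior_Ici] at hy
          exact mul_nonpos_of_nonpos_of_nonneg (sub_nonpos.2 (hx₀ y (le_of_lt hy)).1)
            (D.g_pos y (hx0.trans hy)).le
    have hz : Tendsto (fun β => (A x₀ - B * Ψ x₀) / Ψ β) atTop (𝓝 0) :=
      D.flux_infty.const_div_atTop _
    obtain ⟨β, hβ1, hβ⟩ := ((hz.eventually (gt_mem_nhds one_pos)).and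
      (eventually_ge_atTop x₀)).exists
    have hβu : xu ≤ β := (hx₀ β hβ).2
    have hβ0 := hxu.trans_le hβu
    refine lt_of_lt_of_le ?_ (le_sSup ⟨β, hβu, rfl⟩)
    rw [EReal.coe_lt_coe_iff, D.H_eq hβ0]
    have h1 := hm (mem_Ici.2 le_rfl) hβ hβ
    have h3 : q β * ψ₀ ≤ 0 := mul_nonpos_of_nonpos_of_nonneg
      (D.q_nonpos hxl hpos (hlu.le.trans hβu)) D.psi_zero_nonneg
    have h4 : A β / Ψ β ≤ B + (A x₀ - B * Ψ x₀) / Ψ β := by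
      have hp := D.flux_pos β hβ0
      rw [div_le_iff₀ hp, add_mul, div_mul_cancel₀ _ hp.ne']
      dsimp only at h1
      linarith
    linarith

/-- Beyond the free boundary point, `θ` is smaller than its average. -/
lemma θ_lt (D : FreeBoundaryData ψ R q A Ψ θ g κ ξ ψ₀) (hξ : ξ < xl)
    (hpos : ∀ x, xl < x → 0 < deriv q x) {β x : ℝ} (hβ : xl < β) (hx : β ≤ x) :
    θ x < R β - q β * ψ β := by
  have hβ0 : 0 < β := (D.ξ_pos.trans hξ).trans hβ
  -- Positivity of q'(β) says that θ(β) is below the average A/Ψ = R − qψ at β, and θ decreases from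
  -- there on.
  have h1 := hpos β hβ
  rw [D.deriv_q hβ0, mul_pos_iff_of_pos_left (D.κ_pos β hβ0)] at h1
  have h2 : θ β < A β / Ψ β := by
    rw [lt_div_iff₀ (D.flux_pos β hβ0)]; linarith
  have h3 := D.relation β hβ0
  have h4 := D.θ_anti_Ici.antitoneOn (hξ.trans hβ).le ((hξ.trans hβ).le.trans hx) hx
  linarith

end Critical

end FreeBoundaryData

end ImpulseControl


namespace ImpulseControl

variable {b σ r φ ψ h k : ℝ → ℝ} {C : ℝ}

/-! ### Linearity of the operator -/

lemma opL_congr {u v : ℝ → ℝ} {x : ℝ} (huv : u =ᶠ[𝓝 x] v) : opL b σ r u x = opL b σ r v x := by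
  simp only [opL, huv.deriv.deriv_eq, huv.deriv_eq, huv.eq_of_nhds]

lemma opL_add {u v : ℝ → ℝ} (hu : ContDiffOn ℝ 2 u (Ioi 0)) (hv : ContDiffOn ℝ 2 v (Ioi 0))
    {x : ℝ} (hx : 0 < x) :
    opL b σ r (fun y => u y + v y) x = opL b σ r u x + opL b σ r v x := by
  have h1 : ∀ y, 0 < y → HasDerivAt (fun y => u y + v y) (deriv u y + deriv v y) y := fun y hy =>
    (hasDerivAt_of_contDiffOn_two isOpen_Ioi hu hy).1.add
      (hasDerivAt_of_contDiffOn_two isOpen_Ioi hv hy).1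
  have h2 : deriv (deriv fun y => u y + v y) x = deriv (deriv u) x + deriv (deriv v) x := by
    refine HasDerivAt.deriv (((hasDerivAt_of_contDiffOn_two isOpen_Ioi hu hx).2.add
      (hasDerivAt_of_contDiffOn_two isOpen_Ioi hv hx).2).congr_of_eventuallyEq ?_)
    filter_upwards [Ioi_mem_nhds hx] with y hy
    exact (h1 y hy).deriv
  simp only [opL, h2, (h1 x hx).deriv]
  ring

lemma opL_const_mul (a : ℝ) (u : ℝ → ℝ) (x : ℝ) :
    opL b σ r (fun y => a * u y) x = a * opL b σ r u x := by
  have h1 : deriv (fun y => a * u y) = fun y => a * deriv u y := by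
    ext y
    exact deriv_const_mul_field a
  simp only [opL, h1, deriv_const_mul_field]
  ring

lemma opL_add_const (u : ℝ → ℝ) (a x : ℝ) :
    opL b σ r (fun y => u y + a) x = opL b σ r u x - r x * a := by
  have h1 : deriv (fun y => u y + a) = deriv u := by
    ext y
    exact deriv_add_const a
  simp only [opL, h1]
  ring

/-! ### Regularity of the primitive of the marginal profit -/

lemma AbsolutelyContinuousOnInterval.congr' {f g : ℝ → ℝ} {u v : ℝ}
    (hf : AbsolutelyContinuousOnInterval f u v) (hfg : EqOn f g (uIcc u v)) :
    AbsolutelyContinuousOnInterval g u v := by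
  rw [absolutelyContinuousOnInterval_iff] at hf ⊢
  intro ε hε
  obtain ⟨δ, hδ, hE⟩ := hf ε hε
  refine ⟨δ, hδ, fun E hE1 hE2 => ?_⟩
  have hs : ∑ i ∈ Finset.range E.1, dist (f (E.2 i).1) (f (E.2 i).2)
      = ∑ i ∈ Finset.range E.1, dist (g (E.2 i).1) (g (E.2 i).2) :=
    Finset.sum_congr rfl fun i hi => by rw [hfg (hE1.1 i hi).1, hfg (hE1.1 i hi).2]
  exact hs ▸ hE E hE1 hE2

lemma continuousOn_of_absolutelyContinuous
    (hk : ∀ u v, 0 < u → u ≤ v → AbsolutelyContinuousOnInterval k u v) :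
    ContinuousOn k (Ioi 0) := by
  intro x (hx : 0 < x)
  have h1 := (hk (x / 2) (2 * x) (half_pos hx) (by linarith)).continuousOn
  rw [uIcc_of_le (by linarith)] at h1
  exact (h1.continuousAt (Icc_mem_nhds (half_lt_self hx) (by linarith))).continuousWithinAt

lemma intervalIntegrable_of_continuousOn (hc : ContinuousOn k (Ioi 0))
    (hint : IntegrableOn k (Ioc 0 1)) {x : ℝ} (hx : 0 < x) : IntervalIntegrable k volume 0 x := by
  have h0 : IntervalIntegrable k volume 0 1 :=
    (intervalIntegrable_iff_integrableOn_Ioc_of_le zero_le_one).2 hint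
  refine h0.trans (hc.mono fun y hy => ?_).intervalIntegrable
  exact (lt_min one_pos hx).trans_le hy.1

lemma hasDerivAt_primK (hc : ContinuousOn k (Ioi 0)) (hint : IntegrableOn k (Ioc 0 1)) {x : ℝ}
    (hx : 0 < x) : HasDerivAt (primK k) (k x) x :=
  intervalIntegral.integral_hasDerivAt_right (intervalIntegrable_of_continuousOn hc hint hx)
    (hc.stronglyMeasurableAtFilter isOpen_Ioi x hx) (hc.continuousAt (Ioi_mem_nhds hx))

lemma tendsto_primK_zero (hint : IntegrableOn k (Ioc 0 1)) :
    Tendsto (primK k) (𝓝[>] 0) (𝓝 0) := by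
  have h := intervalIntegral.continuousOn_primitive_interval (a := 0) (b := 1) (μ := volume)
    (f := k) (by rwa [uIcc_of_le zero_le_one, integrableOn_Icc_iff_integrableOn_Ioc])
  rw [uIcc_of_le zero_le_one] at h
  have h0 := (h 0 (left_mem_Icc.2 zero_le_one)).tendsto
  rw [intervalIntegral.integral_same] at h0
  refine h0.mono_left ?_
  rw [← nhdsWithin_Ioc_eq_nhdsGT one_pos]
  exact nhdsWithin_mono _ Ioc_subset_Icc_self

/-- An absolutely continuous function whose derivative is continuous is of class `C¹`. -/
lemma hasDerivAt_of_absolutelyContinuous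
    (hk : ∀ u v, 0 < u → u ≤ v → AbsolutelyContinuousOnInterval k u v)
    (hd : ContinuousOn (deriv k) (Ioi 0)) {x : ℝ} (hx : 0 < x) : HasDerivAt k (deriv k x) x := by
  have h2 : 0 < x / 2 := half_pos hx
  have hsub : uIcc (x / 2) x ⊆ Ioi 0 := fun y hy => by
    rw [uIcc_of_le (by linarith)] at hy; exact h2.trans_le hy.1
  have h := (intervalIntegral.integral_hasDerivAt_right (hd.mono hsub).intervalIntegrable
    (hd.stronglyMeasurableAtFilter isOpen_Ioi x hx)
    (hd.continuousAt (Ioi_mem_nhds hx))).add_const (k (x / 2))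
  refine h.congr_of_eventuallyEq ?_
  filter_upwards [Ioi_mem_nhds (half_lt_self hx)] with y hy
  rw [(hk (x / 2) y h2 (le_of_lt hy)).integral_deriv_eq_sub]
  ring

/-- K'' is k', a priori defined only almost everywhere. Solving 𝓛K for K'', with σ > 0, shows that
k' has a continuous version on ]0, ∞[, and absolute continuity makes k of class C¹. -/
lemma contDiffOn_primK (hcoef : RegularCoefficients b σ) (hr : DiscountRate r)
    (hk : ∀ u v, 0 < u → u ≤ v → AbsolutelyContinuousOnInterval k u v)
    (hint : IntegrableOn k (Ioc 0 1)) (hL : ContinuousOn (opL b σ r (primK k)) (Ioi 0)) :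
    ContDiffOn ℝ 2 (primK k) (Ioi 0) := by
  have hc := continuousOn_of_absolutelyContinuous hk
  have h1 : ∀ x, 0 < x → deriv (primK k) x = k x := fun x hx => (hasDerivAt_primK hc hint hx).deriv
  -- This holds at every point: where k is not differentiable, both sides take the default value 0.
  have h2 : ∀ x, 0 < x → deriv (deriv (primK k)) x = deriv k x := fun x hx => by
    refine Filter.EventuallyEq.deriv_eq ?_
    filter_upwards [Ioi_mem_nhds hx] with y hy
    exact h1 y hy
  have hKc : ContinuousOn (primK k) (Ioi 0) := fun x hx =>
    (hasDerivAt_primK hc hint hx).continuousAt.continuousWithinAt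
  have hd : ContinuousOn (deriv k) (Ioi 0) := by
    have : ContinuousOn (fun x => 2 * (opL b σ r (primK k) x - b x * k x + r x * primK k x)
        / σ x ^ 2) (Ioi 0) :=
      (continuousOn_const.mul ((hL.sub (hcoef.continuousOn_drift.mul hc)).add
        (hr.continuousOn_Ioi.mul hKc))).div (hcoef.continuousOn_vol.pow 2)
        fun x hx => (pow_pos (hcoef.vol_pos x hx) 2).ne'
    refine this.congr fun x hx => ?_
    have hσ := (hcoef.vol_pos x hx).ne'
    simp only [opL, h1 x hx, h2 x hx]
    field_simp
    ring
  exact contDiffOn_two_of_hasDerivAt isOpen_Ioi (fun x hx => hasDerivAt_primK hc hint hx)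
    (fun x hx => hasDerivAt_of_absolutelyContinuous hk hd hx) hd

/-! ### The free-boundary data of the control problem -/

/-- Everything follows from q = `greenFlux`/Ψ and the identity R Ψ − `greenFlux` ψ = A, which is the
Wronskian relation with the upper integral eliminated. The formula for q' is the quotient rule
combined with this identity. -/
lemma freeBoundaryData (hcoef : RegularCoefficients b σ) (hr : DiscountRate r)
    (hinfty : InftyNatural b σ)
    (hfund : FundamentalSolutions b σ r φ ψ) (hC : 0 < C)
    (hW : ∀ x, 0 < x → φ x * flux b σ ψ x - ψ x * flux b σ φ x = C)
    {Θ R : ℝ → ℝ} (hΘ : ContinuousOn Θ (Ioi 0)) (hint : GreenIntegrable b σ φ ψ Θ)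
    (hR : ∀ x, 0 < x → R x = green b σ φ ψ C Θ x)
    {ξ ψ₀ : ℝ} (hξ : 0 < ξ) (hmono : StrictMonoOn (fun x => Θ x / r x) (Ioo 0 ξ))
    (hanti : StrictAntiOn (fun x => Θ x / r x) (Ioi ξ)) (h₀ : 0 ≤ ψ₀)
    (h₀lt : ∀ x, 0 < x → ψ₀ < ψ x) (h₀lim : Tendsto ψ (𝓝[>] 0) (𝓝 ψ₀)) :
    FreeBoundaryData ψ R (ratio R ψ) (lowerInt b σ ψ Θ) (flux b σ ψ) (fun x => Θ x / r x)
      (fun x => speedDensity b σ x * (r x * ψ x))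
      (fun x => speedDensity b σ x * r x / flux b σ ψ x ^ 2) ξ ψ₀ := by
  have hRd : ∀ x, 0 < x → HasDerivAt R (scaleDeriv b σ x * greenFlux b σ φ ψ C Θ x) x := by
    intro x hx
    refine (hasDerivAt_green hcoef hfund hΘ hint hx).congr_of_eventuallyEq ?_
    filter_upwards [Ioi_mem_nhds hx] with y hy
    exact hR y hy
  have hq : ∀ x, 0 < x → ratio R ψ x = greenFlux b σ φ ψ C Θ x / flux b σ ψ x := by
    intro x hx
    rw [ratio, (hRd x hx).deriv, deriv_eq_scaleDeriv_mul_flux b σ ψ,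
      mul_div_mul_left _ _ (scaleDeriv_pos b σ x).ne']
  have hrel : ∀ x, 0 < x → green b σ φ ψ C Θ x * flux b σ ψ x - greenFlux b σ φ ψ C Θ x * ψ x
      = lowerInt b σ ψ Θ x := by
    intro x hx
    rw [green, greenFlux, div_mul_eq_mul_div, div_mul_eq_mul_div, ← sub_div, div_eq_iff hC.ne']
    linear_combination lowerInt b σ ψ Θ x * hW x hx
  refine
    { psi_deriv := fun x hx => hfund.hasDerivAt_psi hx
      psi_incr := hfund.psi_incr
      psi_deriv_cont := (continuousOn_derivs_of_contDiffOn_two isOpen_Ioi hfund.psi_smooth).2.1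
      psi_infty := hfund.psi_infty
      psi_zero := h₀lim
      psi_zero_nonneg := h₀
      psi_zero_lt := h₀lt
      R_deriv := fun x hx => ?_
      R_growth := ?_
      flux_deriv := fun x hx => hfund.hasDerivAt_flux_psi hcoef hx
      flux_pos := fun x hx => hfund.flux_psi_pos hx
      flux_zero := hfund.tendsto_flux_psi_zero hcoef
      flux_infty := hfund.tendsto_flux_psi_atTop hcoef hr hinfty
      g_pos := fun x hx => mul_pos (speedDensity_pos hcoef hx)
        (mul_pos (hr.pos hx) (hfund.psi_pos x hx))
      A_deriv := fun x hx => ?_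
      A_zero := tendsto_lowerInt_zero hint
      q_deriv := fun x hx => ?_
      κ_pos := fun x hx => div_pos (mul_pos (speedDensity_pos hcoef hx) (hr.pos hx))
        (pow_pos (hfund.flux_psi_pos hx) 2)
      relation := fun x hx => ?_
      θ_cont := hΘ.div hr.continuousOn_Ioi fun x hx => (hr.pos hx).ne'
      ξ_pos := hξ
      θ_mono := hmono
      θ_anti := hanti }
  · rw [ratio, div_mul_cancel₀ _ (hfund.psi_incr x hx).ne']
    exact (hRd x hx).differentiableAt.hasDerivAt
  · refine (tendsto_green_div_psi (C := C) hfund hint).congr' ?_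
    filter_upwards [eventually_gt_atTop 0] with x hx
    rw [hR x hx]
  · refine (hasDerivAt_lowerInt hcoef hfund hΘ hint hx).congr_deriv ?_
    have := (hr.pos hx).ne'
    field_simp
  · have hΨ := (hfund.flux_psi_pos (b := b) (σ := σ) hx).ne'
    have h1 := (hasDerivAt_greenFlux hcoef hfund hC hW hΘ hint hx).div
      (hfund.hasDerivAt_flux_psi hcoef hx) hΨ
    refine (h1.congr_of_eventuallyEq ?_).congr_deriv ?_
    · filter_upwards [Ioi_mem_nhds hx] with y hy
      exact hq y hy
    · rw [← hrel x hx]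
      have := (hr.pos hx).ne'
      field_simp
      ring
  · have hΨ := (hfund.flux_psi_pos (b := b) (σ := σ) hx).ne'
    rw [hq x hx, hR x hx, ← hrel x hx]
    field_simp
    ring

/-! ### Verification of the HJB equation -/

/-- Smooth fit: since the derivative vanishes at β, stopping the function there keeps it
differentiable. -/
lemma hasDerivAt_comp_min {E e : ℝ → ℝ} (hE : ∀ x, 0 < x → HasDerivAt E (e x) x) {β : ℝ}
    (hβ : 0 < β) (heβ : e β = 0) {x : ℝ} (hx : 0 < x) :
    HasDerivAt (fun y => E (min y β)) (e (min x β)) x := by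
  rcases lt_trichotomy x β with hlt | heq | hgt
  · rw [min_eq_left hlt.le]
    refine (hE x hx).congr_of_eventuallyEq ?_
    filter_upwards [Iio_mem_nhds hlt] with y hy
    rw [min_eq_left (le_of_lt hy)]
  · subst heq
    rw [min_self, heβ, ← hasDerivWithinAt_univ, ← Iic_union_Ici (a := x)]
    refine HasDerivWithinAt.union ?_ ?_
    · refine ((heβ ▸ hE x hx).hasDerivWithinAt (s := Iic x)).congr (fun y hy => ?_) ?_
      · rw [min_eq_left hy]
      · rw [min_self]
    · refine (hasDerivWithinAt_const x (Ici x) (E x)).congr (fun y hy => ?_) ?_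
      · rw [min_eq_right hy]
      · rw [min_self]
  · rw [min_eq_right hgt.le, heβ]
    refine (hasDerivAt_const x (E β)).congr_of_eventuallyEq ?_
    filter_upwards [Ioi_mem_nhds hgt] with y hy
    rw [min_eq_right (le_of_lt hy)]

lemma contDiffOn_one_of_hasDerivAt {u u₁ : ℝ → ℝ} {s : Set ℝ} (hs : IsOpen s)
    (h₁ : ∀ x ∈ s, HasDerivAt u (u₁ x) x) (hc : ContinuousOn u₁ s) : ContDiffOn ℝ 1 u s := by
  rw [show (1 : WithTop ℕ∞) = 0 + 1 from rfl, contDiffOn_succ_iff_deriv_of_isOpen hs]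
  refine ⟨fun x hx => (h₁ x hx).differentiableAt.differentiableWithinAt, by simp, ?_⟩
  rw [contDiffOn_zero]
  exact hc.congr fun x hx => (h₁ x hx).deriv

section Verification

variable {E w : ℝ → ℝ} {β c E₀ : ℝ}

/-- The form K + E(min(x, β)) covers both branches of the candidate at once, and regularity at β
reduces to E'(β) = 0. -/
lemma hasDerivAt_candidate (hKd : ∀ x, 0 < x → HasDerivAt (primK k) (k x) x)
    (hE : ContDiffOn ℝ 2 E (Ioi 0)) (hβ : 0 < β) (hEβ : deriv E β = 0)
    (hw : ∀ x, 0 < x → w x = primK k x + E (min x β)) {x : ℝ} (hx : 0 < x) :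
    HasDerivAt w (k x + deriv E (min x β)) x := by
  refine ((hKd x hx).add (hasDerivAt_comp_min (e := deriv E)
    (fun y hy => (hasDerivAt_of_contDiffOn_two isOpen_Ioi hE hy).1) hβ hEβ
    hx)).congr_of_eventuallyEq ?_
  filter_upwards [Ioi_mem_nhds hx] with y hy
  exact hw y hy

lemma contDiffOn_one_candidate (hkc : ContinuousOn k (Ioi 0))
    (hKd : ∀ x, 0 < x → HasDerivAt (primK k) (k x) x)
    (hE : ContDiffOn ℝ 2 E (Ioi 0)) (hβ : 0 < β) (hEβ : deriv E β = 0)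
    (hw : ∀ x, 0 < x → w x = primK k x + E (min x β)) : ContDiffOn ℝ 1 w (Ioi 0) :=
  contDiffOn_one_of_hasDerivAt isOpen_Ioi
    (fun _ hx => hasDerivAt_candidate hKd hE hβ hEβ hw hx)
    (hkc.add ((continuousOn_derivs_of_contDiffOn_two isOpen_Ioi hE).2.1.comp
      (continuous_id.min continuous_const).continuousOn fun _ hx => lt_min (mem_Ioi.1 hx) hβ))

lemma contDiffOn_two_candidate (hK : ContDiffOn ℝ 2 (primK k) (Ioi 0))
    (hE : ContDiffOn ℝ 2 E (Ioi 0))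
    (hw : ∀ x, 0 < x → w x = primK k x + E (min x β)) : ContDiffOn ℝ 2 w (Ioi 0 \ {β}) := by
  rintro x ⟨hx, hxβ⟩
  have hx : 0 < x := hx
  have hKx := hK.contDiffAt (Ioi_mem_nhds hx)
  refine ContDiffAt.contDiffWithinAt ?_
  rcases lt_or_gt_of_ne (show x ≠ β from hxβ) with hlt | hgt
  · refine (hKx.add (hE.contDiffAt (Ioi_mem_nhds hx))).congr_of_eventuallyEq ?_
    filter_upwards [Ioi_mem_nhds hx, Iio_mem_nhds hlt] with y hy hy'
    rw [hw y hy, min_eq_left (le_of_lt hy')]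
  · refine (hKx.add (contDiffAt_const (c := E β))).congr_of_eventuallyEq ?_
    filter_upwards [Ioi_mem_nhds hx, Ioi_mem_nhds hgt] with y hy hy'
    rw [hw y hy, min_eq_right (le_of_lt hy')]

/-- The derivative is k plus E'(min(x, β)), and E' is Lipschitz on compact intervals because E is
C². -/
lemma absolutelyContinuous_deriv_candidate
    (hk : ∀ u v, 0 < u → u ≤ v → AbsolutelyContinuousOnInterval k u v)
    (hKd : ∀ x, 0 < x → HasDerivAt (primK k) (k x) x)
    (hE : ContDiffOn ℝ 2 E (Ioi 0)) (hβ : 0 < β) (hEβ : deriv E β = 0)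
    (hw : ∀ x, 0 < x → w x = primK k x + E (min x β)) {u v : ℝ} (hu : 0 < u) (huv : u ≤ v) :
    AbsolutelyContinuousOnInterval (deriv w) u v := by
  have hE1 : ContDiffOn ℝ 1 (deriv E) (Ioi 0) := hE.deriv_of_isOpen isOpen_Ioi (by norm_num)
  have hsub : Icc (min u β) (min v β) ⊆ Ioi 0 := fun y hy => (lt_min hu hβ).trans_le hy.1
  obtain ⟨L, hL⟩ := (hE1.mono hsub).exists_lipschitzOnWith one_ne_zero (convex_Icc _ _)
    isCompact_Icc
  have hmin : LipschitzOnWith 1 (fun x : ℝ => min x β) (uIcc u v) :=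
    (LipschitzWith.id.min_const β).lipschitzOnWith
  have hcomp : LipschitzOnWith (L * 1) (deriv E ∘ fun x => min x β) (uIcc u v) :=
    hL.comp hmin fun x hx => by
      rw [uIcc_of_le huv] at hx
      exact ⟨min_le_min_right β hx.1, min_le_min_right β hx.2⟩
  refine AbsolutelyContinuousOnInterval.congr'
    ((hk u v hu huv).add hcomp.absolutelyContinuousOnInterval) fun x hx => ?_
  rw [uIcc_of_le huv] at hx
  exact (hasDerivAt_candidate hKd hE hβ hEβ hw (hu.trans_le hx.1)).deriv.symm

lemma integral_candidate (hkc : ContinuousOn k (Ioi 0))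
    (hKd : ∀ x, 0 < x → HasDerivAt (primK k) (k x) x)
    (hE : ContDiffOn ℝ 2 E (Ioi 0)) (hβ : 0 < β) (hEβ : deriv E β = 0)
    (hw : ∀ x, 0 < x → w x = primK k x + E (min x β)) {y x : ℝ} (hy : 0 < y) (hyx : y ≤ x) :
    ∫ s in y..x, (k s - deriv w s) = E (min y β) - E (min x β) := by
  have hsub : uIcc y x ⊆ Ioi 0 := fun z hz => by
    rw [uIcc_of_le hyx] at hz; exact hy.trans_le hz.1
  have hd : ∀ z ∈ uIcc y x, HasDerivAt (fun z => primK k z - w z) (k z - deriv w z) z :=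
    fun z hz => (hKd z (hsub hz)).sub
      (hasDerivAt_candidate hKd hE hβ hEβ hw (hsub hz)).differentiableAt.hasDerivAt
  have hwc : ContinuousOn (deriv w) (Ioi 0) :=
    (contDiffOn_one_candidate hkc hKd hE hβ hEβ hw).continuousOn_deriv_of_isOpen isOpen_Ioi le_rfl
  rw [intervalIntegral.integral_eq_sub_of_hasDerivAt hd
    ((hkc.sub hwc).mono hsub).intervalIntegrable, hw x (hy.trans_le hyx), hw y hy]
  ring

/-- The candidate function solves the HJB equation. -/
lemma solvesHJB_candidate
    (hk : ∀ u v, 0 < u → u ≤ v → AbsolutelyContinuousOnInterval k u v)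
    (hKd : ∀ x, 0 < x → HasDerivAt (primK k) (k x) x)
    (hE : ContDiffOn ℝ 2 E (Ioi 0)) (hβ : 0 < β) (hEβ : deriv E β = 0)
    (hw : ∀ x, 0 < x → w x = primK k x + E (min x β))
    (hanti : AntitoneOn E (Ioc 0 β)) (hE₀ : Tendsto E (𝓝[>] 0) (𝓝 E₀)) (hc : E₀ - E β = c)
    (hbelow : ∀ x, 0 < x → x < β → opL b σ r w x + h x = 0)
    (habove : ∀ x, β < x → opL b σ r w x + h x ≤ 0) : SolvesHJB b σ r h k c w := by
  have hkc := continuousOn_of_absolutelyContinuous hk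
  refine ⟨contDiffOn_one_candidate hkc hKd hE hβ hEβ hw,
    fun u v hu huv => absolutelyContinuous_deriv_candidate hk hKd hE hβ hEβ hw hu huv, ?_⟩
  have hEle : ∀ y ∈ Ioc 0 β, E y ≤ E₀ := fun y hy => by
    refine ge_of_tendsto hE₀ ?_
    filter_upwards [Ioo_mem_nhdsGT hy.1] with z hz
    exact hanti ⟨hz.1, hz.2.le.trans hy.2⟩ hy hz.2.le
  have hint : ∀ {x z : ℝ}, 0 < x → z ∈ Ico 0 x →
      ∫ s in (x - z)..x, (k s - deriv w s) = E (min (x - z) β) - E (min x β) := fun hx hz =>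
    integral_candidate hkc hKd hE hβ hEβ hw (sub_pos.2 hz.2) (by linarith [hz.1])
  have hsup : ∀ x, 0 < x →
      (⨆ z ∈ Ico 0 x, ((∫ s in (x - z)..x, (k s - deriv w s) : ℝ) : EReal)) ≤ (c : EReal) := by
    intro x hx
    refine iSup₂_le fun z hz => EReal.coe_le_coe_iff.2 ?_
    have hxz : 0 < x - z := sub_pos.2 hz.2
    rw [hint hx hz]
    have h1 := hEle (min (x - z) β) ⟨lt_min hxz hβ, min_le_right _ _⟩
    have h2 := hanti ⟨lt_min hx hβ, min_le_right _ _⟩ ⟨hβ, le_rfl⟩ (min_le_right x β)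
    linarith
  have hcc : ((-c : ℝ) : EReal) + (c : EReal) = 0 := by
    rw [← EReal.coe_add, neg_add_cancel, EReal.coe_zero]
  -- The point β is discarded because w need not be twice differentiable there.
  have hne : ∀ᵐ x ∂(volume.restrict (Ioi (0 : ℝ))), x ≠ β :=
    ae_restrict_of_ae (compl_mem_ae_iff.2 (measure_singleton β))
  filter_upwards [ae_restrict_mem measurableSet_Ioi, hne] with x hx hxβ
  have hx : 0 < x := hx
  rcases lt_or_gt_of_ne hxβ with hlt | hgt
  · rw [hbelow x hx hlt, EReal.coe_zero, max_eq_left]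
    exact (add_le_add le_rfl (hsup x hx)).trans_eq hcc
  -- The supremum need not be attained: it is approached by impulses that bring the state x down to
  -- y ↓ 0.
  · have hge : (c : EReal) ≤
        ⨆ z ∈ Ico 0 x, ((∫ s in (x - z)..x, (k s - deriv w s) : ℝ) : EReal) := by
      have hlim : Tendsto (fun y => ((E y - E β : ℝ) : EReal)) (𝓝[>] 0) (𝓝 (c : EReal)) := by
        rw [← hc]
        exact EReal.tendsto_coe.2 (hE₀.sub_const _)
      refine le_of_tendsto hlim ?_
      filter_upwards [Ioo_mem_nhdsGT hβ] with y hy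
      have hz : x - y ∈ Ico 0 x := ⟨by linarith [hy.2], by linarith [hy.1]⟩
      have h1 := hint hx hz
      rw [sub_sub_cancel, min_eq_left hy.2.le, min_eq_right hgt.le] at h1
      rw [← h1]
      refine le_iSup₂_of_le (x - y) hz ?_
      rw [sub_sub_cancel]
    rw [le_antisymm (hsup x hx) hge, hcc, max_eq_right]
    exact_mod_cast habove x hgt

end Verification

end ImpulseControl

/-! ### Assembly: the representations of K and R_h, and the verification of the candidate. -/

theorem mainTheorem6
    {Ω : Type*} [mΩ : MeasurableSpace Ω] (P : Measure Ω) [IsProbabilityMeasure P]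
    (𝓕 : Filtration ℝ≥0 mΩ)
    (b σ r h k φ ψ : ℝ → ℝ) (X : ℝ → ℝ≥0 → Ω → ℝ)
    (hcoef : ImpulseControl.RegularCoefficients b σ)
    (hzero : ImpulseControl.ZeroInaccessible b σ)
    (hinfty : ImpulseControl.InftyNatural b σ)
    (hX : ∀ x, 0 < x → ImpulseControl.IsDiffusion b σ 𝓕 P x (X x))
    (hr : ImpulseControl.DiscountRate r)
    (hfund : ImpulseControl.FundamentalSolutions b σ r φ ψ)
    (hpay : ImpulseControl.PayoffConditions b σ r h k ψ P X)
    (Rh Θ q : ℝ → ℝ)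
    (hRh : Rh = ImpulseControl.RF r P X h)
    (hΘ : Θ = ImpulseControl.Theta b σ r h k)
    (hq : q = ImpulseControl.ratio (ImpulseControl.RF r P X Θ) ψ)
    (hxl : ImpulseControl.xLower q < ⊤)
    (hxu : ImpulseControl.xUpper q < ⊤) :
    -- `x̲` is the sign change point of `q'`
    (∀ x : ℝ, 0 < x → x < (ImpulseControl.xLower q).toReal → deriv q x < 0) ∧
    (∀ x : ℝ, (ImpulseControl.xLower q).toReal < x → 0 < deriv q x) ∧
    -- the constants `K_∞`, `R_h(0)` and `ψ(0)` are well-defined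
    ∃ Kinf R0 psi0 : ℝ,
      0 ≤ Kinf ∧
      Tendsto (fun x => ImpulseControl.primK k x / ψ x) atTop (𝓝 Kinf) ∧
      Tendsto Rh (𝓝[>] 0) (𝓝 R0) ∧
      Tendsto ψ (𝓝[>] 0) (𝓝 psi0) ∧
      ∃ cstar : ℝ, 0 < cstar ∧
        ImpulseControl.IsCriticalCost q ψ
          (ImpulseControl.xLower q).toReal (ImpulseControl.xUpper q).toReal cstar ∧
        ∃ (ccirc : EReal) (βcirc : ℝ → ℝ),
          -- part (I)
          (cstar : EReal) < ccirc ∧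
          StrictMonoOn βcirc {c : ℝ | cstar ≤ c ∧ (c : EReal) < ccirc} ∧
          (∀ c : ℝ, cstar ≤ c → (c : EReal) < ccirc →
            (ImpulseControl.xUpper q).toReal ≤ βcirc c ∧
            ImpulseControl.freeBdry q ψ 0 (βcirc c) = -c) ∧
          Tendsto βcirc (comap (fun c : ℝ => (c : EReal)) (𝓝[<] ccirc)) atTop ∧
          -- part (II)
          (ccirc = ⊤ ↔ Tendsto (fun x => Θ x / r x) atTop atBot) ∧
          -- part (III)
          ∀ c : ℝ, cstar ≤ c → (c : EReal) < ccirc →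
            ∀ w : ℝ → ℝ, w = ImpulseControl.wZero Rh q ψ k Kinf R0 psi0 c (βcirc c) →
              ContDiffOn ℝ 1 w (Ioi 0) ∧
              ContDiffOn ℝ 2 w (Ioi 0 \ {βcirc c}) ∧
              ImpulseControl.SolvesHJB b σ r h k c w ∧
              BddBelow (w '' Ioi 0) := by
  open ImpulseControl FreeBoundaryData in
  obtain ⟨C, hC, hW⟩ := hfund.exists_wronskian hcoef
  set K := primK k with hKdef
  set LK := opL b σ r K with hLK
  have hΘfun : Θ = fun x => h x + LK x := hΘ
  have hΘc : ContinuousOn Θ (Ioi 0) := hΘ ▸ hpay.theta_cont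
  have hLKc : ContinuousOn LK (Ioi 0) := by
    refine (hΘc.sub hpay.h_cont).congr fun x _ => ?_
    rw [hΘfun]
    simp
  have hkc := continuousOn_of_absolutelyContinuous hpay.k_ac
  have hKd : ∀ x, 0 < x → HasDerivAt K (k x) x := fun x hx =>
    hasDerivAt_primK hkc hpay.k_int hx
  have hK2 : ContDiffOn ℝ 2 K (Ioi 0) := contDiffOn_primK hcoef hr hpay.k_ac hpay.k_int hLKc
  obtain ⟨gh, hgh⟩ := RF_eq_green hX hcoef hr hfund hC hW hpay.h_cont hpay.h_int
  obtain ⟨gL, hgL⟩ := RF_eq_green hX hcoef hr hfund hC hW hLKc hpay.Lk_int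
  obtain ⟨gΘ, hgΘ⟩ := RF_eq_green hX hcoef hr hfund hC hW hΘc
    (by rw [hΘfun]; exact DiscountedIntegrable.add hX hr hpay.h_cont hpay.h_int hpay.Lk_int)
  set R := RF r P X Θ with hRdef
  obtain ⟨ψ₀, h₀, h₀lt, h₀lim⟩ := hfund.exists_psi_zero
  obtain ⟨ξ, hξ, hmono, hanti⟩ := hpay.theta_shape
  rw [← hΘ] at hmono hanti
  have D := freeBoundaryData hcoef hr hinfty hfund hC hW hΘc gΘ hgΘ hξ hmono hanti h₀ h₀lt h₀lim
  rw [← hq] at D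
  obtain ⟨xl, hxl', hξxl, hneg, hpos⟩ := D.exists_xLower hxl
  have hxl0 : 0 < xl := hξ.trans hξxl
  obtain ⟨xu, hxu', hlu, hq0, hqlt⟩ := D.exists_xUpper hxl0 hneg hpos hxu
  obtain ⟨R₀, hR₀⟩ := D.exists_R_zero hxl0 hneg hqlt
  -- the representation of `K`
  have hgL2 : ContDiffOn ℝ 2 (green b σ φ ψ C LK) (Ioi 0) :=
    contDiffOn_green hcoef hr hfund hC hW hLKc gL
  obtain ⟨a₁, Kinf, hrep⟩ := hfund.exists_coeff hcoef (hK2.add hgL2) (fun x hx => by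
    have h1 := opL_add (b := b) (σ := σ) (r := r) hK2 hgL2 hx
    rw [opL_green hcoef hr hfund hC hW hLKc gL hx] at h1
    exact h1.trans (add_neg_cancel _))
  have hKφ : Tendsto (fun x => K x / φ x) (𝓝[>] 0) (𝓝 0) :=
    (tendsto_primK_zero hpay.k_int).div_atTop hfund.phi_zero
  -- K + R_{𝓛K} is negligible against φ at 0, and so is ψ; hence there is no φ-component.
  have ha₁ : a₁ = 0 := by
    have h1 := hKφ.add (tendsto_green_div_phi (C := C) hfund gL)
    have h2 := (hfund.tendsto_psi_div_phi.const_mul Kinf).const_add a₁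
    have h3 := tendsto_nhds_unique (h2.congr' ?_) h1
    · simpa using h3
    · filter_upwards [self_mem_nhdsWithin] with x hx
      have := (hfund.phi_pos x hx).ne'
      have h3 := hrep x hx
      change K x + green b σ φ ψ C LK x = _ at h3
      rw [← add_div, h3]
      field_simp
  have hKg : ∀ x, 0 < x → K x + green b σ φ ψ C LK x = Kinf * ψ x := fun x hx => by
    have h3 := hrep x hx
    rw [ha₁, zero_mul, zero_add] at h3
    exact h3
  have hψpos := hfund.psi_pos
  have hKψ : Tendsto (fun x => K x / ψ x) atTop (𝓝 Kinf) := by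
    have h1 := (tendsto_green_div_psi (C := C) hfund gL).const_sub Kinf
    rw [sub_zero] at h1
    refine h1.congr' ?_
    filter_upwards [eventually_gt_atTop 0] with x hx
    have h2 := (hψpos x hx).ne'
    rw [eq_sub_of_add_eq (hKg x hx)]
    field_simp
  -- The representation makes K/ψ converge, so the limit superior in the growth condition is the
  -- limit.
  have hKinf : 0 ≤ Kinf := by
    obtain ⟨l, hl0, hl⟩ := hpay.k_growth
    rw [(EReal.tendsto_coe.2 hKψ).limsup_eq, EReal.coe_eq_coe_iff] at hl
    exact hl ▸ hl0
  -- R_h = R_Θ − R_{𝓛K}, and R_{𝓛K} = K_∞ψ − K.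
  have hgreen : ∀ x, 0 < x → green b σ φ ψ C h x = R x + K x - Kinf * ψ x := fun x hx => by
    have h1 := green_add (C := C) gh gL hx
    rw [hgΘ x hx, ← hKg x hx, hΘfun, h1]
    ring
  have hRhx : ∀ x, 0 < x → Rh x = R x + K x - Kinf * ψ x := fun x hx => by
    rw [hRh, hgh x hx, hgreen x hx]
  have hRh0 : Tendsto Rh (𝓝[>] 0) (𝓝 (R₀ - Kinf * ψ₀)) := by
    have h1 := (hR₀.add (tendsto_primK_zero hpay.k_int)).sub (h₀lim.const_mul Kinf)
    rw [add_zero] at h1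
    refine h1.congr' ?_
    filter_upwards [self_mem_nhdsWithin] with x hx
    exact (hRhx x hx).symm
  obtain ⟨βc, hβc, hβmono, hβlim⟩ := D.exists_βcirc (R₀ := R₀) hxl0 hlu hpos
  rw [hxl', hxu', EReal.toReal_coe, EReal.toReal_coe]
  refine ⟨hneg, hpos, Kinf, R₀ - Kinf * ψ₀, ψ₀, hKinf, hKψ, hRh0, h₀lim, H ψ R q ψ₀ R₀ xu,
    D.H_pos hR₀ hxl0 hlu hpos hqlt, D.isCriticalCost hR₀ hxl0 hlu hneg hpos hq0 hqlt,
    ccirc ψ R q ψ₀ R₀ xu, βc, D.H_lt_ccirc hxl0 hlu hpos le_rfl, hβmono, fun c hc hc' => ?_, hβlim,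
    D.ccirc_eq_top_iff hξxl hlu hpos, fun c hc hc' w hw => ?_⟩
  · obtain ⟨h1, h2⟩ := hβc c hc hc'
    refine ⟨h1, ?_⟩
    rw [D.freeBdry_zero hR₀ hxl0 hlu hpos hqlt h1, h2]
  obtain ⟨hβu, hHβ⟩ := hβc c hc hc'
  set β := βc c
  have hlβ : xl < β := hlu.trans_le hβu
  have hβ0 : 0 < β := hxl0.trans hlβ
  set E : ℝ → ℝ := fun x => R x - q β * ψ x with hEdef
  have hEd : ∀ x, 0 < x → HasDerivAt E ((q x - q β) * deriv ψ x) x := fun x hx =>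
    D.hasDerivAt_sub_psi (q β) hx
  have hE : ContDiffOn ℝ 2 E (Ioi 0) :=
    ((contDiffOn_green hcoef hr hfund hC hW hΘc gΘ).congr hgΘ).sub
      (contDiffOn_const.mul hfund.psi_smooth)
  have hEβ : deriv E β = 0 := by rw [(hEd β hβ0).deriv, sub_self, zero_mul]
  have hE₀ : Tendsto E (𝓝[>] 0) (𝓝 (R₀ - q β * ψ₀)) := hR₀.sub (h₀lim.const_mul _)
  have hEc : R₀ - q β * ψ₀ - E β = c := by
    rw [← hHβ, H, hEdef]
    ring
  have hEanti : AntitoneOn E (Ioc 0 β) :=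
    antitoneOn_of_hasDerivAt_nonpos (convex_Ioc 0 β) (fun y hy => hEd y hy.1) fun y hy => by
      rw [interior_Ioc] at hy
      exact mul_nonpos_of_nonpos_of_nonneg
        (sub_nonpos.2 (D.q_le hxl0 hlu hpos hqlt hβu hy.1 hy.2.le)) (hfund.psi_incr y hy.1).le
  have hwE : ∀ x, 0 < x → w x = K x + E (min x β) := by
    intro x hx
    rw [hw, wZero]
    split_ifs with hxβ
    · rw [min_eq_left hxβ.le, hRhx x hx]
      simp only [hEdef]
      ring
    · rw [min_eq_right (not_lt.1 hxβ), ← hEc]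
      simp only [hEdef]
      ring
  refine ⟨contDiffOn_one_candidate hkc hKd hE hβ0 hEβ hwE, contDiffOn_two_candidate hK2 hE hwE,
    solvesHJB_candidate hpay.k_ac hKd hE hβ0 hEβ hwE hEanti hE₀ hEc (fun x hx hxβ => ?_)
      (fun x hβx => ?_), ?_⟩
  · have h1 : w =ᶠ[𝓝 x] fun y => green b σ φ ψ C h y + (Kinf - q β) * ψ y := by
      filter_upwards [Ioo_mem_nhds hx hxβ] with y hy
      rw [hwE y hy.1, min_eq_left hy.2.le, hgreen y hy.1]
      simp only [hEdef]
      ring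
    rw [opL_congr h1, opL_add (contDiffOn_green hcoef hr hfund hC hW hpay.h_cont gh)
      (contDiffOn_const.mul hfund.psi_smooth) hx, opL_const_mul, hfund.psi_ode x hx,
      opL_green hcoef hr hfund hC hW hpay.h_cont gh hx]
    ring
  · have hx : 0 < x := hβ0.trans hβx
    have h1 : w =ᶠ[𝓝 x] fun y => K y + E β := by
      filter_upwards [Ioi_mem_nhds hx, Ioi_mem_nhds hβx] with y hy hy'
      rw [hwE y hy, min_eq_right (le_of_lt hy')]
    -- Here w is K plus the constant E(β), so 𝓛w + h = Θ − rE(β), and the claim is that θ stays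
    -- below E(β).
    have h2 := D.θ_lt hξxl hpos hlβ hβx.le
    rw [div_lt_iff₀ (hr.pos hx), hΘfun] at h2
    rw [opL_congr h1, opL_add_const]
    simp only [hEdef]
    linarith
  -- E decreases on ]0, β], so E(min(x, β)) ≥ E(β), and K is bounded below.
  · obtain ⟨m, hm⟩ := hpay.k_bdd
    refine ⟨m + E β, ?_⟩
    rintro _ ⟨x, hx, rfl⟩
    rw [hwE x hx]
    exact add_le_add (hm ⟨x, hx, rfl⟩)
      (hEanti ⟨lt_min hx hβ0, min_le_right _ _⟩ ⟨hβ0, le_rfl⟩ (min_le_right _ _))
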